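/- Let $K=SO(3,\mathbb R)$ with Haar probability measure $dk$. For $x=(x_1,x_2,x_3)\in\mathbb R^3$ write $x=\begin{pmatrix}1&x_2&x_3\\&1&x_1\\&&1\end{pmatrix}$ for the corresponding element of the group $U(\mathbb R)$ of upper-triangular unipotent real $3\times3$ matrices, with measure $dx=dx_1dx_2dx_3$, and for $t\in\mathbb R^2$ put $\psi_t(x)=e^{2\pi i(t_1x_1+t_2x_2)}$. Every $g\in GL(3,\mathbb R)/\mathbb R^\times$ has a unique Iwasawa decomposition $g=x\,y\,k$ with $x\in U(\mathbb R)$, $y=\mathrm{diag}(y_1y_2,y_1,1)$, $y_1,y_2>0$, $k\in K$. Let $d\in\{0,1\}$, and let $\mathcal D^d:K\to U(2d+1)$ be the Wigner $\mathcal D$-matrix of weight $d$, with rows and columns indexed by $-d,\dots,d$: $\mathcal D^0$ is trivial, and $\mathcal D^1$ is the standard representation of $SO(3)$ written in the orthonormal basis $(1,-i,0)/\sqrt2,\ (0,0,1),\ -(1,i,0)/\sqrt2$, so that the rotation by $\theta$ about the third axis goes to $\mathrm{diag}(e^{i\theta},1,e^{-i\theta})$. Let $V$ be the group of the four matrices $v_{\varepsilon_1,\varepsilon_2}=\mathrm{diag}(\varepsilon_1,\varepsilon_1\varepsilon_2,\varepsilon_2)$,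 $\varepsilon_i=\pm1$, let $\chi^d$ be the character of $V$ with $\chi^d(v_{-1,1})=1$ and $\chi^d(v_{1,-1})=(-1)^d$, and set $\Sigma^d_d=\frac14\sum_{v\in V}\chi^d(v)\mathcal D^d(v)$. Let $\mathfrak a=\{\mu\in\mathbb C^3:\mu_1+\mu_2+\mu_3=0\}$ and $\mathfrak a^d_0=\{\mu\in\mathfrak a:\mathrm{Re}(\mu_i)=0,\ i=1,2,3\}$. For $\mu\in\mathfrak a$ define $$I^d_\mu(xyk)=y_1^{1-\mu_3}y_2^{1+\mu_1}\,\mathcal D^d(k),\qquad h^d_\mu(g)=\int_K\mathrm{Tr}\big({}^t\overline{\mathcal D^d(k)}\,\Sigma^d_d\,I^d_\mu(kg)\big)\,dk .$$ Let $w_l=-\begin{pmatrix}&&1\\&1&\\1&&\end{pmatrix}$ and let $W^d(g,\mu,\psi_t)$ be the matrix-valued Jacquet--Whittaker function: the holomorphic continuation in $\mu$ of $$\int_{U(\mathbb R)}I^d_\mu(w_lug)\,\overline{\psi_t(u)}\,du ,$$ which converges absolutely for $\mathrm{Re}(\mu_1)>\mathrm{Re}(\mu_2)>\mathrm{Re}(\mu_3)$.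 Fix a continuous integrable function $\alpha:\mathbb R\to\mathbb R$ with $\alpha(0)=1$ whose Fourier transform is smooth and compactly supported. **Proposition.** Let $d\in\{0,1\}$ and $t\in\mathbb R^2$ with $t_1t_2\ne0$. For every $\mu\in\mathfrak a^d_0$ and every $R>0$ the integral $$\int_{U(\mathbb R)}\alpha(x_1/R)\,\alpha(x_2/R)\,h^d_\mu(x)\,\overline{\psi_t(x)}\,dx$$ converges absolutely, and as $R\to\infty$ it converges to $$\frac1{2\pi^2}\,\mathrm{Tr}\Big({}^t\overline{W^d(I,-\bar\mu,\psi_t)}\;\Sigma^d_d\;W^d(I,\mu,\psi_t)\Big).$$ The convergence is normal in $\mu$, i.e. uniform on every compact subset of $\mathfrak a^d_0$. -/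

import Mathlib

open MeasureTheory Matrix
open scoped ContDiff FourierTransform ComplexConjugate Topology

noncomputable section

namespace GL3

/-! ### The group `G = GL(3,ℝ)/ℝˣ`, its unipotent subgroup, and the Iwasawa decomposition

Elements of `G` are represented by invertible real matrices. -/

/-- The element of `U(ℝ)` with coordinates `x = (x₁, x₂, x₃)`; Haar measure on `U(ℝ)` is Lebesgue
measure `dx₁ dx₂ dx₃`. -/
def unip (x : ℝ × ℝ × ℝ) : Matrix (Fin 3) (Fin 3) ℝ :=
  !![1, x.2.1, x.2.2; 0, 1, x.1; 0, 0, 1]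

/-- The character `ψ_t(x) = e(t₁ x₁ + t₂ x₂)` of `U(ℝ)`, with `e(z) = exp(2πiz)`. -/
def psi (t : ℝ × ℝ) (x : ℝ × ℝ × ℝ) : ℂ :=
  Complex.exp (2 * Real.pi * Complex.I * ((t.1 * x.1 + t.2 * x.2.1 : ℝ) : ℂ))

/-- The element `diag(y₁ y₂, y₁, 1)` of `Y⁺`. -/
def diagY (y₁ y₂ : ℝ) : Matrix (Fin 3) (Fin 3) ℝ :=
  !![y₁ * y₂, 0, 0; 0, y₁, 0; 0, 0, 1]

/-- The long Weyl element. -/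
def wLong : Matrix (Fin 3) (Fin 3) ℝ := -!![0, 0, 1; 0, 1, 0; 1, 0, 0]

/-- Euclidean length of a vector in `ℝ³`. -/
def len (v : Fin 3 → ℝ) : ℝ := √(v ⬝ᵥ v)

/-- The `y₁`-coordinate of the Iwasawa decomposition `g = r · x · diag(y₁y₂, y₁, 1) · k`. -/
def iwaY₁ (g : Matrix (Fin 3) (Fin 3) ℝ) : ℝ := len (g 1 ⨯₃ g 2) / len (g 2) ^ 2

/-- The `y₂`-coordinate of the Iwasawa decomposition `g = r · x · diag(y₁y₂, y₁, 1) · k`. -/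
def iwaY₂ (g : Matrix (Fin 3) (Fin 3) ℝ) : ℝ := |g.det| * len (g 2) / len (g 1 ⨯₃ g 2) ^ 2

/-- The `K`-part of the Iwasawa decomposition `g = r · x · diag(y₁y₂, y₁, 1) · k`, by the
Gram-Schmidt process on the rows of `g`, starting from the last one. -/
def iwaK (g : Matrix (Fin 3) (Fin 3) ℝ) : Matrix (Fin 3) (Fin 3) ℝ :=
  let k₁ : Fin 3 → ℝ := (len (g 1 ⨯₃ g 2))⁻¹ • (g 1 ⨯₃ g 2)
  let k₃ : Fin 3 → ℝ := (SignType.sign g.det * (len (g 2))⁻¹ : ℝ) • g 2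
  Matrix.of ![k₁, k₃ ⨯₃ k₁, k₃]

/-- The maximal compact subgroup `K = SO(3,ℝ)`. -/
abbrev SO3 : Submonoid (Matrix (Fin 3) (Fin 3) ℝ) := Matrix.specialOrthogonalGroup (Fin 3) ℝ

theorem mem_SO3_iff (k : Matrix (Fin 3) (Fin 3) ℝ) : k ∈ SO3 ↔ k * kᵀ = 1 ∧ k.det = 1 := by
  rw [Matrix.mem_specialOrthogonalGroup_iff, Matrix.mem_orthogonalGroup_iff]

theorem len_pos {v : Fin 3 → ℝ} (hv : v ≠ 0) : 0 < len v := by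
  apply Real.sqrt_pos.2
  have := Matrix.dotProduct_self_star_pos_iff (v := v)
  simpa using this.2 hv

theorem len_sq (v : Fin 3 → ℝ) : len v ^ 2 = v 0 ^ 2 + v 1 ^ 2 + v 2 ^ 2 := by
  rw [len, Real.sq_sqrt] <;> simp [dotProduct, Fin.sum_univ_three] <;> nlinarith [sq_nonneg (v 0), sq_nonneg (v 1), sq_nonneg (v 2)]


theorem len_smul (c : ℝ) (v : Fin 3 → ℝ) : len (c • v) = |c| * len v := by
  rw [len, len, smul_dotProduct, dotProduct_smul, smul_eq_mul, smul_eq_mul, ← mul_assoc,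
    Real.sqrt_mul (mul_self_nonneg c), Real.sqrt_mul_self_eq_abs]

theorem adjugate_of_mem_SO3 {k : Matrix (Fin 3) (Fin 3) ℝ} (hk : k ∈ SO3) : k.adjugate = kᵀ := by
  obtain ⟨h1, h2⟩ := (mem_SO3_iff k).1 hk
  have h3 : k * k.adjugate = 1 := by rw [Matrix.mul_adjugate, h2, one_smul]
  have h4 : kᵀ * k = 1 := mul_eq_one_comm.1 h1
  calc k.adjugate = kᵀ * k * k.adjugate := by rw [h4, Matrix.one_mul]
    _ = kᵀ := by rw [Matrix.mul_assoc, h3, Matrix.mul_one]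

theorem len_row_of_mem_SO3 {k : Matrix (Fin 3) (Fin 3) ℝ} (hk : k ∈ SO3) (i : Fin 3) :
    len (k i) = 1 := by
  have h := congrFun (congrFun ((mem_SO3_iff k).1 hk).1 i) i
  rw [Matrix.mul_apply', Matrix.one_apply_eq] at h
  have h' : k i ⬝ᵥ k i = 1 := h
  rw [len, h', Real.sqrt_one]

theorem cross_of_mem_SO3 {k : Matrix (Fin 3) (Fin 3) ℝ} (hk : k ∈ SO3) :
    k 1 ⨯₃ k 2 = k 0 ∧ k 2 ⨯₃ k 0 = k 1 := by
  have h := adjugate_of_mem_SO3 hk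
  rw [Matrix.adjugate_fin_three] at h
  have e : ∀ i j, _ := fun i j => congrFun (congrFun h i) j
  constructor <;> ext j <;> fin_cases j <;> simp [cross_apply]
  · have := e 0 0; simp at this; linarith
  · have := e 1 0; simp at this; linarith
  · have := e 2 0; simp at this; linarith
  · have := e 0 1; simp at this; linarith
  · have := e 1 1; simp at this; linarith
  · have := e 2 1; simp at this; linarith

/-- The Iwasawa decomposition is unique. -/
theorem iwasawa_unique (r y₁ y₂ : ℝ) (x : ℝ × ℝ × ℝ) (k : Matrix (Fin 3) (Fin 3) ℝ)
    (hr : r ≠ 0) (h₁ : 0 < y₁) (h₂ : 0 < y₂) (hk : k ∈ SO3) :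
    iwaY₁ (r • (unip x * diagY y₁ y₂ * k)) = y₁ ∧
    iwaY₂ (r • (unip x * diagY y₁ y₂ * k)) = y₂ ∧
    iwaK (r • (unip x * diagY y₁ y₂ * k)) = k := by
  set g := r • (unip x * diagY y₁ y₂ * k) with hg
  obtain ⟨c0, c1⟩ := cross_of_mem_SO3 hk
  have g2 : g 2 = r • k 2 := by
    ext j
    simp only [hg, Matrix.smul_apply, Pi.smul_apply, smul_eq_mul]
    simp only [unip, diagY, Matrix.mul_apply, Fin.sum_univ_three]
    simp
  have g1 : g 1 = (r * y₁) • k 1 + (r * x.1) • k 2 := by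
    ext j
    simp only [hg, Matrix.smul_apply, Pi.add_apply, Pi.smul_apply, smul_eq_mul]
    simp only [unip, diagY, Matrix.mul_apply, Fin.sum_univ_three]
    simp
    ring
  have gc : g 1 ⨯₃ g 2 = (r ^ 2 * y₁) • k 0 := by
    rw [g1, g2, ← c0]
    simp only [map_add, map_smul, LinearMap.add_apply, LinearMap.smul_apply, cross_self, smul_zero,
      add_zero, smul_smul]
    congr 1
    ring
  have hdet : g.det = r ^ 3 * (y₁ ^ 2 * y₂) := by
    rw [hg, Matrix.det_smul, Matrix.det_mul, Matrix.det_mul, ((mem_SO3_iff k).1 hk).2]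
    have e : (unip x).det = 1 := by rw [Matrix.det_fin_three]; simp [unip]
    have e' : (diagY y₁ y₂).det = y₁ ^ 2 * y₂ := by
      rw [Matrix.det_fin_three]
      simp [diagY]
      ring
    rw [e, e', Fintype.card_fin]
    ring

  have hr2 : 0 < r ^ 2 := by positivity
  have l2 : len (g 2) = |r| := by rw [g2, len_smul, len_row_of_mem_SO3 hk, mul_one]
  have lc : len (g 1 ⨯₃ g 2) = r ^ 2 * y₁ := by
    rw [gc, len_smul, len_row_of_mem_SO3 hk, mul_one, abs_of_pos (by positivity)]
  have hra : 0 < |r| := abs_pos.2 hr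
  refine ⟨?_, ?_, ?_⟩
  · rw [iwaY₁, lc, l2, sq_abs]
    field_simp
  · rw [iwaY₂, lc, l2, hdet, abs_mul, abs_of_pos (show 0 < y₁ ^ 2 * y₂ by positivity), abs_pow,
      ← sq_abs r]
    field_simp
  · have hs : (SignType.sign g.det : ℝ) * |r|⁻¹ * r = 1 := by
      rw [hdet]
      rcases lt_or_gt_of_ne hr with h | h
      · have : r ^ 3 * (y₁ ^ 2 * y₂) < 0 :=
          mul_neg_of_neg_of_pos (Odd.pow_neg (by decide) h) (by positivity)
        rw [sign_neg this, abs_of_neg h]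
        simp
        field_simp
      · have : 0 < r ^ 3 * (y₁ ^ 2 * y₂) := by positivity
        rw [sign_pos this, abs_of_pos h]
        simp
        field_simp
    have k0 : (len (g 1 ⨯₃ g 2))⁻¹ • (g 1 ⨯₃ g 2) = k 0 := by
      rw [lc, gc, smul_smul, inv_mul_cancel₀ (by positivity), one_smul]
    have k2 : ((SignType.sign g.det : ℝ) * (len (g 2))⁻¹) • g 2 = k 2 := by
      rw [l2, g2, smul_smul, hs, one_smul]
    simp only [iwaK]
    rw [k0, k2, c1]
    ext i j
    fin_cases i <;> rfl

theorem frame_mem_SO3 {u w : Fin 3 → ℝ} (hu : u 0 ^ 2 + u 1 ^ 2 + u 2 ^ 2 = 1)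
    (hw : w 0 ^ 2 + w 1 ^ 2 + w 2 ^ 2 = 1) (huw : u 0 * w 0 + u 1 * w 1 + u 2 * w 2 = 0) :
    (Matrix.of ![u, w ⨯₃ u, w] : Matrix (Fin 3) (Fin 3) ℝ) ∈ SO3 := by
  have key : (w 1 * u 2 - w 2 * u 1) ^ 2 + (w 2 * u 0 - w 0 * u 2) ^ 2 +
      (w 0 * u 1 - w 1 * u 0) ^ 2 = 1 := by
    linear_combination (u 0 ^ 2 + u 1 ^ 2 + u 2 ^ 2) * hw + hu -
      (u 0 * w 0 + u 1 * w 1 + u 2 * w 2) * huw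
  rw [mem_SO3_iff]
  constructor
  · ext i j
    fin_cases i <;> fin_cases j <;>
      simp [Matrix.mul_apply, Fin.sum_univ_three, cross_apply]
    · linear_combination hu
    · ring
    · linear_combination huw
    · ring
    · linear_combination key
    · ring
    · linear_combination huw
    · ring
    · linear_combination hw
  · rw [Matrix.det_fin_three]
    simp [cross_apply]
    linear_combination key

/-- Every invertible matrix has an Iwasawa decomposition. -/
theorem iwasawa_exists (g : Matrix (Fin 3) (Fin 3) ℝ) (hg : g.det ≠ 0) :
    ∃ (r y₁ y₂ : ℝ) (x : ℝ × ℝ × ℝ), ∃ k ∈ SO3, r ≠ 0 ∧ 0 < y₁ ∧ 0 < y₂ ∧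
      g = r • (unip x * diagY y₁ y₂ * k) := by
  have h2 : g 2 ≠ 0 := by
    intro h
    apply hg
    exact Matrix.det_eq_zero_of_row_eq_zero 2 (fun j => congrFun h j)
  have hdc : g.det = g 0 0 * (g 1 ⨯₃ g 2) 0 + g 0 1 * (g 1 ⨯₃ g 2) 1 +
      g 0 2 * (g 1 ⨯₃ g 2) 2 := by
    rw [Matrix.det_fin_three]
    simp [cross_apply]
    ring
  have hc : g 1 ⨯₃ g 2 ≠ 0 := by
    intro h
    apply hg
    rw [hdc, h]
    simp
  have p := len_pos h2
  have q := len_pos hc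
  have hp := len_sq (g 2)
  have hq := len_sq (g 1 ⨯₃ g 2)
  have hac : (g 1 ⨯₃ g 2) 0 * g 2 0 + (g 1 ⨯₃ g 2) 1 * g 2 1 + (g 1 ⨯₃ g 2) 2 * g 2 2 = 0 := by
    simp [cross_apply]
    ring
  have hbc : (g 1 ⨯₃ g 2) 0 * g 1 0 + (g 1 ⨯₃ g 2) 1 * g 1 1 + (g 1 ⨯₃ g 2) 2 * g 1 2 = 0 := by
    simp [cross_apply]
    ring
  have hbk : g 1 0 * (g 2 ⨯₃ (g 1 ⨯₃ g 2)) 0 + g 1 1 * (g 2 ⨯₃ (g 1 ⨯₃ g 2)) 1 +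
      g 1 2 * (g 2 ⨯₃ (g 1 ⨯₃ g 2)) 2 = (g 1 ⨯₃ g 2) 0 ^ 2 + (g 1 ⨯₃ g 2) 1 ^ 2 +
      (g 1 ⨯₃ g 2) 2 ^ 2 := by
    simp [cross_apply]
    ring
  have hak : g 2 0 * (g 2 ⨯₃ (g 1 ⨯₃ g 2)) 0 + g 2 1 * (g 2 ⨯₃ (g 1 ⨯₃ g 2)) 1 +
      g 2 2 * (g 2 ⨯₃ (g 1 ⨯₃ g 2)) 2 = 0 := by
    simp [cross_apply]
    ring
  generalize hcdef : g 1 ⨯₃ g 2 = c at *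
  set n := len (g 2) with hn
  set m := len c with hm
  obtain ⟨s, hs, hsd⟩ : ∃ s : ℝ, s ^ 2 = 1 ∧ 0 < s * g.det := by
    rcases lt_or_gt_of_ne hg with h | h
    · exact ⟨-1, by norm_num, by linarith⟩
    · exact ⟨1, by norm_num, by linarith⟩
  have hs0 : s ≠ 0 := by rintro rfl; norm_num at hs
  have hn0 : n ≠ 0 := p.ne'
  have hm0 : m ≠ 0 := q.ne'
  have hk : (Matrix.of ![m⁻¹ • c, ((s * n⁻¹) • g 2) ⨯₃ (m⁻¹ • c), (s * n⁻¹) • g 2] :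
      Matrix (Fin 3) (Fin 3) ℝ) ∈ SO3 := by
    apply frame_mem_SO3
    · simp only [Pi.smul_apply, smul_eq_mul]
      field_simp
      linarith
    · simp only [Pi.smul_apply, smul_eq_mul]
      field_simp
      rw [hs]
      linarith
    · simp only [Pi.smul_apply, smul_eq_mul]
      linear_combination (m⁻¹ * s * n⁻¹) * hac
  have hk' : ((s * n⁻¹) • g 2) ⨯₃ (m⁻¹ • c) = (s * n⁻¹ * m⁻¹) • (g 2 ⨯₃ c) := by
    simp only [map_smul, LinearMap.smul_apply, smul_smul]
    congr 1
    ring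
  rw [hk'] at hk
  generalize g 2 ⨯₃ c = e at *
  set k : Matrix (Fin 3) (Fin 3) ℝ :=
    Matrix.of ![m⁻¹ • c, (s * n⁻¹ * m⁻¹) • e, (s * n⁻¹) • g 2] with hkdef
  have hkk : kᵀ * k = 1 := mul_eq_one_comm.1 ((mem_SO3_iff k).1 hk).1
  refine ⟨s * n, m / n ^ 2, s * g.det * n / m ^ 2,
    ((g * kᵀ) 1 2 / (s * n), (g * kᵀ) 0 1 * (s * n / m), (g * kᵀ) 0 2 / (s * n)), k, hk,
    by positivity, by positivity, by positivity, ?_⟩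
  have h : g * kᵀ = (s * n) • (unip ((g * kᵀ) 1 2 / (s * n), (g * kᵀ) 0 1 * (s * n / m),
      (g * kᵀ) 0 2 / (s * n)) * diagY (m / n ^ 2) (s * g.det * n / m ^ 2)) := by
    have e00 : (g * kᵀ) 0 0 = g.det / m := by
      rw [hdc]
      simp [Matrix.mul_apply, Fin.sum_univ_three, hkdef]
      field_simp
    have e10 : (g * kᵀ) 1 0 = 0 := by
      simp [Matrix.mul_apply, Fin.sum_univ_three, hkdef]
      linear_combination m⁻¹ * hbc
    have e20 : (g * kᵀ) 2 0 = 0 := by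
      simp [Matrix.mul_apply, Fin.sum_univ_three, hkdef]
      linear_combination m⁻¹ * hac
    have e11 : (g * kᵀ) 1 1 = s * m / n := by
      have : (g * kᵀ) 1 1 = (s * n⁻¹ * m⁻¹) * m ^ 2 := by
        rw [hq, ← hbk]
        simp [Matrix.mul_apply, Fin.sum_univ_three, hkdef]
        ring
      rw [this]
      field_simp
    have e21 : (g * kᵀ) 2 1 = 0 := by
      simp [Matrix.mul_apply, Fin.sum_univ_three, hkdef]
      linear_combination (s * n⁻¹ * m⁻¹) * hak
    have e22 : (g * kᵀ) 2 2 = s * n := by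
      have : (g * kᵀ) 2 2 = (s * n⁻¹) * n ^ 2 := by
        rw [hp]
        simp [Matrix.mul_apply, Fin.sum_univ_three, hkdef]
        ring
      rw [this]
      field_simp
    generalize g * kᵀ = b at *
    ext i j
    fin_cases i <;> fin_cases j <;>
      simp [unip, diagY, e00, e10, e20, e11, e21, e22]
    all_goals field_simp
    all_goals simp [hs]
  have h' := congrArg (· * k) h
  simpa only [Matrix.mul_assoc, hkk, Matrix.mul_one, Matrix.smul_mul] using h'

/-! ### Haar probability measure on `K` -/

instance : MeasurableSpace SO3 := borel SO3

instance : BorelSpace SO3 := ⟨rfl⟩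

instance : IsTopologicalGroup SO3 where
  continuous_mul := continuous_mul
  continuous_inv := by
    refine Continuous.subtype_mk (f := fun k : SO3 => (k : Matrix (Fin 3) (Fin 3) ℝ)ᵀ) ?_ _
    exact continuous_subtype_val.matrix_transpose

instance : CompactSpace SO3 := by
  have hcl : IsClosed (SO3 : Set (Matrix (Fin 3) (Fin 3) ℝ)) := by
    have : (SO3 : Set (Matrix (Fin 3) (Fin 3) ℝ)) = {k | k * kᵀ = 1} ∩ {k | k.det = 1} := by
      ext k
      exact mem_SO3_iff k
    rw [this]
    exact (isClosed_eq (by fun_prop) continuous_const).inter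
      (isClosed_eq (by fun_prop) continuous_const)
  have hco : IsCompact (Set.pi Set.univ (fun _ : Fin 3 => Set.pi Set.univ
      (fun _ : Fin 3 => Set.Icc (-1 : ℝ) 1))) :=
    isCompact_univ_pi fun _ => isCompact_univ_pi fun _ => isCompact_Icc
  refine isCompact_iff_compactSpace.1 (hco.of_isClosed_subset hcl ?_)
  intro k hk i _ j _
  have h := congrFun (congrFun ((mem_SO3_iff k).1 hk).1 i) i
  simp only [Matrix.mul_apply, Matrix.transpose_apply, Matrix.one_apply_eq] at h
  have h1 : k i j * k i j ≤ 1 := by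
    rw [← h]
    exact Finset.single_le_sum (f := fun j => k i j * k i j) (fun j _ => mul_self_nonneg _)
      (Finset.mem_univ j)
  exact ⟨by nlinarith, by nlinarith⟩

/-- Haar probability measure `dk` on `K`. -/
def haarK : Measure SO3 := Measure.haarMeasure ⊤

/-! ### Wigner matrices of weight `0` and `1`, and the projections `Σ^d_d` -/

/-- The columns of this unitary matrix are the standard basis vectors
`(1, -i, 0)/√2`, `(0, 0, 1)`, `-(1, i, 0)/√2` of weights `-1, 0, 1`. -/
def sphBasis : Matrix (Fin 3) (Fin 3) ℂ :=
  !![(√2 : ℂ)⁻¹, 0, -(√2 : ℂ)⁻¹; -Complex.I * (√2 : ℂ)⁻¹, 0, -Complex.I * (√2 : ℂ)⁻¹; 0, 1, 0]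

/-- The Wigner matrix `𝒟^d(k)` for the weights `d = 0, 1`. Rows and columns `-d, …, d` are numbered
from `0` to `2d`. For `d = 0` it is the trivial representation; for `d = 1` it is the standard
representation of `SO(3)`, written in the basis in which rotations about the third axis by `θ`
act as `diag(e^{iθ}, 1, e^{-iθ})`. -/
def wignerD : (d : Fin 2) → Matrix (Fin 3) (Fin 3) ℝ →
    Matrix (Fin (2 * (d : ℕ) + 1)) (Fin (2 * (d : ℕ) + 1)) ℂ
  | 0, _ => (1 : Matrix (Fin 1) (Fin 1) ℂ)
  | 1, k => (sphBasisᴴ * k.map (fun a : ℝ => (a : ℂ)) * sphBasis : Matrix (Fin 3) (Fin 3) ℂ)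

theorem wignerD_rot (θ : ℝ) :
    wignerD 1 !![Real.cos θ, -Real.sin θ, 0; Real.sin θ, Real.cos θ, 0; 0, 0, 1] =
      (Matrix.diagonal ![Complex.exp (Complex.I * θ), 1, Complex.exp (-(Complex.I * θ))] :
        Matrix (Fin 3) (Fin 3) ℂ) := by
  have hs : (√2 : ℂ)⁻¹ * (√2 : ℂ)⁻¹ = 1 / 2 := by
    rw [← mul_inv, ← Complex.ofReal_mul, Real.mul_self_sqrt (by norm_num)]
    norm_num
  have e1 : Complex.exp (Complex.I * θ) = Complex.cos θ + Complex.sin θ * Complex.I := by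
    rw [mul_comm, Complex.exp_mul_I]
  have e2 : Complex.exp (-(Complex.I * θ)) = Complex.cos θ - Complex.sin θ * Complex.I := by
    rw [show -(Complex.I * θ) = (-θ : ℂ) * Complex.I by ring, Complex.exp_mul_I, Complex.cos_neg,
      Complex.sin_neg]
    ring
  have hI : Complex.I ^ 2 = -1 := Complex.I_sq
  rw [e1, e2]
  change sphBasisᴴ * _ * sphBasis = _
  ext i j
  fin_cases i <;> fin_cases j <;>
    simp [sphBasis, Matrix.mul_apply, Fin.sum_univ_three, Matrix.conjTranspose_apply]
  · linear_combination (2 * Complex.cos θ + 2 * Complex.sin θ * Complex.I) * hs -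
      (√2 : ℂ)⁻¹ * (√2 : ℂ)⁻¹ * Complex.cos θ * hI
  · linear_combination -((√2 : ℂ)⁻¹ * (√2 : ℂ)⁻¹ * Complex.cos θ * hI)
  · linear_combination -((√2 : ℂ)⁻¹ * (√2 : ℂ)⁻¹ * Complex.cos θ * hI)
  · linear_combination (2 * Complex.cos θ - 2 * Complex.sin θ * Complex.I) * hs -
      (√2 : ℂ)⁻¹ * (√2 : ℂ)⁻¹ * Complex.cos θ * hI

theorem wignerD_mul (d : Fin 2) (k k' : Matrix (Fin 3) (Fin 3) ℝ) :
    wignerD d (k * k') = wignerD d k * wignerD d k' := by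
  have hs : (√2 : ℂ)⁻¹ * (√2 : ℂ)⁻¹ = 1 / 2 := by
    rw [← mul_inv, ← Complex.ofReal_mul, Real.mul_self_sqrt (by norm_num)]
    norm_num
  have hu : sphBasis * sphBasisᴴ = 1 := by
    ext i j
    fin_cases i <;> fin_cases j <;>
      simp [sphBasis, Matrix.mul_apply, Fin.sum_univ_three, Matrix.conjTranspose_apply]
    · linear_combination 2 * hs
    · linear_combination 2 * hs - 2 * ((√2 : ℂ)⁻¹ * (√2 : ℂ)⁻¹) * Complex.I_sq
  fin_cases d
  · exact (Matrix.mul_one (1 : Matrix (Fin 1) (Fin 1) ℂ)).symm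
  · change sphBasisᴴ * (k * k').map (fun a : ℝ => (a : ℂ)) * sphBasis =
      (sphBasisᴴ * k.map (fun a : ℝ => (a : ℂ)) * sphBasis) *
        (sphBasisᴴ * k'.map (fun a : ℝ => (a : ℂ)) * sphBasis)
    have hm : (k * k').map (fun a : ℝ => (a : ℂ)) =
        k.map (fun a : ℝ => (a : ℂ)) * k'.map (fun a : ℝ => (a : ℂ)) :=
      Matrix.map_mul (f := Complex.ofRealHom)
    rw [hm]
    calc _ = sphBasisᴴ * k.map (fun a : ℝ => (a : ℂ)) * 1 *
          k'.map (fun a : ℝ => (a : ℂ)) * sphBasis := by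
          simp only [Matrix.mul_assoc, Matrix.one_mul]
      _ = _ := by
          rw [← hu]
          simp only [Matrix.mul_assoc]

/-- The element `v_{ε₁,ε₂} = diag(ε₁, ε₁ε₂, ε₂)` of `V`, with `ε₁ = (-1)^a` and `ε₂ = (-1)^b`. -/
def vElt (a b : Fin 2) : Matrix (Fin 3) (Fin 3) ℝ :=
  Matrix.diagonal ![(-1) ^ (a : ℕ), (-1) ^ ((a : ℕ) + (b : ℕ)), (-1) ^ (b : ℕ)]

/-- The character `χ_{η₁,η₂}` of `V` with `χ(v_{-1,1}) = η₁` and `χ(v_{1,-1}) = η₂`, evaluated at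
`v_{(-1)^a,(-1)^b}`. -/
def chiV (η₁ η₂ : ℂ) (a b : Fin 2) : ℂ := η₁ ^ (a : ℕ) * η₂ ^ (b : ℕ)

/-- `Σ^d_χ = (1/4) ∑_{v ∈ V} χ(v) 𝒟^d(v)` for `χ = χ_{η₁,η₂}`. -/
def sigmaChi (d : Fin 2) (η₁ η₂ : ℂ) :
    Matrix (Fin (2 * (d : ℕ) + 1)) (Fin (2 * (d : ℕ) + 1)) ℂ :=
  (1 / 4 : ℂ) • ∑ a : Fin 2, ∑ b : Fin 2, chiV η₁ η₂ a b • wignerD d (vElt a b)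

/-- `Σ^0_0 = Σ^0_{+,+}` and `Σ^1_1 = Σ^1_{+,-}`. -/
def sigmaMat (d : Fin 2) : Matrix (Fin (2 * (d : ℕ) + 1)) (Fin (2 * (d : ℕ) + 1)) ℂ :=
  sigmaChi d 1 ((-1) ^ (d : ℕ))

theorem sigmaMat_zero : sigmaMat 0 = (1 : Matrix (Fin 1) (Fin 1) ℂ) := by
  have h : ∀ a b, wignerD 0 (vElt a b) = (1 : Matrix (Fin 1) (Fin 1) ℂ) := fun _ _ => rfl
  simp only [sigmaMat, sigmaChi, chiV, h, Fin.sum_univ_two]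
  ext i j
  fin_cases i
  fin_cases j
  simp
  norm_num

theorem sigmaMat_one : sigmaMat 1 = (!![0, 0, 0; 0, 1, 0; 0, 0, 0] : Matrix (Fin 3) (Fin 3) ℂ) := by
  have h : ∀ a b, wignerD 1 (vElt a b) =
    (sphBasisᴴ * (vElt a b).map (fun a : ℝ => (a : ℂ)) * sphBasis :
      Matrix (Fin 3) (Fin 3) ℂ) := fun _ _ => rfl
  simp only [sigmaMat, sigmaChi, chiV, h, Fin.sum_univ_two]
  change (_ : Matrix (Fin 3) (Fin 3) ℂ) = _
  ext i j
  fin_cases i <;> fin_cases j <;>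
    simp [sphBasis, vElt, Matrix.mul_apply, Fin.sum_univ_three, Matrix.conjTranspose_apply,
      Matrix.diagonal]
  all_goals ring

/-! ### Spectral parameters -/

/-- The space `𝔞^0 = 𝔞^1` of `μ ∈ ℂ³` with `μ₁ + μ₂ + μ₃ = 0`. -/
def specA : Submodule ℂ (Fin 3 → ℂ) where
  carrier := {μ | μ 0 + μ 1 + μ 2 = 0}
  add_mem' := by
    intro a b ha hb
    simp only [Set.mem_ofPred_eq, Pi.add_apply] at *
    linear_combination ha + hb
  zero_mem' := by simp
  smul_mem' := by
    intro c a ha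
    simp only [Set.mem_ofPred_eq, Pi.smul_apply, smul_eq_mul] at *
    linear_combination c * ha

/-- The tempered parameters `𝔞^0_0 = 𝔞^1_0`: those with `Re μ_i = 0`. -/
def specA₀ : Set specA := {μ | ∀ i, ((μ : Fin 3 → ℂ) i).re = 0}

/-- The parameter `-μ̄`. -/
def negConj (μ : specA) : specA :=
  ⟨fun i => -conj ((μ : Fin 3 → ℂ) i), by
    have h : (μ : Fin 3 → ℂ) 0 + (μ : Fin 3 → ℂ) 1 + (μ : Fin 3 → ℂ) 2 = 0 := μ.2
    have h' := congrArg conj h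
    simp only [map_add, map_zero] at h'
    change -conj ((μ : Fin 3 → ℂ) 0) + -conj ((μ : Fin 3 → ℂ) 1) + -conj ((μ : Fin 3 → ℂ) 2) = 0
    linear_combination -h'⟩

/-! ### The functions `I^d_μ`, `h^d_μ` and the Jacquet-Whittaker function -/

/-- `p_{ρ+μ}(xyk) = y₁^{1-μ₃} y₂^{1+μ₁}`. -/
def pPow (μ : specA) (g : Matrix (Fin 3) (Fin 3) ℝ) : ℂ :=
  (iwaY₁ g : ℂ) ^ (1 - (μ : Fin 3 → ℂ) 2) * (iwaY₂ g : ℂ) ^ (1 + (μ : Fin 3 → ℂ) 0)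

/-- `I^d_μ(xyk) = p_{ρ+μ}(y) 𝒟^d(k)`. -/
def iFun (d : Fin 2) (μ : specA) (g : Matrix (Fin 3) (Fin 3) ℝ) :
    Matrix (Fin (2 * (d : ℕ) + 1)) (Fin (2 * (d : ℕ) + 1)) ℂ :=
  pPow μ g • wignerD d (iwaK g)

/-- The spherical function of height one
`h^d_μ(g) = ∫_K Tr(ᵗ\bar{𝒟^d(k)} Σ^d_d I^d_μ(kg)) dk`. -/
def sphFun (d : Fin 2) (μ : specA) (g : Matrix (Fin 3) (Fin 3) ℝ) : ℂ :=
  ∫ k : SO3, ((wignerD d (k : Matrix (Fin 3) (Fin 3) ℝ))ᴴ * sigmaMat d *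
    iFun d μ ((k : Matrix (Fin 3) (Fin 3) ℝ) * g)).trace ∂haarK

/-- The Jacquet integral `∫_{U(ℝ)} I^d_μ(w_l u g) \bar{ψ_t(u)} du` (entry by entry). -/
def jacquet (d : Fin 2) (g : Matrix (Fin 3) (Fin 3) ℝ) (t : ℝ × ℝ) (μ : specA) :
    Matrix (Fin (2 * (d : ℕ) + 1)) (Fin (2 * (d : ℕ) + 1)) ℂ :=
  Matrix.of fun i j => ∫ u : ℝ × ℝ × ℝ, iFun d μ (wLong * unip u * g) i j * conj (psi t u)

/-- The region `Re μ₁ > Re μ₂ > Re μ₃`, where the Jacquet integral converges absolutely. -/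
def chamber : Set specA :=
  {μ | ((μ : Fin 3 → ℂ) 1).re < ((μ : Fin 3 → ℂ) 0).re ∧
    ((μ : Fin 3 → ℂ) 2).re < ((μ : Fin 3 → ℂ) 1).re}

/-- `F` is a holomorphic continuation in `μ` of the Jacquet integral to the convex open set `Ω`. -/
structure IsJacquetContinuation (d : Fin 2) (g : Matrix (Fin 3) (Fin 3) ℝ) (t : ℝ × ℝ)
    (Ω : Set specA)
    (F : specA → Matrix (Fin (2 * (d : ℕ) + 1)) (Fin (2 * (d : ℕ) + 1)) ℂ) : Prop where
  isOpen : IsOpen Ω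
  convex : Convex ℝ Ω
  chamber_subset : chamber ⊆ Ω
  holomorphic : ∀ i j, DifferentiableOn ℂ (fun μ => F μ i j) Ω
  eq_jacquet : ∀ μ ∈ chamber, F μ = jacquet d g t μ

open Classical in
/-- The Jacquet-Whittaker function `W^d(g, μ, ψ_t)`: the value at `μ` of the holomorphic
continuation of the Jacquet integral. -/
def whittaker (d : Fin 2) (g : Matrix (Fin 3) (Fin 3) ℝ) (μ : specA) (t : ℝ × ℝ) :
    Matrix (Fin (2 * (d : ℕ) + 1)) (Fin (2 * (d : ℕ) + 1)) ℂ :=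
  if h : ∃ F, ∃ Ω, IsJacquetContinuation d g t Ω F ∧ μ ∈ Ω then h.choose μ else 0

/-- The value of the continuation does not depend on its choice. -/
theorem whittaker_eq {d : Fin 2} {g : Matrix (Fin 3) (Fin 3) ℝ} {t : ℝ × ℝ} {Ω : Set specA}
    {F : specA → Matrix (Fin (2 * (d : ℕ) + 1)) (Fin (2 * (d : ℕ) + 1)) ℂ}
    (hF : IsJacquetContinuation d g t Ω F) {μ : specA} (hμ : μ ∈ Ω) :
    whittaker d g μ t = F μ := by
  have h : ∃ F, ∃ Ω, IsJacquetContinuation d g t Ω F ∧ μ ∈ Ω := ⟨F, Ω, hF, hμ⟩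
  rw [whittaker, dif_pos h]
  obtain ⟨Ω', hF', hμ'⟩ := h.choose_spec
  generalize h.choose = F' at *
  obtain ⟨c, hc⟩ : chamber.Nonempty :=
    ⟨⟨![1, 0, -1], by change (1 : ℂ) + 0 + -1 = 0; ring⟩, by simp [chamber]⟩
  ext i j
  let L : ℂ → specA := fun z => c + z • (μ - c)
  have hL : Differentiable ℂ L := by fun_prop
  let S : Set ℂ := L ⁻¹' (Ω ∩ Ω')
  have hS : IsOpen S := (hF.isOpen.inter hF'.isOpen).preimage hL.continuous
  have hSc : Convex ℝ S := by
    intro z hz w hw a b ha hb hab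
    have := (hF.convex.inter hF'.convex) hz hw ha hb hab
    have e : L (a • z + b • w) = a • L z + b • L w := by
      simp only [L, smul_add, add_smul, smul_assoc]
      rw [show a • c + a • z • (μ - c) + (b • c + b • w • (μ - c)) =
        (a + b) • c + (a • z • (μ - c) + b • w • (μ - c)) by rw [add_smul]; abel, hab, one_smul]
    change L (a • z + b • w) ∈ Ω ∩ Ω'
    rw [e]
    exact this
  have h0 : L 0 = c := by simp [L]
  have h1 : L 1 = μ := by simp [L]
  have m0 : (0 : ℂ) ∈ S := by
    change L 0 ∈ Ω ∩ Ω'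
    rw [h0]
    exact ⟨hF.chamber_subset hc, hF'.chamber_subset hc⟩
  have m1 : (1 : ℂ) ∈ S := by
    change L 1 ∈ Ω ∩ Ω'
    rw [h1]
    exact ⟨hμ, hμ'⟩
  have a' : AnalyticOnNhd ℂ (fun z => F' (L z) i j) S :=
    ((hF'.holomorphic i j).comp hL.differentiableOn fun z hz => hz.2).analyticOnNhd hS
  have a : AnalyticOnNhd ℂ (fun z => F (L z) i j) S :=
    ((hF.holomorphic i j).comp hL.differentiableOn fun z hz => hz.1).analyticOnNhd hS
  have hch : IsOpen chamber := by
    have hr : ∀ k, Continuous fun μ : specA => ((μ : Fin 3 → ℂ) k).re := fun k =>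
      Complex.continuous_re.comp ((continuous_apply k).comp continuous_subtype_val)
    exact (isOpen_lt (hr 1) (hr 0)).inter (isOpen_lt (hr 2) (hr 1))
  have hev : (fun z => F' (L z) i j) =ᶠ[𝓝 0] (fun z => F (L z) i j) := by
    filter_upwards [(hch.preimage hL.continuous).mem_nhds (show L 0 ∈ chamber by rwa [h0])]
      with z hz
    rw [hF.eq_jacquet _ hz, hF'.eq_jacquet _ hz]
  have := a'.eqOn_of_preconnected_of_eventuallyEq a hSc.isPreconnected m0 hev m1
  simpa only [h1] using this

/-- `∫_{U(ℝ)} α(x₁/R) α(x₂/R) h^d_μ(x) \bar{ψ_t(x)} dx` is the integral of this function. -/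
def cutoffIntegrand (α : ℝ → ℝ) (d : Fin 2) (t : ℝ × ℝ) (R : ℝ) (μ : specA)
    (x : ℝ × ℝ × ℝ) : ℂ :=
  (α (x.1 / R) : ℂ) * (α (x.2.1 / R) : ℂ) * sphFun d μ (unip x) * conj (psi t x)

end GL3

end

open GL3

noncomputable section
namespace GL3

/-! ### Integrals along fibres -/

/-! Write A and B for the length of the last row of w_l u and of the cross product of its last two
rows (`lenA`, `lenB`). Then p_{ρ+μ}(w_l u) = A^{-1-z₁} B^{-1-z₂} with z = (μ₂-μ₃, μ₁-μ₂), and the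
entries of the K-part of w_l u are bounded functions Q of u (`IsSymbol`). So W^d(I, μ, ψ_t) is built
from Fourier coefficients over U of functions f = A^{-1-z₁} B^{-1-z₂} Q.

On the big cell the Haar measure of K becomes du / (2π² A² B²), at least for functions that ignore
the signs of the first and last rows (`integral_haarK`). If Re μ = 0, the factor A^{-2} B^{-2} is
exactly what turns the K-integral defining h(x) into 1/(2π²) times a sum of correlations ∫
conj(f_j(u)) f_j(ux) du on U (`integral_haarK_powAB`, `ae_sphFun_eq`). For d = 0 there is one term,
with Q = 1; for d = 1 there are three, from the last row of the K-part. Formally the Fourier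
coefficient of a correlation at t is |f̂_j(t)|², and since -μ̄ = μ these add up to the trace in the
limit.

The difficulty is convergence, because at Re z = 0 the size (AB)^{-1} of f lies at the edge of
integrability. For Re z > 0 everything converges absolutely, and the cutoff merely averages |f̂_j(t
- s/R)|² against α̂(s₁) α̂(s₂) (`integral_cutoff_corr`). Both sides then extend to Re z = 0. On the
cutoff side this is dominated convergence (`tendsto_cutInt`), because integrable weights in x₁ and
x₂ make the double integral of a correlation converge (`lintegral_majU_corr_lt_top`). On the Fourier
side, one integration by parts for each simple root continues t₁ t₂ f̂_j(t), up to a constant, to Re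
z_i > -1/8, jointly continuously in z and t (`exists_continuation`). As α̂ has compact support and
t₁ t₂ ≠ 0, for large R only frequencies t - s/R off the axes occur (`eventually_cutInt_eq`).

The averaged expression is jointly continuous in (1/R, z) up to and including 1/R = 0, where α(0) =
1 makes it |f̂_j(t)|². This gives the limit and its uniformity on compact sets
(`tendstoUniformlyOn_cutInt`). -/

theorem lintegral_affine (f : ℝ → ENNReal) (hf : Measurable f) {a : ℝ} (ha : a ≠ 0) (b : ℝ) :
    ∫⁻ v, ENNReal.ofReal |a| * f (b + a * v) = ∫⁻ y, f y := by
  have h1 : ∫⁻ y, f y = ∫⁻ y, f (b + y) := (lintegral_add_left_eq_self f b).symm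
  have hg : Measurable fun y => f (b + y) := hf.comp (measurable_const_add b)
  have h2 := Real.smul_map_volume_mul_left ha
  rw [h1]
  conv_rhs => rw [← h2]
  rw [lintegral_smul_measure, lintegral_map hg (measurable_const_mul a),
    smul_eq_mul]
  exact lintegral_const_mul _ (hg.comp (measurable_const_mul a))

/-! ### Changes of variables: from nonnegative to complex integrands. -/

section Transfer

variable {X Y : Type*} [MeasurableSpace X] [MeasurableSpace Y] {μ : Measure X} {ν : Measure Y}
  {T : X → Y} {w : X → NNReal}

/-- A measure is determined by its integrals of nonnegative functions, so the hypothesis says that ν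
is the pushforward of w·μ. Changes of variables can thus be checked on nonnegative integrands only,
by Tonelli, and then carried over to integrability and to complex integrals. -/
theorem map_withDensity_of_lintegral (hT : Measurable T) (hw : Measurable w)
    (h : ∀ f : Y → ENNReal, Measurable f → ∫⁻ x, w x * f (T x) ∂μ = ∫⁻ y, f y ∂ν) :
    (μ.withDensity fun x => (w x : ENNReal)).map T = ν := by
  refine Measure.ext_of_lintegral _ fun f hf => ?_
  rw [lintegral_map hf hT, ← h f hf]
  exact lintegral_withDensity_eq_lintegral_mul _ hw.coe_nnreal_ennreal (hf.comp hT)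

theorem integrable_of_lintegral (hT : Measurable T) (hw : Measurable w)
    (h : ∀ f : Y → ENNReal, Measurable f → ∫⁻ x, w x * f (T x) ∂μ = ∫⁻ y, f y ∂ν)
    {f : Y → ℂ} (hf : Measurable f) :
    Integrable (fun x => ((w x : ℝ) : ℂ) * f (T x)) μ ↔ Integrable f ν := by
  have hm := map_withDensity_of_lintegral hT hw h
  rw [← hm, integrable_map_measure hf.aestronglyMeasurable hT.aemeasurable,
    integrable_withDensity_iff_integrable_smul hw]
  rfl

theorem integral_of_lintegral (hT : Measurable T) (hw : Measurable w)
    (h : ∀ f : Y → ENNReal, Measurable f → ∫⁻ x, w x * f (T x) ∂μ = ∫⁻ y, f y ∂ν)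
    {f : Y → ℂ} (hf : Measurable f) :
    ∫ x, ((w x : ℝ) : ℂ) * f (T x) ∂μ = ∫ y, f y ∂ν := by
  have hm := map_withDensity_of_lintegral hT hw h
  rw [← hm, integral_map hT.aemeasurable hf.aestronglyMeasurable,
    integral_withDensity_eq_integral_smul hw]
  rfl

end Transfer

theorem lintegral_triple (f : ℝ × ℝ × ℝ → ENNReal) (hf : Measurable f) :
    ∫⁻ u, f u = ∫⁻ a, ∫⁻ b, ∫⁻ c, f (a, b, c) := by
  rw [Measure.volume_eq_prod, lintegral_prod _ hf.aemeasurable]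
  refine lintegral_congr fun a => ?_
  rw [Measure.volume_eq_prod, lintegral_prod _ (by fun_prop)]

/-- The substitution `u₃ = b(u₁,u₂) + a(u₁,u₂) v`. -/
theorem lintegral_fibre (a b : ℝ → ℝ → ℝ) (ha : Measurable (Function.uncurry a))
    (hb : Measurable (Function.uncurry b)) (ha0 : ∀ x y, a x y ≠ 0)
    (f : ℝ × ℝ × ℝ → ENNReal) (hf : Measurable f) :
    ∫⁻ u : ℝ × ℝ × ℝ, (|a u.1 u.2.1|.toNNReal : ENNReal) *
      f (u.1, u.2.1, b u.1 u.2.1 + a u.1 u.2.1 * u.2.2) = ∫⁻ u, f u := by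
  have ha' : Measurable fun u : ℝ × ℝ × ℝ => a u.1 u.2.1 :=
    ha.comp (measurable_fst.prodMk (measurable_fst.comp measurable_snd))
  have hb' : Measurable fun u : ℝ × ℝ × ℝ => b u.1 u.2.1 :=
    hb.comp (measurable_fst.prodMk (measurable_fst.comp measurable_snd))
  rw [lintegral_triple _ hf, lintegral_triple]
  · refine lintegral_congr fun x => lintegral_congr fun y => ?_
    rw [← lintegral_affine (fun c => f (x, y, c)) (by fun_prop) (ha0 x y) (b x y)]
    rfl
  · refine Measurable.mul ?_ (hf.comp (by fun_prop))
    exact measurable_coe_nnreal_ennreal.comp ha'.abs.real_toNNReal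

/-! ### Size estimates on the unipotent group -/

/-- `⟨x⟩ = √(1 + x²)`. -/
def jap (x : ℝ) : ℝ := √(1 + x ^ 2)

theorem jap_sq (x : ℝ) : jap x ^ 2 = 1 + x ^ 2 := Real.sq_sqrt (by positivity)

theorem one_le_jap (x : ℝ) : 1 ≤ jap x := Real.one_le_sqrt.2 (by nlinarith [sq_nonneg x])

theorem jap_pos (x : ℝ) : 0 < jap x := zero_lt_one.trans_le (one_le_jap x)

@[fun_prop]
theorem continuous_jap : Continuous jap := by unfold jap; fun_prop

@[fun_prop]
theorem measurable_jap : Measurable jap := continuous_jap.measurable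

/-- The length of the last row of `w_l u`. -/
def lenA (u : ℝ × ℝ × ℝ) : ℝ := √(1 + u.2.1 ^ 2 + u.2.2 ^ 2)

/-- The length of the cross product of the last two rows of `w_l u`. -/
def lenB (u : ℝ × ℝ × ℝ) : ℝ := √(1 + u.1 ^ 2 + (u.2.2 - u.1 * u.2.1) ^ 2)

theorem lenA_sq (u : ℝ × ℝ × ℝ) : lenA u ^ 2 = 1 + u.2.1 ^ 2 + u.2.2 ^ 2 :=
  Real.sq_sqrt (by positivity)

theorem lenB_sq (u : ℝ × ℝ × ℝ) : lenB u ^ 2 = 1 + u.1 ^ 2 + (u.2.2 - u.1 * u.2.1) ^ 2 :=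
  Real.sq_sqrt (by positivity)

theorem one_le_lenA (u : ℝ × ℝ × ℝ) : 1 ≤ lenA u :=
  Real.one_le_sqrt.2 (by nlinarith [sq_nonneg u.2.1, sq_nonneg u.2.2])

theorem one_le_lenB (u : ℝ × ℝ × ℝ) : 1 ≤ lenB u :=
  Real.one_le_sqrt.2 (by nlinarith [sq_nonneg u.1, sq_nonneg (u.2.2 - u.1 * u.2.1)])

theorem lenA_pos (u : ℝ × ℝ × ℝ) : 0 < lenA u := zero_lt_one.trans_le (one_le_lenA u)

theorem lenB_pos (u : ℝ × ℝ × ℝ) : 0 < lenB u := zero_lt_one.trans_le (one_le_lenB u)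

@[fun_prop]
theorem continuous_lenA : Continuous lenA := by unfold lenA; fun_prop

@[fun_prop]
theorem continuous_lenB : Continuous lenB := by unfold lenB; fun_prop

@[fun_prop]
theorem measurable_lenA : Measurable lenA := continuous_lenA.measurable

@[fun_prop]
theorem measurable_lenB : Measurable lenB := continuous_lenB.measurable

/-- Since u₁u₂ is the difference of u₃ and u₃ - u₁u₂, its square is at most 2u₃² + 2(u₃ - u₁u₂)².
Hence (1 + u₁²)(1 + u₂²) ≤ 2A² + 2B². -/
theorem jap_mul_jap_le (u : ℝ × ℝ × ℝ) : jap u.1 * jap u.2.1 ≤ 2 * max (lenA u) (lenB u) := by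
  have hA := lenA_pos u
  have hB := lenB_pos u
  have hM : 0 < max (lenA u) (lenB u) := lt_max_of_lt_left hA
  refine abs_le_of_sq_le_sq' ?_ (by positivity) |>.2
  have h1 : lenA u ^ 2 ≤ max (lenA u) (lenB u) ^ 2 := by gcongr; exact le_max_left _ _
  have h2 : lenB u ^ 2 ≤ max (lenA u) (lenB u) ^ 2 := by gcongr; exact le_max_right _ _
  rw [mul_pow, mul_pow, jap_sq, jap_sq]
  rw [lenA_sq] at h1
  rw [lenB_sq] at h2
  nlinarith [sq_nonneg (u.2.2 + (u.2.2 - u.1 * u.2.1))]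

/-- A power s of the larger of A, B is spent on decay in u₁ and u₂ by `jap_mul_jap_le`. What remains
is bounded by the power 2r - s of the smaller one, which controls u₃ or u₃ - u₁u₂ according to which
it is; the sum covers both cases. -/
theorem lenA_mul_lenB_rpow_le (u : ℝ × ℝ × ℝ) {r s : ℝ} (hs : 0 ≤ s) (hsr : s ≤ r) :
    (lenA u * lenB u) ^ (-r) ≤ 2 ^ s * (jap u.1 ^ (-s) * jap u.2.1 ^ (-s) *
      (jap u.2.2 ^ (-(2 * r - s)) + jap (u.2.2 - u.1 * u.2.1) ^ (-(2 * r - s)))) := by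
  -- X is the larger and Y the smaller of the two lengths, and z is the coordinate controlled by Y.
  have key : ∀ X Y z : ℝ, 0 < Y → Y ≤ X → jap u.1 * jap u.2.1 ≤ 2 * X → jap z ≤ Y →
      (X * Y) ^ (-r) ≤ 2 ^ s * (jap u.1 ^ (-s) * jap u.2.1 ^ (-s) * jap z ^ (-(2 * r - s))) := by
    intro X Y z hY hYX hX hz
    have hX0 : 0 < X := hY.trans_le hYX
    have j1 := jap_pos u.1
    have j2 := jap_pos u.2.1
    have e1 : (X * Y) ^ (-r) = X ^ (-s) * X ^ (-(r - s)) * Y ^ (-r) := by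
      rw [Real.mul_rpow hX0.le hY.le, ← Real.rpow_add hX0]; ring_nf
    have e2 : X ^ (-(r - s)) ≤ Y ^ (-(r - s)) :=
      Real.rpow_le_rpow_of_nonpos hY hYX (by linarith)
    have e3 : X ^ (-s) ≤ 2 ^ s * (jap u.1 ^ (-s) * jap u.2.1 ^ (-s)) := by
      rw [← Real.mul_rpow j1.le j2.le]
      have : (2 * X) ^ (-s) ≤ (jap u.1 * jap u.2.1) ^ (-s) :=
        Real.rpow_le_rpow_of_nonpos (by positivity) hX (by linarith)
      calc X ^ (-s) = 2 ^ s * (2 * X) ^ (-s) := by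
            rw [Real.mul_rpow zero_le_two hX0.le, ← mul_assoc, ← Real.rpow_add zero_lt_two]
            simp
        _ ≤ _ := by gcongr
    have e4 : Y ^ (-(r - s)) * Y ^ (-r) ≤ jap z ^ (-(2 * r - s)) := by
      rw [← Real.rpow_add hY, show -(r - s) + -r = -(2 * r - s) by ring]
      exact Real.rpow_le_rpow_of_nonpos (jap_pos z) hz (by linarith)
    calc (X * Y) ^ (-r) = X ^ (-s) * X ^ (-(r - s)) * Y ^ (-r) := e1
      _ ≤ (2 ^ s * (jap u.1 ^ (-s) * jap u.2.1 ^ (-s))) * Y ^ (-(r - s)) * Y ^ (-r) := by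
          gcongr
      _ = (2 ^ s * (jap u.1 ^ (-s) * jap u.2.1 ^ (-s))) * (Y ^ (-(r - s)) * Y ^ (-r)) := by ring
      _ ≤ (2 ^ s * (jap u.1 ^ (-s) * jap u.2.1 ^ (-s))) * jap z ^ (-(2 * r - s)) := by gcongr
      _ = _ := by ring
  have h := jap_mul_jap_le u
  have j1 := jap_pos u.1
  have j2 := jap_pos u.2.1
  have j3 := jap_pos u.2.2
  have j4 := jap_pos (u.2.2 - u.1 * u.2.1)
  rcases le_total (lenA u) (lenB u) with hl | hl
  · rw [max_eq_right hl] at h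
    refine (mul_comm (lenA u) (lenB u) ▸ key _ _ u.2.2 (lenA_pos u) hl h ?_).trans ?_
    · exact Real.sqrt_le_sqrt (by nlinarith [sq_nonneg u.2.1])
    · gcongr
      exact le_add_of_nonneg_right (by positivity)
  · rw [max_eq_left hl] at h
    refine (key _ _ (u.2.2 - u.1 * u.2.1) (lenB_pos u) hl h ?_).trans ?_
    · exact Real.sqrt_le_sqrt (by nlinarith [sq_nonneg u.1])
    · gcongr
      exact le_add_of_nonneg_left (by positivity)

theorem integrable_jap_rpow {p : ℝ} (hp : 1 < p) : Integrable fun x => jap x ^ (-p) := by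
  have h := integrable_rpow_neg_one_add_norm_sq (E := ℝ) (μ := volume) (r := p)
    (by simpa using hp)
  refine h.congr (Filter.Eventually.of_forall fun x => ?_)
  simp only [jap]
  rw [Real.sqrt_eq_rpow, ← Real.rpow_mul (by positivity), Real.norm_eq_abs, sq_abs]
  congr 1
  ring

theorem measurePreserving_shear :
    MeasurePreserving (fun u : ℝ × ℝ × ℝ => (u.1, u.2.1, u.2.2 - u.1 * u.2.1)) := by
  refine ⟨by fun_prop, ?_⟩
  refine Measure.ext_of_lintegral _ fun f hf => ?_
  rw [lintegral_map hf (by fun_prop), ← lintegral_fibre (fun _ _ => 1) (fun x y => -(x * y))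
    (by fun_prop) (by fun_prop) (by simp) f hf]
  simp [sub_eq_neg_add]

theorem integrable_majorant {s p : ℝ} (hs : 1 < s) (hp : 1 < p) :
    Integrable fun u : ℝ × ℝ × ℝ => jap u.1 ^ (-s) * jap u.2.1 ^ (-s) *
      (jap u.2.2 ^ (-p) + jap (u.2.2 - u.1 * u.2.1) ^ (-p)) := by
  have h1 : Integrable fun u : ℝ × ℝ × ℝ => jap u.1 ^ (-s) * (jap u.2.1 ^ (-s) * jap u.2.2 ^ (-p)) :=
    (integrable_jap_rpow hs).mul_prod ((integrable_jap_rpow hs).mul_prod (integrable_jap_rpow hp))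
  have h2 := measurePreserving_shear.integrable_comp_of_integrable h1
  refine (h1.add h2).congr (Filter.Eventually.of_forall fun u => ?_)
  simp
  ring

theorem integrable_lenA_mul_lenB_rpow {r : ℝ} (hr : 1 < r) :
    Integrable fun u => (lenA u * lenB u) ^ (-r) := by
  refine ((integrable_majorant hr hr).const_mul (2 ^ r)).mono'
    ((measurable_lenA.mul measurable_lenB).pow_const _).aestronglyMeasurable (Filter.Eventually.of_forall fun u => ?_)
  rw [Real.norm_of_nonneg (by have := lenA_pos u; have := lenB_pos u; positivity)]
  refine (lenA_mul_lenB_rpow_le u (by linarith) le_rfl).trans_eq ?_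
  rw [show 2 * r - r = r by ring]

/-- The majorant of the kernel after one integration by parts in each of `u₁` and `u₂`. -/
theorem integrable_lenA_mul_lenB_rpow_mul_jap {r : ℝ} (hr : 3 / 4 < r) :
    Integrable fun u => (lenA u * lenB u) ^ (-r) * ((jap u.1)⁻¹ * (jap u.2.1)⁻¹) := by
  -- With s = 1/2 in `lenA_mul_lenB_rpow_le` the extra factors raise the decay in u₁ and u₂ to 3/2,
  -- and 2r - 1/2 > 1 is exactly r > 3/4.
  refine ((integrable_majorant (s := 3 / 2) (p := 2 * r - 1 / 2) (by norm_num)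
    (by linarith)).const_mul (2 ^ (1 / 2 : ℝ))).mono' ?_ (Filter.Eventually.of_forall fun u => ?_)
  · exact (Measurable.mul (by fun_prop) (by fun_prop)).aestronglyMeasurable
  have hA := lenA_pos u
  have hB := lenB_pos u
  have j1 := jap_pos u.1
  have j2 := jap_pos u.2.1
  rw [Real.norm_of_nonneg (by positivity)]
  have := lenA_mul_lenB_rpow_le u (r := r) (s := 1 / 2) (by norm_num) (by linarith)
  refine (mul_le_mul_of_nonneg_right this (by positivity)).trans_eq ?_
  have e : ∀ x, jap x ^ (-(3 / 2) : ℝ) = jap x ^ (-(1 / 2) : ℝ) * (jap x)⁻¹ := by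
    intro x
    rw [← Real.rpow_neg_one, ← Real.rpow_add (jap_pos x)]
    norm_num
  rw [e, e]
  ring

/-! ### Symbols: polynomials in the entries of the `K`-part of `w_l u` -/

/-- Minus the last row of `w_l u`. -/
def rowU (u : ℝ × ℝ × ℝ) : Fin 3 → ℝ := ![1, u.2.1, u.2.2]

/-- The cross product of the last two rows of `w_l u`. -/
def crossU (u : ℝ × ℝ × ℝ) : Fin 3 → ℝ := ![u.2.2 - u.1 * u.2.1, u.1, -1]

/-- Polynomials in the coordinates of the unit vectors along `rowU u` and `crossU u`. -/
inductive IsSymbol : (ℝ × ℝ × ℝ → ℂ) → Prop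
  | const (c : ℂ) : IsSymbol fun _ => c
  | row (i : Fin 3) : IsSymbol fun u => ((rowU u i / lenA u : ℝ) : ℂ)
  | cross (i : Fin 3) : IsSymbol fun u => ((crossU u i / lenB u : ℝ) : ℂ)
  | add {P Q : ℝ × ℝ × ℝ → ℂ} : IsSymbol P → IsSymbol Q → IsSymbol fun u => P u + Q u
  | mul {P Q : ℝ × ℝ × ℝ → ℂ} : IsSymbol P → IsSymbol Q → IsSymbol fun u => P u * Q u

theorem continuous_rowU (i : Fin 3) : Continuous fun u => rowU u i := by
  fin_cases i <;> simp [rowU] <;> fun_prop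

theorem continuous_crossU (i : Fin 3) : Continuous fun u => crossU u i := by
  fin_cases i <;> simp [crossU] <;> fun_prop

theorem abs_rowU_le (u : ℝ × ℝ × ℝ) (i : Fin 3) : |rowU u i| ≤ lenA u := by
  have h := lenA_sq u
  refine abs_le_of_sq_le_sq ?_ (lenA_pos u).le
  rw [h]
  fin_cases i <;> simp [rowU] <;> nlinarith [sq_nonneg u.2.1, sq_nonneg u.2.2]

theorem abs_crossU_le (u : ℝ × ℝ × ℝ) (i : Fin 3) : |crossU u i| ≤ lenB u := by
  have h := lenB_sq u
  refine abs_le_of_sq_le_sq ?_ (lenB_pos u).le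
  rw [h]
  fin_cases i <;> simp [crossU] <;> nlinarith [sq_nonneg u.1, sq_nonneg (u.2.2 - u.1 * u.2.1)]

namespace IsSymbol

theorem continuous {Q : ℝ × ℝ × ℝ → ℂ} (hQ : IsSymbol Q) : Continuous Q := by
  induction hQ with
  | const c => exact continuous_const
  | row i =>
    exact Complex.continuous_ofReal.comp
      ((continuous_rowU i).div continuous_lenA fun u => (lenA_pos u).ne')
  | cross i =>
    exact Complex.continuous_ofReal.comp
      ((continuous_crossU i).div continuous_lenB fun u => (lenB_pos u).ne')
  | add _ _ h1 h2 => exact h1.add h2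
  | mul _ _ h1 h2 => exact h1.mul h2

theorem bounded {Q : ℝ × ℝ × ℝ → ℂ} (hQ : IsSymbol Q) : ∃ C, 0 ≤ C ∧ ∀ u, ‖Q u‖ ≤ C := by
  induction hQ with
  | const c => exact ⟨‖c‖, norm_nonneg _, fun _ => le_rfl⟩
  | row i =>
    refine ⟨1, zero_le_one, fun u => ?_⟩
    rw [Complex.norm_real, Real.norm_eq_abs, abs_div, abs_of_pos (lenA_pos u)]
    exact div_le_one_of_le₀ (abs_rowU_le u i) (lenA_pos u).le
  | cross i =>
    refine ⟨1, zero_le_one, fun u => ?_⟩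
    rw [Complex.norm_real, Real.norm_eq_abs, abs_div, abs_of_pos (lenB_pos u)]
    exact div_le_one_of_le₀ (abs_crossU_le u i) (lenB_pos u).le
  | add _ _ h1 h2 =>
    obtain ⟨C, hC, h⟩ := h1
    obtain ⟨C', hC', h'⟩ := h2
    exact ⟨C + C', add_nonneg hC hC', fun u => norm_add_le_of_le (h u) (h' u)⟩
  | mul _ _ h1 h2 =>
    obtain ⟨C, hC, h⟩ := h1
    obtain ⟨C', hC', h'⟩ := h2
    exact ⟨C * C', mul_nonneg hC hC', fun u => norm_mul_le_of_le (h u) (h' u)⟩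

theorem const_mul {Q : ℝ × ℝ × ℝ → ℂ} (hQ : IsSymbol Q) (c : ℂ) : IsSymbol fun u => c * Q u :=
  (IsSymbol.const c).mul hQ

end IsSymbol

/-! ### The involution exchanging the two simple roots -/

/-- The involution `(u₁, u₂, u₃) ↦ (u₂, u₁, u₁u₂ - u₃)`. -/
def flipU (u : ℝ × ℝ × ℝ) : ℝ × ℝ × ℝ := (u.2.1, u.1, u.1 * u.2.1 - u.2.2)

theorem flipU_flipU (u : ℝ × ℝ × ℝ) : flipU (flipU u) = u := by
  simp only [flipU]
  ext <;> simp
  ring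

@[fun_prop]
theorem continuous_flipU : Continuous flipU := by unfold flipU; fun_prop

theorem lenA_flipU (u : ℝ × ℝ × ℝ) : lenA (flipU u) = lenB u := by
  simp only [lenA, lenB, flipU]
  congr 1
  ring

theorem lenB_flipU (u : ℝ × ℝ × ℝ) : lenB (flipU u) = lenA u := by
  rw [← lenA_flipU, flipU_flipU]

theorem psi_flipU (t : ℝ × ℝ) (u : ℝ × ℝ × ℝ) : psi t (flipU u) = psi t.swap u := by
  simp only [psi, flipU, Prod.fst_swap, Prod.snd_swap]
  rw [add_comm]

theorem measurePreserving_flipU : MeasurePreserving flipU := by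
  refine ⟨by fun_prop, Measure.ext_of_lintegral _ fun f hf => ?_⟩
  have hm : Measurable fun z : ℝ × ℝ => ∫⁻ c, f (flipU (z.1, z.2, c)) :=
    Measurable.lintegral_prod_right' (f := fun z : (ℝ × ℝ) × ℝ => f (flipU (z.1.1, z.1.2, z.2)))
      (by fun_prop)
  rw [lintegral_map hf (by fun_prop), lintegral_triple _ (by fun_prop)]
  rw [lintegral_lintegral_swap hm.aemeasurable,
    ← lintegral_fibre (fun _ _ => -1) (fun x y => x * y) (by fun_prop) (by fun_prop) (by simp) f hf,
    lintegral_triple _ (by fun_prop)]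
  simp [flipU, ← sub_eq_add_neg, mul_comm]

/-- `flipU` exchanges A and B and sends `rowU` to `crossU` read backwards, with a sign change in the
first and last entries. -/
theorem IsSymbol.comp_flipU {Q : ℝ × ℝ × ℝ → ℂ} (hQ : IsSymbol Q) :
    IsSymbol fun u => Q (flipU u) := by
  induction hQ with
  | const c => exact .const c
  | row i =>
    have h := (IsSymbol.cross (2 - i)).const_mul (if i = 1 then 1 else -1)
    convert h using 2 with u
    simp only [lenA_flipU]
    fin_cases i <;> simp [rowU, crossU, flipU]
    · ring
    · ring
  | cross i =>
    have h := (IsSymbol.row (2 - i)).const_mul (if i = 1 then 1 else -1)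
    convert h using 2 with u
    simp only [lenB_flipU]
    fin_cases i <;> simp [rowU, crossU, flipU] <;> ring
  | add _ _ h1 h2 => exact h1.add h2
  | mul _ _ h1 h2 => exact h1.mul h2

/-! ### The vector field along which symbols improve -/

/-- The vector field `∂₁ + ((u₂ + u₁u₃)/⟨u₁⟩²) ∂₃`. -/
def fieldU (u : ℝ × ℝ × ℝ) : ℝ × ℝ × ℝ := (1, 0, (u.2.1 + u.1 * u.2.2) / jap u.1 ^ 2)

/-- `g` is the derivative of `f` along `fieldU`. -/
def DerivAlong {E : Type*} [NormedAddCommGroup E] [NormedSpace ℝ E]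
    (f g : ℝ × ℝ × ℝ → E) : Prop :=
  ∀ (c : ℝ → ℝ × ℝ × ℝ) (s : ℝ), HasDerivAt c (fieldU (c s)) s →
    HasDerivAt (fun r => f (c r)) (g (c s)) s

theorem hasDerivAt_components {c : ℝ → ℝ × ℝ × ℝ} {s : ℝ} (h : HasDerivAt c (fieldU (c s)) s) :
    HasDerivAt (fun r => (c r).1) 1 s ∧ HasDerivAt (fun r => (c r).2.1) 0 s ∧
      HasDerivAt (fun r => (c r).2.2) (((c s).2.1 + (c s).1 * (c s).2.2) / jap (c s).1 ^ 2) s := by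
  have h1 := (hasFDerivAt_fst (𝕜 := ℝ) (p := c s)).comp_hasDerivAt s h
  have h2 := (hasFDerivAt_snd (𝕜 := ℝ) (p := c s)).comp_hasDerivAt s h
  have h3 := (hasFDerivAt_fst (𝕜 := ℝ) (p := (c s).2)).comp_hasDerivAt s h2
  have h4 := (hasFDerivAt_snd (𝕜 := ℝ) (p := (c s).2)).comp_hasDerivAt s h2
  exact ⟨h1, h3, h4⟩

/-- The logarithmic derivative of `lenA`. -/
def dlogA (u : ℝ × ℝ × ℝ) : ℝ :=
  (jap u.1 ^ 2)⁻¹ * (rowU u 1 / lenA u * (rowU u 2 / lenA u)) +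
    u.1 / jap u.1 ^ 2 * (rowU u 2 / lenA u * (rowU u 2 / lenA u))

theorem derivAlong_lenA : DerivAlong lenA fun u => lenA u * dlogA u := by
  intro c s h
  obtain ⟨h1, h2, h3⟩ := hasDerivAt_components h
  have hA := lenA_pos (c s)
  have hj := jap_pos (c s).1
  have := (((h2.pow 2).const_add 1).add (h3.pow 2)).sqrt (x := s) (by
    simp only [Pi.add_apply, Pi.pow_apply]; positivity)
  refine this.congr_deriv ?_
  simp only [Pi.add_apply, Pi.pow_apply]
  rw [show √(1 + (c s).2.1 ^ 2 + (c s).2.2 ^ 2) = lenA (c s) from rfl]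
  simp [dlogA, rowU]
  field_simp

/-- This is what the field is designed for: along it both 1 + u₁² and (u₃ - u₁u₂)² have logarithmic
derivative 2u₁/⟨u₁⟩², so B is proportional to ⟨u₁⟩ on each integral curve. -/
theorem derivAlong_lenB : DerivAlong lenB fun u => lenB u * (u.1 / jap u.1 ^ 2) := by
  intro c s h
  obtain ⟨h1, h2, h3⟩ := hasDerivAt_components h
  have hB := lenB_pos (c s)
  have hj := jap_pos (c s).1
  have := (((h1.pow 2).const_add 1).add ((h3.sub (h1.mul h2)).pow 2)).sqrt (x := s) (by
    simp only [Pi.add_apply, Pi.pow_apply, Pi.sub_apply, Pi.mul_apply]; positivity)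
  refine this.congr_deriv ?_
  simp only [Pi.add_apply, Pi.pow_apply, Pi.sub_apply, Pi.mul_apply]
  rw [show √(1 + (c s).1 ^ 2 + ((c s).2.2 - (c s).1 * (c s).2.1) ^ 2) = lenB (c s) from rfl]
  have hB2 := lenB_sq (c s)
  have hj2 := jap_sq (c s).1
  field_simp
  rw [hB2, hj2]
  simp
  ring

/-- The derivative of a symbol along `fieldU` is `p P₁ + q P₂` with symbols `P₁`, `P₂` and
`p = 1/⟨u₁⟩²`, `q = u₁/⟨u₁⟩²`. -/
theorem IsSymbol.exists_derivAlong {Q : ℝ × ℝ × ℝ → ℂ} (hQ : IsSymbol Q) :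
    ∃ P₁ P₂, IsSymbol P₁ ∧ IsSymbol P₂ ∧ DerivAlong Q fun u =>
      (((jap u.1 ^ 2)⁻¹ : ℝ) : ℂ) * P₁ u + ((u.1 / jap u.1 ^ 2 : ℝ) : ℂ) * P₂ u := by
  induction hQ with
  | const c =>
    exact ⟨_, _, .const 0, .const 0, fun c s h => by simpa using hasDerivAt_const _ _⟩
  | row i =>
    let r : Fin 3 → ℝ × ℝ × ℝ → ℂ := fun i u => ((rowU u i / lenA u : ℝ) : ℂ)
    have hr : ∀ i, IsSymbol (r i) := .row
    -- Only the last entry of `rowU` moves along the field, with velocity p·u₂ + q·u₃; e records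
    -- whether i is that entry. The remaining terms come from differentiating 1/A.
    obtain ⟨e, he⟩ : ∃ e : ℝ, e = if i = 2 then 1 else 0 := ⟨_, rfl⟩
    refine ⟨fun u => (e : ℂ) * r 1 u + ((-1 : ℝ) : ℂ) * (r i u * (r 1 u * r 2 u)),
      fun u => (e : ℂ) * r 2 u + ((-1 : ℝ) : ℂ) * (r i u * (r 2 u * r 2 u)),
      ((hr 1).const_mul _).add (((hr i).mul ((hr 1).mul (hr 2))).const_mul _),
      ((hr 2).const_mul _).add (((hr i).mul ((hr 2).mul (hr 2))).const_mul _), ?_⟩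
    intro c s h
    obtain ⟨h1, h2, h3⟩ := hasDerivAt_components h
    have hA := derivAlong_lenA c s h
    have hA0 := (lenA_pos (c s)).ne'
    have hj := (jap_pos (c s).1).ne'
    have hc : HasDerivAt (fun x => rowU (c x) i)
        (e * (((c s).2.1 + (c s).1 * (c s).2.2) / jap (c s).1 ^ 2)) s := by
      rw [he]
      fin_cases i
      · simpa [rowU] using hasDerivAt_const s (1 : ℝ)
      · simpa [rowU] using h2
      · simpa [rowU] using h3
    refine (hc.div hA hA0).ofReal_comp.congr_deriv ?_
    simp only [r, ← Complex.ofReal_mul, ← Complex.ofReal_add]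
    congr 1
    generalize rowU (c s) i = x
    simp [dlogA, rowU]
    field_simp
    ring
  | cross i =>
    let b : Fin 3 → ℝ × ℝ × ℝ → ℂ := fun i u => ((crossU u i / lenB u : ℝ) : ℂ)
    have hb : ∀ i, IsSymbol (b i) := .cross
    -- The entry u₃ - u₁u₂ grows at the same rate q as B, so the quotient is constant. For u₁/B the
    -- derivative is (1 - u₁q)/B = p/B, and for -1/B it is q/B.
    refine ⟨fun u => ((if i = 1 then -1 else 0 : ℝ) : ℂ) * b 2 u,
      fun u => ((if i = 2 then -1 else 0 : ℝ) : ℂ) * b i u,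
      (hb 2).const_mul _, (hb i).const_mul _, ?_⟩
    intro c s h
    obtain ⟨h1, h2, h3⟩ := hasDerivAt_components h
    have hB := derivAlong_lenB c s h
    have hB0 := (lenB_pos (c s)).ne'
    have hj := (jap_pos (c s).1).ne'
    have hj2 := jap_sq (c s).1
    simp only [b, ← Complex.ofReal_mul, ← Complex.ofReal_add]
    fin_cases i
    · refine (((h3.sub (h1.mul h2)).div hB hB0).ofReal_comp).congr_deriv ?_
      congr 1
      simp [crossU]
      field_simp
      rw [hj2]
      left
      ring
    · refine ((h1.div hB hB0).ofReal_comp).congr_deriv ?_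
      congr 1
      simp [crossU]
      field_simp
      rw [hj2]
      ring
    · refine (((hasDerivAt_const s (-1 : ℝ)).div hB hB0).ofReal_comp).congr_deriv ?_
      congr 1
      simp [crossU]
      field_simp
  | add _ _ h1 h2 =>
    obtain ⟨P₁, P₂, hP₁, hP₂, h⟩ := h1
    obtain ⟨R₁, R₂, hR₁, hR₂, h'⟩ := h2
    refine ⟨_, _, hP₁.add hR₁, hP₂.add hR₂, fun c s hc => ?_⟩
    refine ((h c s hc).add (h' c s hc)).congr_deriv ?_
    ring
  | @mul P Q hP hQ h1 h2 =>
    obtain ⟨P₁, P₂, hP₁, hP₂, h⟩ := h1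
    obtain ⟨R₁, R₂, hR₁, hR₂, h'⟩ := h2
    refine ⟨_, _, (hP₁.mul hQ).add (hP.mul hR₁), (hP₂.mul hQ).add (hP.mul hR₂), fun c s hc => ?_⟩
    refine ((h c s hc).mul (h' c s hc)).congr_deriv ?_
    ring

/-! ### Integration by parts -/

theorem hasDerivAt_jap (s : ℝ) : HasDerivAt jap (s / jap s) s := by
  refine ((((hasDerivAt_id s).pow 2).const_add 1).sqrt (x := s) (by
    simp only [Pi.pow_apply, id]; positivity)).congr_deriv ?_
  simp only [id, Pi.pow_apply]
  rw [show √(1 + s ^ 2) = jap s from rfl]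
  have := (jap_pos s).ne'
  field_simp
  simp

/-- The integral curves are u₃ = u₁u₂ + ⟨u₁⟩v with u₂ and v fixed. In the coordinates (u₁, u₂, v)
the field becomes ∂/∂u₁ and Lebesgue measure acquires the density ⟨u₁⟩. -/
theorem derivAlong_path (y v s : ℝ) :
    HasDerivAt (fun r : ℝ => (r, y, r * y + jap r * v)) (fieldU (s, y, s * y + jap s * v)) s := by
  have hj := (jap_pos s).ne'
  have hj2 := jap_sq s
  refine (hasDerivAt_id s).prodMk ((hasDerivAt_const s y).prodMk
    ((((hasDerivAt_id s).mul_const y).add ((hasDerivAt_jap s).mul_const v)).congr_deriv ?_))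
  field_simp
  linear_combination y * hj2

/-- Integration by parts in the form of the Fourier transform of a derivative: integrability of f
and f' replaces any discussion of boundary terms. -/
theorem integral_deriv_mul_exp {f f' : ℝ → ℂ} (hf : Integrable f) (hf' : Integrable f')
    (hd : ∀ x, HasDerivAt f (f' x) x) (t : ℝ) :
    ∫ x : ℝ, f' x * Complex.exp (-(2 * Real.pi * Complex.I * ((t * x : ℝ) : ℂ))) =
      2 * Real.pi * Complex.I * t *
        ∫ x : ℝ, f x * Complex.exp (-(2 * Real.pi * Complex.I * ((t * x : ℝ) : ℂ))) := by
  have he : deriv f = f' := funext fun x => (hd x).deriv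
  have h := congrFun (Real.fourier_deriv hf (fun x => (hd x).differentiableAt) (he ▸ hf')) t
  rw [he, Real.fourier_real_eq_integral_exp_smul, Real.fourier_real_eq_integral_exp_smul] at h
  have hx : ∀ g : ℝ → ℂ, ∫ v : ℝ, Complex.exp (((-2 * Real.pi * v * t : ℝ) : ℂ) * Complex.I) • g v =
      ∫ x : ℝ, g x * Complex.exp (-(2 * Real.pi * Complex.I * ((t * x : ℝ) : ℂ))) := by
    intro g
    refine integral_congr_ae (Filter.Eventually.of_forall fun x => ?_)
    simp only [smul_eq_mul]
    rw [mul_comm]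
    congr 2
    push_cast
    ring
  rw [hx, hx] at h
  simpa only [smul_eq_mul] using h

theorem norm_exp_two_pi (x : ℝ) :
    ‖Complex.exp (-(2 * Real.pi * Complex.I * (x : ℂ)))‖ = 1 := by
  rw [Complex.norm_exp]
  simp

/-- One-dimensional integration by parts on each integral curve. The character depends on u₁ alone
there apart from a constant factor, and the derivative of ⟨u₁⟩f is ⟨u₁⟩(g + (u₁/⟨u₁⟩²)f); the second
term is the divergence of the field. The factor k(u₂) is constant on curves. -/
theorem integral_derivAlong {f g : ℝ × ℝ × ℝ → ℂ} (hfc : Continuous f) (hgc : Continuous g)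
    (hD : DerivAlong f g) (hf : Integrable f)
    (hg : Integrable fun u => g u + ((u.1 / jap u.1 ^ 2 : ℝ) : ℂ) * f u) {k : ℝ → ℂ}
    (hk : Continuous k) {C : ℝ} (hkC : ∀ x, ‖k x‖ ≤ C) (t : ℝ) :
    ∫ u, (g u + ((u.1 / jap u.1 ^ 2 : ℝ) : ℂ) * f u) * (k u.2.1 *
      Complex.exp (-(2 * Real.pi * Complex.I * ((t * u.1 : ℝ) : ℂ)))) =
    2 * Real.pi * Complex.I * t * ∫ u, f u * (k u.2.1 *
      Complex.exp (-(2 * Real.pi * Complex.I * ((t * u.1 : ℝ) : ℂ)))) := by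
  let T : ℝ × ℝ × ℝ → ℝ × ℝ × ℝ := fun u => (u.1, u.2.1, u.1 * u.2.1 + jap u.1 * u.2.2)
  let w : ℝ × ℝ × ℝ → NNReal := fun u => |jap u.1|.toNNReal
  have hT : Measurable T := by fun_prop
  have hw : Measurable w := by fun_prop
  have hw' : ∀ u, ((w u : ℝ) : ℂ) = (jap u.1 : ℂ) := fun u => by
    simp [w, Real.coe_toNNReal', (jap_pos u.1).le]
  have hl : ∀ F : ℝ × ℝ × ℝ → ENNReal, Measurable F → ∫⁻ x, w x * F (T x) = ∫⁻ y, F y :=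
    fun F hF => lintegral_fibre (fun x _ => jap x) (fun x y => x * y) (by fun_prop) (by fun_prop)
      (fun x _ => (jap_pos x).ne') F hF
  have hjc : Continuous fun u : ℝ × ℝ × ℝ => ((u.1 / jap u.1 ^ 2 : ℝ) : ℂ) :=
    Complex.continuous_ofReal.comp (Continuous.div (by fun_prop) (by fun_prop)
      fun u => (pow_pos (jap_pos u.1) 2).ne')
  let G : ℝ × ℝ × ℝ → ℂ := fun u => g u + ((u.1 / jap u.1 ^ 2 : ℝ) : ℂ) * f u
  have hGc : Continuous G := hgc.add (hjc.mul hfc)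
  let e : ℝ × ℝ × ℝ → ℂ := fun u =>
    k u.2.1 * Complex.exp (-(2 * Real.pi * Complex.I * ((t * u.1 : ℝ) : ℂ)))
  have hec : Continuous e := by fun_prop
  have heC : ∀ u, ‖e u‖ ≤ C := fun u => by
    simp only [e, norm_mul, norm_exp_two_pi, mul_one]
    exact hkC _
  have red : ∀ F : ℝ × ℝ × ℝ → ℂ, Continuous F → Integrable F →
      Integrable (fun u => (jap u.1 : ℂ) * F (T u)) ∧
      ∫ u, F u * e u = ∫ y : ℝ × ℝ, k y.1 * ∫ x : ℝ, (jap x : ℂ) * F (T (x, y)) *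
        Complex.exp (-(2 * Real.pi * Complex.I * ((t * x : ℝ) : ℂ))) := by
    intro F hF hFi
    have i1 := (integrable_of_lintegral hT hw hl hF.measurable).2 hFi
    simp only [hw'] at i1
    refine ⟨i1, ?_⟩
    have hFe : Continuous fun u => F u * e u := hF.mul hec
    have i2 := (integrable_of_lintegral hT hw hl hFe.measurable).2
      (hFi.mul_bdd hec.aestronglyMeasurable (Filter.Eventually.of_forall heC))
    rw [← integral_of_lintegral hT hw hl hFe.measurable]
    rw [Measure.volume_eq_prod] at i2 ⊢
    rw [integral_prod_symm _ i2]
    refine integral_congr_ae (Filter.Eventually.of_forall fun y => ?_)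
    simp only [hw']
    rw [← integral_const_mul]
    refine integral_congr_ae (Filter.Eventually.of_forall fun x => ?_)
    simp only [T, e]
    ring
  obtain ⟨if', ef⟩ := red f hfc hf
  obtain ⟨ig, eg⟩ := red G hGc hg
  change ∫ u, G u * e u = _ * ∫ u, f u * e u
  rw [ef, eg, ← integral_const_mul]
  rw [Measure.volume_eq_prod] at if' ig
  refine integral_congr_ae ?_
  -- By Fubini, ⟨u₁⟩f and its derivative are integrable along almost every curve.
  filter_upwards [if'.prod_left_ae, ig.prod_left_ae] with y h1 h2
  rw [mul_left_comm]
  congr 1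
  refine integral_deriv_mul_exp h1 h2 (fun s => ?_) t
  have hp := hD _ s (derivAlong_path y.1 y.2 s)
  have hj := (jap_pos s).ne'
  have h0 : HasDerivAt (fun r => (jap r : ℂ)) ((s / jap s : ℝ) : ℂ) s :=
    (hasDerivAt_jap s).ofReal_comp
  refine (h0.mul hp).congr_deriv ?_
  simp only [G, T]
  have hj' : (jap s : ℂ) ≠ 0 := Complex.ofReal_ne_zero.2 hj
  push_cast
  field_simp
  ring

/-! ### The kernel -/

/-- The function `u ↦ A^{-1-a} B^{-1-b}`, the value of `p_{ρ+μ}(w_l u)`. -/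
def kern (z : ℂ × ℂ) (u : ℝ × ℝ × ℝ) : ℂ :=
  Complex.exp (-(1 + z.1) * (Real.log (lenA u) : ℂ) - (1 + z.2) * (Real.log (lenB u) : ℂ))

theorem continuous_log_lenA : Continuous fun u => Real.log (lenA u) :=
  continuous_lenA.log fun u => (lenA_pos u).ne'

theorem continuous_log_lenB : Continuous fun u => Real.log (lenB u) :=
  continuous_lenB.log fun u => (lenB_pos u).ne'

theorem continuous_kern : Continuous fun p : (ℂ × ℂ) × (ℝ × ℝ × ℝ) => kern p.1 p.2 := by
  have h1 := Complex.continuous_ofReal.comp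
    (continuous_log_lenA.comp (continuous_snd (X := ℂ × ℂ)))
  have h2 := Complex.continuous_ofReal.comp
    (continuous_log_lenB.comp (continuous_snd (X := ℂ × ℂ)))
  exact Complex.continuous_exp.comp (.sub (.mul (by fun_prop) h1) (.mul (by fun_prop) h2))

theorem continuous_kern_right (z : ℂ × ℂ) : Continuous (kern z) :=
  continuous_kern.comp (continuous_const.prodMk continuous_id)

theorem kern_flipU (z : ℂ × ℂ) (u : ℝ × ℝ × ℝ) : kern z (flipU u) = kern z.swap u := by
  simp only [kern, lenA_flipU, lenB_flipU, Prod.fst_swap, Prod.snd_swap]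
  congr 1
  ring

theorem norm_kern_le {z : ℂ × ℂ} {r : ℝ} (h1 : r ≤ 1 + z.1.re) (h2 : r ≤ 1 + z.2.re)
    (u : ℝ × ℝ × ℝ) : ‖kern z u‖ ≤ (lenA u * lenB u) ^ (-r) := by
  have hA := Real.log_nonneg (one_le_lenA u)
  have hB := Real.log_nonneg (one_le_lenB u)
  rw [kern, Complex.norm_exp, Real.rpow_def_of_pos (mul_pos (lenA_pos u) (lenB_pos u)),
    Real.log_mul (lenA_pos u).ne' (lenB_pos u).ne']
  gcongr
  simp
  nlinarith

theorem kern_derivAlong (z : ℂ × ℂ) : DerivAlong (kern z) fun u =>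
    kern z u * (-(1 + z.1) * (dlogA u : ℂ) - (1 + z.2) * ((u.1 / jap u.1 ^ 2 : ℝ) : ℂ)) := by
  intro c s h
  have hA := ((derivAlong_lenA c s h).log (lenA_pos _).ne').ofReal_comp
  have hB := ((derivAlong_lenB c s h).log (lenB_pos _).ne').ofReal_comp
  have := ((hA.const_mul (-(1 + z.1))).sub (hB.const_mul (1 + z.2))).cexp
  refine this.congr_deriv ?_
  rw [mul_div_cancel_left₀ _ (lenA_pos (c s)).ne', mul_div_cancel_left₀ _ (lenB_pos (c s)).ne']
  rfl

theorem integrable_kern {z : ℂ × ℂ} (h1 : 0 < z.1.re) (h2 : 0 < z.2.re) : Integrable (kern z) := by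
  have hm : 0 < min z.1.re z.2.re := lt_min h1 h2
  refine (integrable_lenA_mul_lenB_rpow (r := 1 + min z.1.re z.2.re) (by linarith)).mono'
    (continuous_kern_right z).aestronglyMeasurable (Filter.Eventually.of_forall fun u => ?_)
  exact norm_kern_le (by linarith [min_le_left z.1.re z.2.re])
    (by linarith [min_le_right z.1.re z.2.re]) u

/-- The integral `∫ A^{-1-a} B^{-1-b} P \bar{ψ_t}` over the unipotent group. -/
def oscInt (P : ℝ × ℝ × ℝ → ℂ) (z : ℂ × ℂ) (t : ℝ × ℝ) : ℂ :=
  ∫ u, kern z u * P u * conj (psi t u)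

theorem conj_psi (t : ℝ × ℝ) (u : ℝ × ℝ × ℝ) : conj (psi t u) =
    Complex.exp (-(2 * Real.pi * Complex.I * ((t.2 * u.2.1 : ℝ) : ℂ))) *
      Complex.exp (-(2 * Real.pi * Complex.I * ((t.1 * u.1 : ℝ) : ℂ))) := by
  rw [psi, ← Complex.exp_conj, ← Complex.exp_add]
  congr 1
  simp [Complex.conj_ofNat]
  ring

theorem norm_psi (t : ℝ × ℝ) (u : ℝ × ℝ × ℝ) : ‖psi t u‖ = 1 := by
  rw [← Complex.norm_conj, conj_psi, norm_mul, norm_exp_two_pi, norm_exp_two_pi, one_mul]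

theorem continuous_psi : Continuous fun p : (ℝ × ℝ) × (ℝ × ℝ × ℝ) => psi p.1 p.2 := by
  unfold psi
  fun_prop

theorem continuous_psi_right (t : ℝ × ℝ) : Continuous (psi t) :=
  continuous_psi.comp (continuous_const.prodMk continuous_id)

/-- This symmetry turns integration by parts in u₁ into integration by parts in u₂. -/
theorem oscInt_comp_flipU (P : ℝ × ℝ × ℝ → ℂ) (z : ℂ × ℂ) (t : ℝ × ℝ) :
    oscInt (fun u => P (flipU u)) z.swap t.swap = oscInt P z t := by
  have he : MeasurableEmbedding flipU := (MeasurableEquiv.mk ⟨flipU, flipU, flipU_flipU, flipU_flipU⟩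
    continuous_flipU.measurable continuous_flipU.measurable).measurableEmbedding
  rw [oscInt, oscInt, ← measurePreserving_flipU.integral_comp he]
  simp only [kern_flipU, psi_flipU, flipU_flipU, Prod.swap_swap]

/-! ### Holomorphic continuation of oscillatory integrals -/

/-- The domain of the continuation. -/
def contDom : Set (ℂ × ℂ) := {z | -(1 / 8) < z.1.re ∧ -(1 / 8) < z.2.re}

theorem isOpen_contDom : IsOpen contDom :=
  (isOpen_lt continuous_const (Complex.continuous_re.comp continuous_fst)).inter
    (isOpen_lt continuous_const (Complex.continuous_re.comp continuous_snd))

/-- Functions holomorphic in `z ∈ contDom` and jointly continuous. -/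
def IsGood (J : ℂ × ℂ → ℝ × ℝ → ℂ) : Prop :=
  (∀ t, DifferentiableOn ℂ (fun z => J z t) contDom) ∧
    ContinuousOn (fun p : (ℂ × ℂ) × (ℝ × ℝ) => J p.1 p.2) (contDom ×ˢ Set.univ)

theorem IsGood.add {J J' : ℂ × ℂ → ℝ × ℝ → ℂ} (h : IsGood J) (h' : IsGood J') :
    IsGood fun z t => J z t + J' z t :=
  ⟨fun t => (h.1 t).add (h'.1 t), h.2.add h'.2⟩

theorem IsGood.const_mul {J : ℂ × ℂ → ℝ × ℝ → ℂ} (h : IsGood J) {c : ℂ × ℂ → ℂ}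
    (hc : Differentiable ℂ c) : IsGood fun z t => c z * J z t :=
  ⟨fun t => hc.differentiableOn.mul (h.1 t),
    (hc.continuous.comp continuous_fst).continuousOn.mul h.2⟩

theorem IsGood.swap {J : ℂ × ℂ → ℝ × ℝ → ℂ} (h : IsGood J) :
    IsGood fun z t => J z.swap t.swap := by
  refine ⟨fun t => (h.1 t.swap).comp (g := fun z => J z t.swap) ?_ fun z hz => ⟨hz.2, hz.1⟩, ?_⟩
  · exact (differentiable_snd.prodMk differentiable_fst).differentiableOn
  · exact h.2.comp (f := fun p : (ℂ × ℂ) × (ℝ × ℝ) => (p.1.swap, p.2.swap))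
      (Continuous.continuousOn (by fun_prop)) fun p hp => ⟨⟨hp.1.2, hp.1.1⟩, trivial⟩

/-- The exponent 7/8 exceeds the threshold 3/4 of `integrable_lenA_mul_lenB_rpow_mul_jap`, with room
left for the logarithms produced by differentiating in z. -/
theorem norm_kern_le_of_mem {z : ℂ × ℂ} (hz : z ∈ contDom) (u : ℝ × ℝ × ℝ) :
    ‖kern z u‖ ≤ (lenA u * lenB u) ^ (-(7 / 8) : ℝ) :=
  norm_kern_le (by linarith [hz.1]) (by linarith [hz.2]) u

theorem one_le_lenA_mul_lenB (u : ℝ × ℝ × ℝ) : 1 ≤ lenA u * lenB u :=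
  one_le_mul_of_one_le_of_one_le (one_le_lenA u) (one_le_lenB u)

/-- The derivative in `z` of the exponent of `kern z u`. -/
def kernLin (u : ℝ × ℝ × ℝ) : ℂ × ℂ →L[ℂ] ℂ :=
  -((Real.log (lenA u) : ℂ) • ContinuousLinearMap.fst ℂ ℂ ℂ +
    (Real.log (lenB u) : ℂ) • ContinuousLinearMap.snd ℂ ℂ ℂ)

theorem continuous_kernLin : Continuous kernLin := by
  have h1 := Complex.continuous_ofReal.comp continuous_log_lenA
  have h2 := Complex.continuous_ofReal.comp continuous_log_lenB
  exact ((h1.smul continuous_const).add (h2.smul continuous_const)).neg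

theorem hasFDerivAt_kern (z : ℂ × ℂ) (u : ℝ × ℝ × ℝ) :
    HasFDerivAt (fun z => kern z u) (kern z u • kernLin u) z := by
  have h1 := ((hasFDerivAt_fst (𝕜 := ℂ) (p := z)).const_add 1).neg.mul_const
    (Real.log (lenA u) : ℂ)
  have h2 := ((hasFDerivAt_snd (𝕜 := ℂ) (p := z)).const_add 1).mul_const (Real.log (lenB u) : ℂ)
  refine (h1.sub h2).cexp.congr_fderiv ?_
  rw [kern, kernLin]
  congr 1
  ext <;> simp

/-- The logarithms cost a power 1/16, which is affordable because 7/8 - 1/16 = 13/16 > 3/4. -/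
theorem norm_kernLin_le (u : ℝ × ℝ × ℝ) : ‖kernLin u‖ ≤ 16 * (lenA u * lenB u) ^ (1 / 16 : ℝ) := by
  have hA := Real.log_nonneg (one_le_lenA u)
  have hB := Real.log_nonneg (one_le_lenB u)
  have h := Real.log_le_rpow_div (x := lenA u * lenB u) (ε := 1 / 16)
    (zero_le_one.trans (one_le_lenA_mul_lenB u)) (by norm_num)
  rw [Real.log_mul (lenA_pos u).ne' (lenB_pos u).ne'] at h
  have h' : ‖kernLin u‖ ≤ Real.log (lenA u) + Real.log (lenB u) := by
    rw [kernLin, norm_neg]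
    refine (norm_add_le _ _).trans ?_
    rw [norm_smul, norm_smul, Complex.norm_real, Complex.norm_real, Real.norm_of_nonneg hA,
      Real.norm_of_nonneg hB]
    have e1 := ContinuousLinearMap.norm_fst_le (𝕜 := ℂ) (E := ℂ) (F := ℂ)
    have e2 := ContinuousLinearMap.norm_snd_le (𝕜 := ℂ) (E := ℂ) (F := ℂ)
    nlinarith
  linarith

/-- Decay ⟨u₁⟩⁻¹⟨u₂⟩⁻¹ of the amplitude makes the integral converge absolutely beyond Re z = 0, with
a majorant independent of z and t. Differentiation under the integral and dominated convergence then
give both properties. -/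
theorem isGood_oscInt {P : ℝ × ℝ × ℝ → ℂ} (hP : Continuous P) {C : ℝ}
    (hC : ∀ u, ‖P u‖ ≤ C * ((jap u.1)⁻¹ * (jap u.2.1)⁻¹)) : IsGood (oscInt P) := by
  have hcp := continuous_psi
  have hck := continuous_kern
  have hcl := continuous_kernLin
  have hcF : ∀ z t, Continuous fun u => kern z u * P u * conj (psi t u) := fun z t =>
    ((continuous_kern_right z).mul hP).mul (Complex.continuous_conj.comp (continuous_psi_right t))
  have hb : ∀ z ∈ contDom, ∀ t u, ‖kern z u * P u * conj (psi t u)‖ ≤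
      C * ((lenA u * lenB u) ^ (-(7 / 8) : ℝ) * ((jap u.1)⁻¹ * (jap u.2.1)⁻¹)) := by
    intro z hz t u
    rw [norm_mul, norm_mul, Complex.norm_conj, norm_psi, mul_one]
    refine (mul_le_mul (norm_kern_le_of_mem hz u) (hC u) (norm_nonneg _)
      (Real.rpow_nonneg (zero_le_one.trans (one_le_lenA_mul_lenB u)) _)).trans_eq ?_
    ring
  have hbi := (integrable_lenA_mul_lenB_rpow_mul_jap (r := 7 / 8) (by norm_num)).const_mul C
  constructor
  · intro t z hz
    refine DifferentiableAt.differentiableWithinAt ?_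
    let F' : ℂ × ℂ → ℝ × ℝ × ℝ → (ℂ × ℂ →L[ℂ] ℂ) := fun z u =>
      (P u * conj (psi t u)) • (kern z u • kernLin u)
    -- The majorant is uniform on all of `contDom`, so that set itself serves as the neighbourhood
    -- of z.
    refine (hasFDerivAt_integral_of_dominated_of_fderiv_le (F' := F')
      (bound := fun u => (16 * C) * ((lenA u * lenB u) ^ (-(13 / 16) : ℝ) *
        ((jap u.1)⁻¹ * (jap u.2.1)⁻¹))) (isOpen_contDom.mem_nhds hz) ?_ ?_ ?_ ?_ ?_ ?_).differentiableAt
    · exact Filter.Eventually.of_forall fun z => (hcF z t).aestronglyMeasurable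
    · exact hbi.mono' (hcF z t).aestronglyMeasurable (Filter.Eventually.of_forall (hb z hz t))
    · refine Continuous.aestronglyMeasurable ?_
      exact (hP.mul (Complex.continuous_conj.comp (continuous_psi_right t))).smul
        ((continuous_kern_right z).smul hcl)
    · refine Filter.Eventually.of_forall fun u z hz => ?_
      have h1 : F' z u = (kern z u * P u * conj (psi t u)) • kernLin u := by
        simp only [F', smul_smul]
        congr 1
        ring
      rw [h1, norm_smul]
      have h0 : 0 < lenA u * lenB u := mul_pos (lenA_pos u) (lenB_pos u)
      refine (mul_le_mul (hb z hz t u) (norm_kernLin_le u) (norm_nonneg _)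
        ((norm_nonneg _).trans (hb z hz t u))).trans_eq ?_
      rw [show (-(13 / 16) : ℝ) = -(7 / 8) + 1 / 16 by norm_num, Real.rpow_add h0]
      ring
    · exact (integrable_lenA_mul_lenB_rpow_mul_jap (by norm_num)).const_mul _
    · refine Filter.Eventually.of_forall fun u z _ => ?_
      have h := (hasFDerivAt_kern z u).const_mul (P u * conj (psi t u))
      refine h.congr_of_eventuallyEq (Filter.Eventually.of_forall fun z => ?_)
      ring
  · refine continuousOn_of_dominated (F := fun (p : (ℂ × ℂ) × (ℝ × ℝ)) u =>
      kern p.1 u * P u * conj (psi p.2 u)) (fun p _ => (hcF p.1 p.2).aestronglyMeasurable)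
      (fun p hp => Filter.Eventually.of_forall (hb p.1 hp.1 p.2)) hbi
      (Filter.Eventually.of_forall fun u => Continuous.continuousOn ?_)
    have c1 : Continuous fun p : (ℂ × ℂ) × (ℝ × ℝ) => kern p.1 u :=
      hck.comp (continuous_fst.prodMk continuous_const)
    have c2 : Continuous fun p : (ℂ × ℂ) × (ℝ × ℝ) => psi p.2 u :=
      hcp.comp (continuous_snd.prodMk continuous_const)
    exact (c1.mul continuous_const).mul (Complex.continuous_conj.comp c2)

/-- The function `p P₁ + q P₂` with `p = 1/⟨u₁⟩²`, `q = u₁/⟨u₁⟩²`. -/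
def amp (P₁ P₂ : ℝ × ℝ × ℝ → ℂ) (u : ℝ × ℝ × ℝ) : ℂ :=
  (((jap u.1 ^ 2)⁻¹ : ℝ) : ℂ) * P₁ u + ((u.1 / jap u.1 ^ 2 : ℝ) : ℂ) * P₂ u

theorem continuous_ofReal_p : Continuous fun x : ℝ => (((jap x ^ 2)⁻¹ : ℝ) : ℂ) :=
  Complex.continuous_ofReal.comp
    (Continuous.inv₀ (by fun_prop) fun x => (pow_pos (jap_pos x) 2).ne')

theorem continuous_ofReal_q : Continuous fun x : ℝ => ((x / jap x ^ 2 : ℝ) : ℂ) :=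
  Complex.continuous_ofReal.comp
    (Continuous.div (by fun_prop) (by fun_prop) fun x => (pow_pos (jap_pos x) 2).ne')

theorem norm_ofReal_p_le (x : ℝ) : ‖(((jap x ^ 2)⁻¹ : ℝ) : ℂ)‖ ≤ (jap x)⁻¹ := by
  have h := one_le_jap x
  rw [Complex.norm_real, Real.norm_of_nonneg (by positivity)]
  exact inv_anti₀ (jap_pos x) (by nlinarith)

theorem norm_ofReal_q_le (x : ℝ) : ‖((x / jap x ^ 2 : ℝ) : ℂ)‖ ≤ (jap x)⁻¹ := by
  have h := jap_pos x
  have hx : |x| ≤ jap x := abs_le_of_sq_le_sq (by rw [jap_sq]; linarith) h.le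
  rw [Complex.norm_real, Real.norm_eq_abs, abs_div, abs_of_pos (pow_pos h 2), div_le_iff₀ (by positivity)]
  field_simp
  exact hx

theorem continuous_amp {P₁ P₂ : ℝ × ℝ × ℝ → ℂ} (h₁ : IsSymbol P₁) (h₂ : IsSymbol P₂) :
    Continuous (amp P₁ P₂) :=
  ((continuous_ofReal_p.comp continuous_fst).mul h₁.continuous).add
    ((continuous_ofReal_q.comp continuous_fst).mul h₂.continuous)

theorem norm_amp_le {P₁ P₂ : ℝ × ℝ × ℝ → ℂ} (h₁ : IsSymbol P₁) (h₂ : IsSymbol P₂) :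
    ∃ C, 0 ≤ C ∧ ∀ u, ‖amp P₁ P₂ u‖ ≤ C * (jap u.1)⁻¹ := by
  obtain ⟨C₁, h0, hC₁⟩ := h₁.bounded
  obtain ⟨C₂, h0', hC₂⟩ := h₂.bounded
  refine ⟨C₁ + C₂, add_nonneg h0 h0', fun u => ?_⟩
  have hj := jap_pos u.1
  refine (norm_add_le_of_le (norm_mul_le_of_le (norm_ofReal_p_le _) (hC₁ u))
    (norm_mul_le_of_le (norm_ofReal_q_le _) (hC₂ u))).trans_eq ?_
  ring

theorem integrable_kern_mul {z : ℂ × ℂ} (h1 : 0 < z.1.re) (h2 : 0 < z.2.re)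
    {P : ℝ × ℝ × ℝ → ℂ} (hP : Continuous P) {C : ℝ} (hC : ∀ u, ‖P u‖ ≤ C) :
    Integrable fun u => kern z u * P u :=
  (integrable_kern h1 h2).mul_bdd hP.aestronglyMeasurable (Filter.Eventually.of_forall hC)

theorem integrable_kern_mul_psi {z : ℂ × ℂ} (h1 : 0 < z.1.re) (h2 : 0 < z.2.re)
    {P : ℝ × ℝ × ℝ → ℂ} (hP : Continuous P) {C : ℝ} (hC : ∀ u, ‖P u‖ ≤ C) (t : ℝ × ℝ) :
    Integrable fun u => kern z u * P u * conj (psi t u) :=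
  (integrable_kern_mul h1 h2 hP hC).mul_bdd (c := 1)
    (Complex.continuous_conj.comp (continuous_psi_right t)).aestronglyMeasurable
    (Filter.Eventually.of_forall fun u => by rw [Complex.norm_conj, norm_psi])

/-- Integration by parts in u₁ replaces Q by amplitudes of size ⟨u₁⟩⁻¹: `P₁`, `P₂` come from
differentiating Q, `S₁`, `S₂` from the power of A, and the last term from the power of B. The
spectator k(u₂) makes the statement usable again when decay in the other variable has already been
gained. -/
theorem exists_oscInt_parts {Q : ℝ × ℝ × ℝ → ℂ} (hQ : IsSymbol Q) :
    ∃ P₁ P₂ S₁ S₂, IsSymbol P₁ ∧ IsSymbol P₂ ∧ IsSymbol S₁ ∧ IsSymbol S₂ ∧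
      ∀ (k : ℝ → ℂ) (C : ℝ), Continuous k → (∀ x, ‖k x‖ ≤ C) → ∀ (z : ℂ × ℂ) (t : ℝ × ℝ),
        0 < z.1.re → 0 < z.2.re →
        2 * Real.pi * Complex.I * t.1 * oscInt (fun u => k u.2.1 * Q u) z t =
          oscInt (fun u => k u.2.1 * amp P₁ P₂ u) z t +
          (-(1 + z.1)) * oscInt (fun u => k u.2.1 * amp S₁ S₂ u) z t +
          (-z.2) * oscInt (fun u => k u.2.1 * amp (fun _ => 0) Q u) z t := by
  obtain ⟨P₁, P₂, hP₁, hP₂, hD⟩ := hQ.exists_derivAlong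
  obtain ⟨S₁, eS₁⟩ : ∃ S : ℝ × ℝ × ℝ → ℂ, S = fun u =>
    ((rowU u 1 / lenA u : ℝ) : ℂ) * ((rowU u 2 / lenA u : ℝ) : ℂ) * Q u := ⟨_, rfl⟩
  obtain ⟨S₂, eS₂⟩ : ∃ S : ℝ × ℝ × ℝ → ℂ, S = fun u =>
    ((rowU u 2 / lenA u : ℝ) : ℂ) * ((rowU u 2 / lenA u : ℝ) : ℂ) * Q u := ⟨_, rfl⟩
  have hS₁ : IsSymbol S₁ := eS₁ ▸ ((IsSymbol.row 1).mul (.row 2)).mul hQ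
  have hS₂ : IsSymbol S₂ := eS₂ ▸ ((IsSymbol.row 2).mul (.row 2)).mul hQ
  refine ⟨P₁, P₂, S₁, S₂, hP₁, hP₂, hS₁, hS₂, fun k C hk hkC z t h1 h2 => ?_⟩
  have h0 := IsSymbol.const 0
  have hint : ∀ {P : ℝ × ℝ × ℝ → ℂ}, Continuous P → (∃ C, 0 ≤ C ∧ ∀ u, ‖P u‖ ≤ C) →
      Integrable (fun u => kern z u * P u) ∧
      Integrable (fun u => kern z u * (k u.2.1 * P u) * conj (psi t u)) := by
    rintro P hP ⟨D, -, hPD⟩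
    refine ⟨integrable_kern_mul h1 h2 hP hPD, integrable_kern_mul_psi h1 h2 (C := C * D)
      ((hk.comp (continuous_fst.comp continuous_snd)).mul hP)
      (fun u => norm_mul_le_of_le (hkC _) (hPD u)) t⟩
  have hbd : ∀ {S S' : ℝ × ℝ × ℝ → ℂ}, IsSymbol S → IsSymbol S' →
      ∃ C, 0 ≤ C ∧ ∀ u, ‖amp S S' u‖ ≤ C := by
    intro S S' hS hS'
    obtain ⟨D, hD0, hD⟩ := norm_amp_le hS hS'
    refine ⟨D, hD0, fun u => (hD u).trans (mul_le_of_le_one_right hD0 (inv_le_one_of_one_le₀ (one_le_jap _)))⟩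
  obtain ⟨i0, -⟩ := hint hQ.continuous hQ.bounded
  obtain ⟨iP, iP'⟩ := hint (continuous_amp hP₁ hP₂) (hbd hP₁ hP₂)
  obtain ⟨iS, iS'⟩ := hint (continuous_amp hS₁ hS₂) (hbd hS₁ hS₂)
  obtain ⟨iQ, iQ'⟩ := hint (continuous_amp h0 hQ) (hbd h0 hQ)
  have hfD : DerivAlong (fun u => kern z u * Q u) fun u =>
      (kern z u * amp P₁ P₂ u + (-(1 + z.1)) * (kern z u * amp S₁ S₂ u)) +
        (-(1 + z.2)) * (kern z u * amp (fun _ => 0) Q u) := by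
    intro c s h
    refine ((kern_derivAlong z c s h).mul (hD c s h)).congr_deriv ?_
    simp only [amp, dlogA, eS₁, eS₂]
    push_cast
    ring
  have hk' : Continuous fun x : ℝ =>
      k x * Complex.exp (-(2 * Real.pi * Complex.I * ((t.2 * x : ℝ) : ℂ))) := by fun_prop
  -- The power of B contributes -(1 + z₂)q and the divergence of the field contributes +q, which
  -- leaves -z₂q.
  have hg : (fun u => ((kern z u * amp P₁ P₂ u + (-(1 + z.1)) * (kern z u * amp S₁ S₂ u)) +
        (-(1 + z.2)) * (kern z u * amp (fun _ => 0) Q u)) + ((u.1 / jap u.1 ^ 2 : ℝ) : ℂ) *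
          (kern z u * Q u)) = fun u => (kern z u * amp P₁ P₂ u +
          (-(1 + z.1)) * (kern z u * amp S₁ S₂ u)) + (-z.2) * (kern z u * amp (fun _ => 0) Q u) := by
    funext u
    simp only [amp]
    ring
  have hck := continuous_kern_right z
  have hgi : Integrable fun u => ((kern z u * amp P₁ P₂ u +
      (-(1 + z.1)) * (kern z u * amp S₁ S₂ u)) + (-(1 + z.2)) * (kern z u * amp (fun _ => 0) Q u)) +
        ((u.1 / jap u.1 ^ 2 : ℝ) : ℂ) * (kern z u * Q u) := by
    rw [hg]
    exact (iP.add (iS.const_mul _)).add (iQ.const_mul _)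
  have hgc : Continuous fun u => (kern z u * amp P₁ P₂ u +
      (-(1 + z.1)) * (kern z u * amp S₁ S₂ u)) +
        (-(1 + z.2)) * (kern z u * amp (fun _ => 0) Q u) :=
    ((hck.mul (continuous_amp hP₁ hP₂)).add
      (continuous_const.mul (hck.mul (continuous_amp hS₁ hS₂)))).add
      (continuous_const.mul (hck.mul (continuous_amp h0 hQ)))
  have hfc : Continuous fun u => kern z u * Q u := hck.mul hQ.continuous
  have main := integral_derivAlong hfc hgc hfD i0 hgi hk' (C := C)
    (fun x => by rw [norm_mul, norm_exp_two_pi, mul_one]; exact hkC x) t.1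
  have hg' := fun u => congrFun hg u
  have i12 : Integrable fun u => kern z u * (k u.2.1 * amp P₁ P₂ u) * conj (psi t u) +
      (-(1 + z.1)) * (kern z u * (k u.2.1 * amp S₁ S₂ u) * conj (psi t u)) :=
    iP'.add (iS'.const_mul _)
  simp only [oscInt]
  rw [← integral_const_mul (-(1 + z.1)), ← integral_const_mul (-z.2),
    ← integral_add iP' (iS'.const_mul _), ← integral_add i12 (iQ'.const_mul _)]
  refine Eq.trans ?_ (main.symm.trans ?_)
  · congr 1
    refine integral_congr_ae (Filter.Eventually.of_forall fun u => ?_)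
    simp only [conj_psi]
    ring
  · refine integral_congr_ae (Filter.Eventually.of_forall fun u => ?_)
    simp only [hg', conj_psi]
    ring

/-- `ρ` is continuous and `O(1/⟨x⟩)`. -/
def IsDecay (k : ℝ → ℂ) : Prop := Continuous k ∧ ∃ C, 0 ≤ C ∧ ∀ x, ‖k x‖ ≤ C * (jap x)⁻¹

/-- The weight k supplies the decay in u₂ and the integration by parts supplies it in u₁, so every
term on the right falls under `isGood_oscInt`. -/
theorem exists_isGood_snd {Q : ℝ × ℝ × ℝ → ℂ} (hQ : IsSymbol Q) {k : ℝ → ℂ} (hk : IsDecay k) :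
    ∃ H, IsGood H ∧ ∀ (z : ℂ × ℂ) (t : ℝ × ℝ), 0 < z.1.re → 0 < z.2.re →
      2 * Real.pi * Complex.I * t.1 * oscInt (fun u => k u.2.1 * Q u) z t = H z t := by
  obtain ⟨P₁, P₂, S₁, S₂, hP₁, hP₂, hS₁, hS₂, h⟩ := exists_oscInt_parts hQ
  obtain ⟨hkc, C, hC0, hC⟩ := hk
  have hgood : ∀ {S S' : ℝ × ℝ × ℝ → ℂ}, IsSymbol S → IsSymbol S' →
      IsGood (oscInt fun u => k u.2.1 * amp S S' u) := by
    intro S S' hS hS'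
    obtain ⟨D, hD0, hD⟩ := norm_amp_le hS hS'
    refine isGood_oscInt (C := C * D) ((hkc.comp (continuous_fst.comp continuous_snd)).mul
      (continuous_amp hS hS')) fun u => ?_
    refine (norm_mul_le_of_le (hC _) (hD u)).trans_eq ?_
    ring
  refine ⟨_, ((hgood hP₁ hP₂).add ((hgood hS₁ hS₂).const_mul (c := fun z => -(1 + z.1))
    (by fun_prop))).add ((hgood (.const 0) hQ).const_mul (c := fun z => -z.2) (by fun_prop)),
    fun z t h1 h2 => ?_⟩
  exact h k C hkc (fun x => (hC x).trans
    (mul_le_of_le_one_right hC0 (inv_le_one_of_one_le₀ (one_le_jap _)))) z t h1 h2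

theorem exists_isGood_fst {Q : ℝ × ℝ × ℝ → ℂ} (hQ : IsSymbol Q) {k : ℝ → ℂ} (hk : IsDecay k) :
    ∃ H, IsGood H ∧ ∀ (z : ℂ × ℂ) (t : ℝ × ℝ), 0 < z.1.re → 0 < z.2.re →
      2 * Real.pi * Complex.I * t.2 * oscInt (fun u => k u.1 * Q u) z t = H z t := by
  obtain ⟨H, hH, h⟩ := exists_isGood_snd hQ.comp_flipU hk
  refine ⟨_, hH.swap, fun z t h1 h2 => ?_⟩
  rw [← h z.swap t.swap h2 h1, ← oscInt_comp_flipU]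
  rfl

/-- Holomorphic continuation of `∫ A^{-1-a} B^{-1-b} Q \bar{ψ_t}` for a symbol `Q`. -/
theorem exists_continuation {Q : ℝ × ℝ × ℝ → ℂ} (hQ : IsSymbol Q) :
    ∃ H, IsGood H ∧ ∀ (z : ℂ × ℂ) (t : ℝ × ℝ), 0 < z.1.re → 0 < z.2.re →
      (2 * Real.pi * Complex.I) ^ 2 * (t.1 * t.2) * oscInt Q z t = H z t := by
  obtain ⟨P₁, P₂, S₁, S₂, hP₁, hP₂, hS₁, hS₂, h⟩ := exists_oscInt_parts hQ
  have hp : IsDecay fun x : ℝ => (((jap x ^ 2)⁻¹ : ℝ) : ℂ) :=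
    ⟨continuous_ofReal_p, 1, zero_le_one, fun x => by rw [one_mul]; exact norm_ofReal_p_le x⟩
  have hq : IsDecay fun x : ℝ => ((x / jap x ^ 2 : ℝ) : ℂ) :=
    ⟨continuous_ofReal_q, 1, zero_le_one, fun x => by rw [one_mul]; exact norm_ofReal_q_le x⟩
  -- The amplitudes left by the first integration by parts are symbols times the decaying functions
  -- p and q of u₁. These act as the weight k while the second integration by parts is made in u₂.
  have key : ∀ {S S' : ℝ × ℝ × ℝ → ℂ}, IsSymbol S → IsSymbol S' → ∃ H, IsGood H ∧
      ∀ (z : ℂ × ℂ) (t : ℝ × ℝ), 0 < z.1.re → 0 < z.2.re →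
      2 * Real.pi * Complex.I * t.2 * oscInt (fun u => 1 * amp S S' u) z t = H z t := by
    intro S S' hS hS'
    obtain ⟨H, hH, e⟩ := exists_isGood_fst hS hp
    obtain ⟨H', hH', e'⟩ := exists_isGood_fst hS' hq
    refine ⟨_, hH.add hH', fun z t h1 h2 => ?_⟩
    rw [← e z t h1 h2, ← e' z t h1 h2, ← mul_add]
    congr 1
    have hi : ∀ {k : ℝ → ℂ} {S : ℝ × ℝ × ℝ → ℂ}, IsDecay k → IsSymbol S →
        Integrable fun u => kern z u * (k u.1 * S u) * conj (psi t u) := by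
      rintro k S ⟨hkc, C, hC0, hC⟩ hS
      obtain ⟨D, -, hD⟩ := hS.bounded
      refine integrable_kern_mul_psi h1 h2 (C := C * D)
        ((hkc.comp continuous_fst).mul hS.continuous) (fun u => norm_mul_le_of_le ((hC _).trans
        (mul_le_of_le_one_right hC0 (inv_le_one_of_one_le₀ (one_le_jap _)))) (hD u)) t
    rw [oscInt, oscInt, oscInt, ← integral_add (hi hp hS) (hi hq hS')]
    refine integral_congr_ae (Filter.Eventually.of_forall fun u => ?_)
    simp only [amp]
    ring
  obtain ⟨H₁, g₁, e₁⟩ := key hP₁ hP₂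
  obtain ⟨H₂, g₂, e₂⟩ := key hS₁ hS₂
  obtain ⟨H₃, g₃, e₃⟩ := key (.const 0) hQ
  refine ⟨_, (g₁.add (g₂.const_mul (c := fun z => -(1 + z.1)) (by fun_prop))).add
    (g₃.const_mul (c := fun z => -z.2) (by fun_prop)), fun z t h1 h2 => ?_⟩
  -- The first integration by parts is made with the trivial weight k = 1.
  have := h (fun _ => 1) 1 continuous_const (by simp) z t h1 h2
  simp only [← e₁ z t h1 h2, ← e₂ z t h1 h2, ← e₃ z t h1 h2]
  rw [show oscInt Q z t = oscInt (fun u => 1 * Q u) z t by simp only [one_mul]]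
  linear_combination (2 * Real.pi * Complex.I * t.2) * this

/-! ### Pairs of vectors in `ℝ³` in coordinates adapted to the big cell -/

theorem measurable_vec3 {X : Type*} [MeasurableSpace X] {f g h : X → ℝ} (hf : Measurable f)
    (hg : Measurable g) (hh : Measurable h) :
    Measurable fun x => (![f x, g x, h x] : Fin 3 → ℝ) := by
  refine measurable_pi_iff.2 fun i => ?_
  fin_cases i
  exacts [hf, hg, hh]

theorem lintegral_fin_three (f : (Fin 3 → ℝ) → ENNReal) (hf : Measurable f) :
    ∫⁻ v, f v = ∫⁻ a, ∫⁻ b, ∫⁻ c, f ![a, b, c] := by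
  have h1 := (volume_preserving_piFinSuccAbove (fun _ : Fin 3 => ℝ) 0).symm
  have h2 := (volume_preserving_piFinTwo (fun _ : Fin 2 => ℝ)).symm
  have m1 : Measurable fun z => f ((MeasurableEquiv.piFinSuccAbove (fun _ : Fin 3 => ℝ) 0).symm z) :=
    hf.comp (MeasurableEquiv.measurable _)
  rw [← h1.lintegral_comp hf, Measure.volume_eq_prod, lintegral_prod _ m1.aemeasurable]
  refine lintegral_congr fun a => ?_
  have m2 : Measurable fun w : Fin 2 → ℝ =>
      f ((MeasurableEquiv.piFinSuccAbove (fun _ : Fin 3 => ℝ) 0).symm (a, w)) :=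
    m1.comp measurable_prodMk_left
  have m3 : Measurable fun w : ℝ × ℝ => f ((MeasurableEquiv.piFinSuccAbove
      (fun _ : Fin 3 => ℝ) 0).symm (a, (MeasurableEquiv.piFinTwo fun _ => ℝ).symm w)) :=
    m2.comp (MeasurableEquiv.measurable _)
  refine (h2.lintegral_comp m2).symm.trans ?_
  rw [Measure.volume_eq_prod, lintegral_prod _ m3.aemeasurable]
  refine lintegral_congr fun b => lintegral_congr fun c => ?_
  congr 1
  ext i
  fin_cases i <;> rfl

theorem ae_ne_zero : ∀ᵐ x : ℝ, x ≠ 0 := Measure.ae_ne volume 0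

theorem lintegral_last (f : (Fin 3 → ℝ) → ENNReal) (hf : Measurable f) :
    ∫⁻ v, f v = ∫⁻ s, ∫⁻ y, ∫⁻ z, ENNReal.ofReal (s ^ 2) * f ![s, s * y, s * z] := by
  rw [lintegral_fin_three f hf]
  refine lintegral_congr_ae ?_
  filter_upwards [ae_ne_zero] with s hs
  have hm : Measurable fun z : ℝ × ℝ => f ![s, z.1, z.2] :=
    hf.comp (measurable_vec3 measurable_const measurable_fst measurable_snd)
  have hm1 : Measurable fun b => ∫⁻ c, f ![s, b, c] := Measurable.lintegral_prod_right' hm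
  rw [← lintegral_affine _ hm1 hs 0]
  refine lintegral_congr fun y => ?_
  have hm2 : ∀ w, Measurable fun z => f ![s, w, z] := fun w =>
    hf.comp (measurable_vec3 measurable_const measurable_const measurable_id)
  rw [← lintegral_affine _ (hm2 _) hs 0,
    ← lintegral_const_mul' _ _ ENNReal.ofReal_ne_top]
  refine lintegral_congr fun z => ?_
  simp only [zero_add]
  rw [← mul_assoc, ← ENNReal.ofReal_mul (abs_nonneg _), abs_mul_abs_self, sq]

/-- The coordinates are v = y·(1, u₂, u₃) + r·(0, 1, x), whose Jacobian is |r|. -/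
theorem lintegral_middle (f : (Fin 3 → ℝ) → ENNReal) (hf : Measurable f) (u₂ u₃ : ℝ) :
    ∫⁻ v, f v = ∫⁻ y, ∫⁻ r, ∫⁻ x, ENNReal.ofReal |r| * f ![y, r + y * u₂, r * x + y * u₃] := by
  rw [lintegral_fin_three f hf]
  refine lintegral_congr fun y => ?_
  rw [← lintegral_add_right_eq_self _ (y * u₂)]
  refine lintegral_congr_ae ?_
  filter_upwards [ae_ne_zero] with r hr
  have hm : Measurable fun z => f ![y, r + y * u₂, z] :=
    hf.comp (measurable_vec3 measurable_const measurable_const measurable_id)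
  rw [← lintegral_affine _ hm hr (y * u₃)]
  simp only [add_comm]

theorem lintegral_rotate (f : ℝ × ℝ × ℝ → ENNReal) (hf : Measurable f) :
    ∫⁻ a, ∫⁻ b, ∫⁻ c, f (a, b, c) = ∫⁻ c, ∫⁻ a, ∫⁻ b, f (a, b, c) := by
  have h1 : ∀ a, ∫⁻ b, ∫⁻ c, f (a, b, c) = ∫⁻ c, ∫⁻ b, f (a, b, c) := fun a =>
    lintegral_lintegral_swap (f := fun b c => f (a, b, c)) (by fun_prop)
  simp only [h1]
  refine lintegral_lintegral_swap (f := fun a c => ∫⁻ b, f (a, b, c)) ?_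
  exact (Measurable.lintegral_prod_right' (f := fun z : (ℝ × ℝ) × ℝ => f (z.1.1, z.2, z.1.2))
    (by fun_prop)).aemeasurable

/-! ### Gaussian integrals -/

theorem lintegral_exp_sq {b : ℝ} (hb : 0 < b) :
    ∫⁻ x : ℝ, ENNReal.ofReal (Real.exp (-Real.pi * b ^ 2 * x ^ 2)) = ENNReal.ofReal b⁻¹ := by
  have hpi := Real.pi_pos
  have h := integral_gaussian (Real.pi * b ^ 2)
  have hi := integrable_exp_neg_mul_sq (b := Real.pi * b ^ 2) (by positivity)
  simp only [neg_mul] at h hi ⊢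
  rw [← ofReal_integral_eq_lintegral_ofReal hi
    (Filter.Eventually.of_forall fun x => (Real.exp_pos _).le), h]
  congr 1
  rw [show Real.pi / (Real.pi * b ^ 2) = (b⁻¹) ^ 2 by field_simp, Real.sqrt_sq (by positivity)]

theorem lintegral_abs_pow_mul_exp_sq {b : ℝ} (hb : 0 < b) (n : ℕ) :
    ∫⁻ x : ℝ, ENNReal.ofReal (|x| ^ n * Real.exp (-b * x ^ 2)) =
      ENNReal.ofReal (b ^ (-((n : ℝ) + 1) / 2) * Real.Gamma (((n : ℝ) + 1) / 2)) := by
  have h := integral_rpow_mul_exp_neg_mul_rpow (p := 2) (q := n) (by norm_num)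
    (by have := n.cast_nonneg (α := ℝ); linarith) hb
  have h2 := integral_comp_abs (f := fun x : ℝ => x ^ n * Real.exp (-b * x ^ 2))
  have hi : Integrable fun x : ℝ => |x| ^ n * Real.exp (-b * x ^ 2) := by
    refine ((integrable_rpow_mul_exp_neg_mul_sq hb (s := n)
      (by have := n.cast_nonneg (α := ℝ); linarith)).norm).congr
      (Filter.Eventually.of_forall fun x => ?_)
    simp [Real.rpow_natCast]
  rw [← ofReal_integral_eq_lintegral_ofReal hi
    (Filter.Eventually.of_forall fun x => by positivity)]
  congr 1
  simp only [sq_abs] at h2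
  rw [h2]
  simp only [Real.rpow_natCast, Real.rpow_ofNat] at h
  rw [h]
  ring

theorem lintegral_abs_mul_exp_sq {b : ℝ} (hb : 0 < b) :
    ∫⁻ x : ℝ, ENNReal.ofReal (|x| * Real.exp (-Real.pi * b ^ 2 * x ^ 2)) =
      ENNReal.ofReal (Real.pi * b ^ 2)⁻¹ := by
  have h := lintegral_abs_pow_mul_exp_sq (b := Real.pi * b ^ 2) (by positivity) 1
  simp only [pow_one, neg_mul] at h ⊢
  rw [h]
  norm_num
  rw [Real.rpow_neg_one]
  congr 1
  field_simp

theorem lintegral_sq_mul_exp_sq {b : ℝ} (hb : 0 < b) :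
    ∫⁻ x : ℝ, ENNReal.ofReal (x ^ 2 * Real.exp (-Real.pi * b ^ 2 * x ^ 2)) =
      ENNReal.ofReal (2 * Real.pi * b ^ 3)⁻¹ := by
  have hpi := Real.pi_pos
  have h := lintegral_abs_pow_mul_exp_sq (b := Real.pi * b ^ 2) (by positivity) 2
  simp only [sq_abs, neg_mul] at h ⊢
  rw [h]
  congr 1
  have hG : Real.Gamma ((((2 : ℕ) : ℝ) + 1) / 2) = 1 / 2 * √Real.pi := by
    rw [show (((2 : ℕ) : ℝ) + 1) / 2 = 1 / 2 + 1 by norm_num, Real.Gamma_add_one (by norm_num),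
      Real.Gamma_one_half_eq]
  have hr : (Real.pi * b ^ 2) ^ (-(((2 : ℕ) : ℝ) + 1) / 2) = (Real.pi * √Real.pi * b ^ 3)⁻¹ := by
    rw [show -(((2 : ℕ) : ℝ) + 1) / 2 = -((1 : ℝ) + 1 / 2) by norm_num, Real.rpow_neg (by positivity),
      Real.rpow_add (by positivity), Real.rpow_one, ← Real.sqrt_eq_rpow,
      Real.sqrt_mul hpi.le, Real.sqrt_sq hb.le]
    ring
  rw [hG, hr]
  have := Real.sqrt_pos.2 hpi
  field_simp

theorem len_rowU (u : ℝ × ℝ × ℝ) : len (rowU u) = lenA u := by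
  rw [← Real.sqrt_sq (show 0 ≤ len (rowU u) from Real.sqrt_nonneg _), len_sq]
  simp [rowU, lenA]

theorem len_crossU (u : ℝ × ℝ × ℝ) : len (crossU u) = lenB u := by
  rw [← Real.sqrt_sq (show 0 ≤ len (crossU u) from Real.sqrt_nonneg _), len_sq]
  simp only [crossU, lenB]
  congr 1
  simp
  ring

theorem measurable_rowU : Measurable rowU :=
  measurable_pi_iff.2 fun i => (continuous_rowU i).measurable

theorem measurable_crossU : Measurable crossU :=
  measurable_pi_iff.2 fun i => (continuous_crossU i).measurable

/-- The unit vector along `v`. -/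
def unitV (v : Fin 3 → ℝ) : Fin 3 → ℝ := (len v)⁻¹ • v

theorem continuous_len : Continuous len := by
  have : Continuous fun v : Fin 3 → ℝ => v ⬝ᵥ v := by
    simp only [dotProduct]
    fun_prop
  exact this.sqrt

theorem measurable_unitV : Measurable unitV :=
  (continuous_len.measurable.inv).smul measurable_id

theorem unitV_smul (c : ℝ) (hc : c ≠ 0) (v : Fin 3 → ℝ) :
    unitV (c • v) = unitV v ∨ unitV (c • v) = -unitV v := by
  have e : unitV (c • v) = (|c|⁻¹ * c) • unitV v := by
    rw [unitV, unitV, len_smul, smul_smul, smul_smul, mul_inv]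
    congr 1
    ring
  rcases lt_or_gt_of_ne hc with h | h
  · right
    rw [e, abs_of_neg h, inv_neg, neg_mul, inv_mul_cancel₀ hc, neg_one_smul]
  · left
    rw [e, abs_of_pos h, inv_mul_cancel₀ hc, one_smul]

/-- Invariance under sign changes of either argument. -/
def IsEven₂ {E : Type*} (F : (Fin 3 → ℝ) → (Fin 3 → ℝ) → E) : Prop :=
  (∀ c r, F (-c) r = F c r) ∧ ∀ c r, F c (-r) = F c r

theorem IsEven₂.smul {E : Type*} {F : (Fin 3 → ℝ) → (Fin 3 → ℝ) → E} (hF : IsEven₂ F)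
    {a b : ℝ} (ha : a ≠ 0) (hb : b ≠ 0) (c r : Fin 3 → ℝ) :
    F (unitV (a • c)) (unitV (b • r)) = F (unitV c) (unitV r) := by
  rcases unitV_smul a ha c with h | h <;> rcases unitV_smul b hb r with h' | h' <;>
    rw [h, h'] <;> simp only [hF.1, hF.2]

/-- The Gaussian density on pairs of vectors. -/
def gaussW (z : (Fin 3 → ℝ) × (Fin 3 → ℝ)) : ENNReal :=
  ENNReal.ofReal (Real.exp (-Real.pi * (len z.2) ^ 2) * Real.exp (-Real.pi * (len z.1) ^ 2))

theorem measurable_gaussW : Measurable gaussW := by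
  have := continuous_len
  unfold gaussW
  fun_prop

/-- The second vector is s·(1, y, z) and the first is y'·(1, y, z) + r·(0, 1, x). Their cross
product is rs times `crossU (x, y, z)`, so (x, y, z) is the big-cell coordinate of the frame of the
pair, while s, y', r are to be integrated out. -/
theorem lintegral_pairs (H : (Fin 3 → ℝ) × (Fin 3 → ℝ) → ENNReal) (hH : Measurable H) :
    ∫⁻ z, H z = ∫⁻ s, ∫⁻ y, ∫⁻ z, ENNReal.ofReal (s ^ 2) * ∫⁻ y', ∫⁻ r, ∫⁻ x, ENNReal.ofReal |r| *
      H (![y', r + y' * y, r * x + y' * z], ![s, s * y, s * z]) := by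
  rw [Measure.volume_eq_prod, lintegral_prod_symm _ hH.aemeasurable,
    lintegral_last _ (Measurable.lintegral_prod_left' hH)]
  refine lintegral_congr fun s => lintegral_congr fun y => lintegral_congr fun z => ?_
  congr 1
  exact lintegral_middle _ (hH.comp measurable_prodMk_right) y z

theorem lintegral_gauss_inner (F : ℝ → ENNReal) (hF : Measurable F) (y z : ℝ) :
    ∫⁻ y', ∫⁻ r, ∫⁻ x, ENNReal.ofReal (|r| *
      Real.exp (-Real.pi * len ![y', r + y' * y, r * x + y' * z] ^ 2)) * F x =
      ∫⁻ x, ENNReal.ofReal (lenA (x, y, z) / (Real.pi * lenB (x, y, z) ^ 2)) * F x := by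
  have hlen := continuous_len
  have hv : Measurable fun p : ℝ × ℝ × ℝ =>
      (![p.1, p.2.1 + p.1 * y, p.2.1 * p.2.2 + p.1 * z] : Fin 3 → ℝ) :=
    measurable_vec3 (by fun_prop) (by fun_prop) (by fun_prop)
  have hm : Measurable fun p : ℝ × ℝ × ℝ => ENNReal.ofReal (|p.2.1| *
      Real.exp (-Real.pi * len ![p.1, p.2.1 + p.1 * y, p.2.1 * p.2.2 + p.1 * z] ^ 2)) := by
    have := hlen.measurable.comp hv
    simp only [Function.comp_def] at this
    fun_prop
  have hpi := Real.pi_pos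
  rw [lintegral_rotate (fun p => ENNReal.ofReal (|p.2.1| *
      Real.exp (-Real.pi * len ![p.1, p.2.1 + p.1 * y, p.2.1 * p.2.2 + p.1 * z] ^ 2)) * F p.2.2)
      (hm.mul (hF.comp (by fun_prop)))]
  refine lintegral_congr fun x => ?_
  have hm' : Measurable fun p : ℝ × ℝ => ENNReal.ofReal (|p.2| *
      Real.exp (-Real.pi * len ![p.1, p.2 + p.1 * y, p.2 * x + p.1 * z] ^ 2)) :=
    hm.comp (f := fun p : ℝ × ℝ => (p.1, p.2, x)) (by fun_prop)
  rw [lintegral_lintegral_swap (f := fun a b => ENNReal.ofReal (|b| *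
    Real.exp (-Real.pi * len ![a, b + a * y, b * x + a * z] ^ 2)) * F x)
    (hm'.mul_const _).aemeasurable]
  set A := lenA (x, y, z) with hA
  set B := lenB (x, y, z) with hB
  have hA0 : 0 < A := lenA_pos _
  have hB0 : 0 < B := lenB_pos _
  have hA2 : A ^ 2 = 1 + y ^ 2 + z ^ 2 := lenA_sq _
  have hB2 : B ^ 2 = 1 + x ^ 2 + (z - x * y) ^ 2 := lenB_sq _
  -- Completing the square in a: the vectors (1, y, z) and (0, 1, x) have inner product y + xz, the
  -- first has length A, and their Gram determinant is B². The coefficient of r² left over is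
  -- therefore (B/A)².
  have h1 : ∀ r a : ℝ, ENNReal.ofReal (|r| *
      Real.exp (-Real.pi * len ![a, r + a * y, r * x + a * z] ^ 2)) * F x =
      ENNReal.ofReal (|r| * Real.exp (-Real.pi * (B / A) ^ 2 * r ^ 2)) * F x *
        ENNReal.ofReal (Real.exp (-Real.pi * A ^ 2 * (a + r * (y + x * z) / A ^ 2) ^ 2)) := by
    intro r a
    rw [mul_right_comm, ← ENNReal.ofReal_mul (by positivity), mul_assoc, ← Real.exp_add]
    congr 4
    rw [len_sq]
    simp
    have hA20 : (1 + y ^ 2 + z ^ 2) ≠ 0 := by positivity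
    rw [div_pow, hA2, hB2]
    field_simp
    ring
  simp only [h1]
  have h2 : ∀ r : ℝ, ∫⁻ a : ℝ, ENNReal.ofReal (Real.exp (-Real.pi * A ^ 2 *
      (a + r * (y + x * z) / A ^ 2) ^ 2)) = ENNReal.ofReal A⁻¹ := fun r => by
    rw [lintegral_add_right_eq_self (fun a : ℝ => ENNReal.ofReal (Real.exp (-Real.pi * A ^ 2 * a ^ 2))),
      lintegral_exp_sq hA0]
  have h3 : ∀ r : ℝ, ∫⁻ a : ℝ, ENNReal.ofReal (|r| * Real.exp (-Real.pi * (B / A) ^ 2 * r ^ 2)) *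
      F x * ENNReal.ofReal (Real.exp (-Real.pi * A ^ 2 * (a + r * (y + x * z) / A ^ 2) ^ 2)) =
      ENNReal.ofReal (|r| * Real.exp (-Real.pi * (B / A) ^ 2 * r ^ 2)) *
        (F x * ENNReal.ofReal A⁻¹) := fun r => by
    rw [lintegral_const_mul _ (by fun_prop), h2, mul_assoc]
  simp only [h3]
  rw [lintegral_mul_const _ (by fun_prop), lintegral_abs_mul_exp_sq (by positivity),
    mul_left_comm, mul_comm, ← ENNReal.ofReal_mul (by positivity)]
  congr 2
  field_simp

/-- The Gaussian average of an even function of the frame attached to a pair of vectors, in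
coordinates on the big cell. -/
theorem lintegral_gaussW_mul (F : (Fin 3 → ℝ) → (Fin 3 → ℝ) → ENNReal)
    (hF : Measurable (Function.uncurry F)) (hev : IsEven₂ F) :
    ∫⁻ z, gaussW z * F (unitV (z.1 ⨯₃ z.2)) (unitV z.2) =
      ∫⁻ u, ENNReal.ofReal (2 * Real.pi ^ 2 * (lenA u * lenB u) ^ 2)⁻¹ *
        F (unitV (crossU u)) (unitV (rowU u)) := by
  have hpi := Real.pi_pos
  have hcr : Measurable fun z : (Fin 3 → ℝ) × (Fin 3 → ℝ) => z.1 ⨯₃ z.2 := by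
    simp only [cross_apply]
    exact measurable_vec3 (by fun_prop) (by fun_prop) (by fun_prop)
  have hH : Measurable fun z : (Fin 3 → ℝ) × (Fin 3 → ℝ) =>
      gaussW z * F (unitV (z.1 ⨯₃ z.2)) (unitV z.2) :=
    measurable_gaussW.mul (hF.comp ((measurable_unitV.comp hcr).prodMk
      (measurable_unitV.comp measurable_snd)))
  let Fu : ℝ × ℝ × ℝ → ENNReal := fun u => F (unitV (crossU u)) (unitV (rowU u))
  have hFu : Measurable Fu := hF.comp ((measurable_unitV.comp measurable_crossU).prodMk
      (measurable_unitV.comp measurable_rowU))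
  let Z : ℝ × ℝ → ENNReal := fun p => ∫⁻ x, ENNReal.ofReal
    (lenA (x, p.1, p.2) / (Real.pi * lenB (x, p.1, p.2) ^ 2)) * Fu (x, p.1, p.2)
  have hZ : Measurable Z :=
    Measurable.lintegral_prod_right' (f := fun q : (ℝ × ℝ) × ℝ => ENNReal.ofReal
      (lenA (q.2, q.1.1, q.1.2) / (Real.pi * lenB (q.2, q.1.1, q.1.2) ^ 2)) *
        Fu (q.2, q.1.1, q.1.2)) (by fun_prop)
  rw [lintegral_pairs _ hH]
  -- Null sets must be dropped here because the direction of a scaled vector is determined, up to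
  -- sign, only when s and r are nonzero.
  have step : ∀ᵐ s : ℝ, ∀ y z : ℝ, ENNReal.ofReal (s ^ 2) * ∫⁻ y', ∫⁻ r, ∫⁻ x, ENNReal.ofReal |r| *
      (gaussW (![y', r + y' * y, r * x + y' * z], ![s, s * y, s * z]) *
        F (unitV (![y', r + y' * y, r * x + y' * z] ⨯₃ ![s, s * y, s * z]))
          (unitV ![s, s * y, s * z])) =
      ENNReal.ofReal (s ^ 2 * Real.exp (-Real.pi * lenA (0, y, z) ^ 2 * s ^ 2)) * Z (y, z) := by
    filter_upwards [ae_ne_zero] with s hs y z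
    rw [ENNReal.ofReal_mul (sq_nonneg s), mul_assoc]
    congr 1
    simp only [Z]
    rw [← lintegral_gauss_inner (fun x => Fu (x, y, z)) (hFu.comp (by fun_prop)) y z,
      ← lintegral_const_mul' _ _ ENNReal.ofReal_ne_top]
    refine lintegral_congr fun y' => ?_
    rw [← lintegral_const_mul' _ _ ENNReal.ofReal_ne_top]
    refine lintegral_congr_ae ?_
    filter_upwards [ae_ne_zero] with r hr
    rw [← lintegral_const_mul' _ _ ENNReal.ofReal_ne_top]
    refine lintegral_congr fun x => ?_
    have e1 : (![s, s * y, s * z] : Fin 3 → ℝ) = s • rowU (x, y, z) := by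
      ext i
      fin_cases i <;> simp [rowU]
    have e2 : ![y', r + y' * y, r * x + y' * z] ⨯₃ ![s, s * y, s * z] =
        (r * s) • crossU (x, y, z) := by
      rw [cross_apply]
      ext i
      fin_cases i <;> simp [crossU] <;> ring
    -- Evenness of F removes the signs of rs and of s.
    rw [e2, e1, hev.smul (mul_ne_zero hr hs) hs, gaussW]
    simp only [len_smul, len_rowU]
    rw [← mul_assoc, ← mul_assoc, ← ENNReal.ofReal_mul (abs_nonneg _),
      ← ENNReal.ofReal_mul (by positivity)]
    congr 2
    rw [mul_pow, sq_abs, show lenA (x, y, z) = lenA (0, y, z) from rfl]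
    ring_nf
  -- The integral over s gives 1/(2πA³). Together with A/(πB²) from the inner integral this is
  -- 1/(2π²A²B²), the source of the constant in the theorem.
  have step2 : ∫⁻ s : ℝ, ∫⁻ y : ℝ, ∫⁻ z : ℝ,
      ENNReal.ofReal (s ^ 2 * Real.exp (-Real.pi * lenA (0, y, z) ^ 2 * s ^ 2)) * Z (y, z) =
      ∫⁻ y, ∫⁻ z, ENNReal.ofReal (2 * Real.pi * lenA (0, y, z) ^ 3)⁻¹ * Z (y, z) := by
    rw [← lintegral_rotate (fun p : ℝ × ℝ × ℝ => ENNReal.ofReal (p.2.2 ^ 2 *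
      Real.exp (-Real.pi * lenA (0, p.1, p.2.1) ^ 2 * p.2.2 ^ 2)) * Z (p.1, p.2.1)) (by fun_prop)]
    refine lintegral_congr fun y => lintegral_congr fun z => ?_
    dsimp only
    rw [lintegral_mul_const _ (by fun_prop), lintegral_sq_mul_exp_sq (lenA_pos _)]
  have step3 : ∀ y z : ℝ, ENNReal.ofReal (2 * Real.pi * lenA (0, y, z) ^ 3)⁻¹ * Z (y, z) =
      ∫⁻ x, ENNReal.ofReal (2 * Real.pi ^ 2 * (lenA (x, y, z) * lenB (x, y, z)) ^ 2)⁻¹ *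
        Fu (x, y, z) := by
    intro y z
    rw [← lintegral_const_mul' _ _ ENNReal.ofReal_ne_top]
    refine lintegral_congr fun x => ?_
    have hA := lenA_pos (x, y, z)
    have hB := lenB_pos (x, y, z)
    rw [show lenA (0, y, z) = lenA (x, y, z) from rfl, ← mul_assoc,
      ← ENNReal.ofReal_mul (by positivity)]
    congr 2
    field_simp
  change _ = ∫⁻ u, ENNReal.ofReal (2 * Real.pi ^ 2 * (lenA u * lenB u) ^ 2)⁻¹ * Fu u
  rw [lintegral_congr_ae (g := fun s => ∫⁻ y, ∫⁻ z, ENNReal.ofReal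
    (s ^ 2 * Real.exp (-Real.pi * lenA (0, y, z) ^ 2 * s ^ 2)) * Z (y, z))
    (by filter_upwards [step] with s hs using lintegral_congr fun y => lintegral_congr fun z => hs y z),
    step2]
  simp only [step3]
  rw [lintegral_rotate (fun p : ℝ × ℝ × ℝ => ENNReal.ofReal (2 * Real.pi ^ 2 *
    (lenA (p.2.2, p.1, p.2.1) * lenB (p.2.2, p.1, p.2.1)) ^ 2)⁻¹ * Fu (p.2.2, p.1, p.2.1))
    (by fun_prop), lintegral_triple _ (by fun_prop)]

/-! ### The Haar measure of `K` in coordinates on the big cell -/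

instance : haarK.IsMulLeftInvariant := by unfold haarK; infer_instance

instance : IsProbabilityMeasure haarK := ⟨Measure.haarMeasure_self⟩

/-- For a rotation the cofactor matrix is the matrix itself, the adjugate being the transpose. -/
theorem cross_vecMul {k : Matrix (Fin 3) (Fin 3) ℝ} (hk : k ∈ SO3) (p q : Fin 3 → ℝ) :
    (p ᵥ* k) ⨯₃ (q ᵥ* k) = (p ⨯₃ q) ᵥ* k := by
  have h := adjugate_of_mem_SO3 hk
  rw [Matrix.adjugate_fin_three] at h
  have e : ∀ j i, _ := fun j i => congrFun (congrFun h j) i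
  ext j
  fin_cases j <;> simp [cross_apply, vecMul, dotProduct, Fin.sum_univ_three]
  · have e0 := e 0 0; have e1 := e 0 1; have e2 := e 0 2
    simp at e0 e1 e2
    linear_combination (p 1 * q 2 - p 2 * q 1) * e0 + (p 2 * q 0 - p 0 * q 2) * e1 +
      (p 0 * q 1 - p 1 * q 0) * e2
  · have e0 := e 1 0; have e1 := e 1 1; have e2 := e 1 2
    simp at e0 e1 e2
    linear_combination (p 1 * q 2 - p 2 * q 1) * e0 + (p 2 * q 0 - p 0 * q 2) * e1 +
      (p 0 * q 1 - p 1 * q 0) * e2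
  · have e0 := e 2 0; have e1 := e 2 1; have e2 := e 2 2
    simp at e0 e1 e2
    linear_combination (p 1 * q 2 - p 2 * q 1) * e0 + (p 2 * q 0 - p 0 * q 2) * e1 +
      (p 0 * q 1 - p 1 * q 0) * e2

theorem len_vecMul {k : Matrix (Fin 3) (Fin 3) ℝ} (hk : k ∈ SO3) (p : Fin 3 → ℝ) :
    len (p ᵥ* k) = len p := by
  rw [len, len]
  congr 1
  rw [← Matrix.dotProduct_mulVec, ← Matrix.mulVec_transpose, Matrix.mulVec_mulVec,
    ((mem_SO3_iff k).1 hk).1, Matrix.one_mulVec]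

theorem unitV_vecMul {k : Matrix (Fin 3) (Fin 3) ℝ} (hk : k ∈ SO3) (p : Fin 3 → ℝ) :
    unitV (p ᵥ* k) = unitV p ᵥ* k := by
  rw [unitV, unitV, len_vecMul hk, Matrix.smul_vecMul]

theorem measurePreserving_vecMul {k : Matrix (Fin 3) (Fin 3) ℝ} (hk : k ∈ SO3) :
    MeasurePreserving fun p : Fin 3 → ℝ => p ᵥ* k := by
  have hd : kᵀ.det = 1 := by rw [Matrix.det_transpose, ((mem_SO3_iff k).1 hk).2]
  have h := Real.map_matrix_volume_pi_eq_smul_volume_pi (M := kᵀ) (by rw [hd]; exact one_ne_zero)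
  have e : ⇑(toLin' kᵀ) = fun p : Fin 3 → ℝ => p ᵥ* k := by
    ext p : 1
    rw [Matrix.toLin'_apply, Matrix.mulVec_transpose]
  rw [hd, e] at h
  refine ⟨?_, by simpa using h⟩
  rw [← e]
  exact (LinearMap.continuous_on_pi _).measurable

theorem unitV_sq {v : Fin 3 → ℝ} (hv : v ≠ 0) :
    unitV v 0 ^ 2 + unitV v 1 ^ 2 + unitV v 2 ^ 2 = 1 := by
  have h := len_pos hv
  rw [← len_sq, unitV, len_smul, abs_of_pos (by positivity), inv_mul_cancel₀ h.ne', one_pow]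

theorem exists_frame {p q : Fin 3 → ℝ} (h : p ⨯₃ q ≠ 0) :
    ∃ k : SO3, (k : Matrix (Fin 3) (Fin 3) ℝ) 0 = unitV (p ⨯₃ q) ∧
      (k : Matrix (Fin 3) (Fin 3) ℝ) 2 = unitV q := by
  have hq : q ≠ 0 := by
    rintro rfl
    simp at h
  have hperp : unitV (p ⨯₃ q) 0 * unitV q 0 + unitV (p ⨯₃ q) 1 * unitV q 1 +
      unitV (p ⨯₃ q) 2 * unitV q 2 = 0 := by
    simp only [unitV, Pi.smul_apply, smul_eq_mul]
    simp [cross_apply]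
    ring
  exact ⟨⟨_, frame_mem_SO3 (unitV_sq h) (unitV_sq hq) hperp⟩, rfl, rfl⟩

theorem lintegral_gaussW : ∫⁻ z, gaussW z = 1 := by
  have hlen := continuous_len
  have h1 : ∫⁻ v : Fin 3 → ℝ, ENNReal.ofReal (Real.exp (-Real.pi * len v ^ 2)) = 1 := by
    have h0 : ∫⁻ x : ℝ, ENNReal.ofReal (Real.exp (-Real.pi * x ^ 2)) = 1 := by
      have := lintegral_exp_sq zero_lt_one
      simpa using this
    rw [lintegral_fin_three _ (by fun_prop)]
    have e : ∀ a b c : ℝ, ENNReal.ofReal (Real.exp (-Real.pi * len ![a, b, c] ^ 2)) =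
        ENNReal.ofReal (Real.exp (-Real.pi * a ^ 2)) * (ENNReal.ofReal (Real.exp (-Real.pi * b ^ 2)) *
          ENNReal.ofReal (Real.exp (-Real.pi * c ^ 2))) := by
      intro a b c
      rw [← ENNReal.ofReal_mul (Real.exp_pos _).le, ← ENNReal.ofReal_mul (Real.exp_pos _).le,
        ← Real.exp_add, ← Real.exp_add, len_sq]
      congr 2
      simp
      ring
    simp only [e, lintegral_const_mul' _ _ ENNReal.ofReal_ne_top, h0, mul_one]
  rw [Measure.volume_eq_prod, lintegral_prod _ measurable_gaussW.aemeasurable]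
  have e : ∀ p q : Fin 3 → ℝ, gaussW (p, q) = ENNReal.ofReal (Real.exp (-Real.pi * len p ^ 2)) *
      ENNReal.ofReal (Real.exp (-Real.pi * len q ^ 2)) := by
    intro p q
    rw [gaussW, mul_comm, ENNReal.ofReal_mul (Real.exp_pos _).le]
  simp only [e, lintegral_const_mul' _ _ ENNReal.ofReal_ne_top, h1, mul_one]

theorem measurable_cross :
    Measurable fun z : (Fin 3 → ℝ) × (Fin 3 → ℝ) => z.1 ⨯₃ z.2 := by
  simp only [cross_apply]
  exact measurable_vec3 (by fun_prop) (by fun_prop) (by fun_prop)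

/-- In the coordinates of `lintegral_pairs` the third entry of the cross product is -rs, which
vanishes only on a null set. -/
theorem ae_cross_ne_zero : ∀ᵐ z : (Fin 3 → ℝ) × (Fin 3 → ℝ), z.1 ⨯₃ z.2 ≠ 0 := by
  have hS : MeasurableSet {z : (Fin 3 → ℝ) × (Fin 3 → ℝ) | z.1 ⨯₃ z.2 = 0} :=
    measurable_cross (measurableSet_singleton 0)
  rw [ae_iff]
  simp only [not_not]
  rw [← lintegral_indicator_one hS, lintegral_pairs _ (measurable_one.indicator hS)]
  refine (lintegral_congr_ae (g := fun _ => 0) ?_).trans lintegral_zero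
  filter_upwards [ae_ne_zero] with s hs
  have : ∀ y z : ℝ, ∫⁻ y', ∫⁻ r, ∫⁻ x, ENNReal.ofReal |r| *
      Set.indicator {z : (Fin 3 → ℝ) × (Fin 3 → ℝ) | z.1 ⨯₃ z.2 = 0} 1
        ((![y', r + y' * y, r * x + y' * z], ![s, s * y, s * z]) :
          (Fin 3 → ℝ) × (Fin 3 → ℝ)) = (0 : ENNReal) := by
    intro y z
    refine (lintegral_congr fun y' => ?_).trans lintegral_zero
    refine (lintegral_congr_ae (g := fun _ => 0) ?_).trans lintegral_zero
    filter_upwards [ae_ne_zero] with r hr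
    refine (lintegral_congr fun x => ?_).trans lintegral_zero
    rw [Set.indicator_of_notMem, mul_zero]
    intro h
    have h2 := congrFun h 2
    simp [cross_apply] at h2
    have : r * s = 0 := by linear_combination -h2
    exact mul_ne_zero hr hs this
  simp [this]

theorem measurable_entry (i j : Fin 3) :
    Measurable fun k : SO3 => (k : Matrix (Fin 3) (Fin 3) ℝ) i j :=
  (Continuous.matrix_elem (continuous_subtype_val (p := (· ∈ SO3))) i j).measurable

theorem measurable_row (i : Fin 3) :
    Measurable fun k : SO3 => (k : Matrix (Fin 3) (Fin 3) ℝ) i :=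
  measurable_pi_iff.2 fun j => measurable_entry i j

/-- The Gaussian law on pairs of vectors is rotation invariant, so the frame of a Gaussian pair is
Haar distributed up to signs. Averaging over both K and the Gaussian proves this, and
`lintegral_gaussW_mul` evaluates the Gaussian mean on the big cell. -/
theorem lintegral_haarK (F : (Fin 3 → ℝ) → (Fin 3 → ℝ) → ENNReal)
    (hF : Measurable (Function.uncurry F)) (hev : IsEven₂ F) :
    ∫⁻ k : SO3, F ((k : Matrix (Fin 3) (Fin 3) ℝ) 0) ((k : Matrix (Fin 3) (Fin 3) ℝ) 2) ∂haarK =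
      ∫⁻ u, ENNReal.ofReal (2 * Real.pi ^ 2 * (lenA u * lenB u) ^ 2)⁻¹ *
        F (unitV (crossU u)) (unitV (rowU u)) := by
  rw [← lintegral_gaussW_mul F hF hev]
  let Fh : (Fin 3 → ℝ) × (Fin 3 → ℝ) → ENNReal := fun z => F (unitV (z.1 ⨯₃ z.2)) (unitV z.2)
  have hFh : Measurable Fh := hF.comp ((measurable_unitV.comp measurable_cross).prodMk
    (measurable_unitV.comp measurable_snd))
  let act : (Fin 3 → ℝ) × (Fin 3 → ℝ) → SO3 → (Fin 3 → ℝ) × (Fin 3 → ℝ) := fun z k =>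
    (z.1 ᵥ* (k : Matrix (Fin 3) (Fin 3) ℝ), z.2 ᵥ* (k : Matrix (Fin 3) (Fin 3) ℝ))
  have hact : Measurable fun p : ((Fin 3 → ℝ) × (Fin 3 → ℝ)) × SO3 => act p.1 p.2 := by
    have hv : ∀ j, Measurable fun p : (Fin 3 → ℝ) × SO3 =>
        (p.1 ᵥ* (p.2 : Matrix (Fin 3) (Fin 3) ℝ)) j := fun j => by
      simp only [vecMul, dotProduct]
      refine Finset.measurable_sum _ fun i _ => ?_
      exact ((measurable_pi_apply i).comp measurable_fst).mul
        ((measurable_entry i j).comp measurable_snd)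
    have hv' : Measurable fun p : (Fin 3 → ℝ) × SO3 => p.1 ᵥ* (p.2 : Matrix (Fin 3) (Fin 3) ℝ) :=
      measurable_pi_iff.2 hv
    exact (hv'.comp (f := fun p : ((Fin 3 → ℝ) × (Fin 3 → ℝ)) × SO3 => (p.1.1, p.2))
      (by fun_prop)).prodMk (hv'.comp (f := fun p : ((Fin 3 → ℝ) × (Fin 3 → ℝ)) × SO3 =>
        (p.1.2, p.2)) (by fun_prop))
  -- Left translation by the frame κ of the pair z turns k into κk, which is the frame of the
  -- rotated pair.
  have h1 : ∀ z : (Fin 3 → ℝ) × (Fin 3 → ℝ), z.1 ⨯₃ z.2 ≠ 0 →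
      ∫⁻ k : SO3, F ((k : Matrix (Fin 3) (Fin 3) ℝ) 0) ((k : Matrix (Fin 3) (Fin 3) ℝ) 2) ∂haarK =
        ∫⁻ k, Fh (act z k) ∂haarK := by
    intro z hz
    obtain ⟨κ, hκ0, hκ2⟩ := exists_frame hz
    rw [← lintegral_mul_left_eq_self _ κ]
    refine lintegral_congr fun k => ?_
    simp only [Fh, act]
    rw [cross_vecMul k.2, unitV_vecMul k.2, unitV_vecMul k.2, ← hκ0, ← hκ2]
    rfl
  have h2 : ∀ k : SO3, ∫⁻ z, gaussW z * Fh (act z k) = ∫⁻ z, gaussW z * Fh z := by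
    intro k
    have hp : MeasurePreserving (fun z => act z k) := (measurePreserving_vecMul k.2).prod
      (measurePreserving_vecMul k.2)
    refine (lintegral_congr fun z => ?_).trans (hp.lintegral_comp (measurable_gaussW.mul hFh))
    simp only [gaussW, act, len_vecMul k.2]
  calc _ = (∫⁻ z, gaussW z) * ∫⁻ k : SO3, F ((k : Matrix (Fin 3) (Fin 3) ℝ) 0)
        ((k : Matrix (Fin 3) (Fin 3) ℝ) 2) ∂haarK := by rw [lintegral_gaussW, one_mul]
    _ = ∫⁻ z, ∫⁻ k, gaussW z * Fh (act z k) ∂haarK := by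
        rw [← lintegral_mul_const _ measurable_gaussW]
        refine lintegral_congr_ae ?_
        filter_upwards [ae_cross_ne_zero] with z hz
        rw [h1 z hz]
        exact (lintegral_const_mul _ (hFh.comp (hact.comp measurable_prodMk_left))).symm
    _ = ∫⁻ k, (∫⁻ z, gaussW z * Fh (act z k)) ∂haarK :=
        lintegral_lintegral_swap (Measurable.aemeasurable
          ((measurable_gaussW.comp measurable_fst).mul (hFh.comp hact)))
    _ = ∫⁻ z, gaussW z * Fh z := by
        simp only [h2, lintegral_const, measure_univ, mul_one]

/-- The hypothesis says that f and g have the same law, so nonnegative test functions suffice to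
compare complex integrals. -/
theorem map_eq_of_lintegral {X Y : Type*} [MeasurableSpace X] [MeasurableSpace Y] {μ : Measure X}
    {ν : Measure Y} {f : X → ℂ} {g : Y → ℂ} (hf : Measurable f) (hg : Measurable g)
    (h : ∀ θ : ℂ → ENNReal, Measurable θ → ∫⁻ x, θ (f x) ∂μ = ∫⁻ y, θ (g y) ∂ν) :
    (Integrable f μ ↔ Integrable g ν) ∧ ∫ x, f x ∂μ = ∫ y, g y ∂ν := by
  have hm : μ.map f = ν.map g := Measure.ext_of_lintegral _ fun θ hθ => by
    rw [lintegral_map hθ hf, lintegral_map hθ hg, h θ hθ]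
  have i1 := integrable_map_measure (μ := μ) (f := f) (g := id)
    measurable_id.aestronglyMeasurable hf.aemeasurable
  have i2 := integrable_map_measure (μ := ν) (f := g) (g := id)
    measurable_id.aestronglyMeasurable hg.aemeasurable
  have e1 := integral_map (μ := μ) hf.aemeasurable (f := id) measurable_id.aestronglyMeasurable
  have e2 := integral_map (μ := ν) hg.aemeasurable (f := id) measurable_id.aestronglyMeasurable
  rw [hm] at i1 e1
  exact ⟨i1.symm.trans i2, e1.symm.trans e2⟩

theorem integral_haarK (F : (Fin 3 → ℝ) → (Fin 3 → ℝ) → ℂ)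
    (hF : Measurable (Function.uncurry F)) (hev : IsEven₂ F) :
    ∫ k : SO3, F ((k : Matrix (Fin 3) (Fin 3) ℝ) 0) ((k : Matrix (Fin 3) (Fin 3) ℝ) 2) ∂haarK =
      ∫ u, (((2 * Real.pi ^ 2 * (lenA u * lenB u) ^ 2)⁻¹ : ℝ) : ℂ) *
        F (unitV (crossU u)) (unitV (rowU u)) := by
  let w : ℝ × ℝ × ℝ → NNReal := fun u => ((2 * Real.pi ^ 2 * (lenA u * lenB u) ^ 2)⁻¹).toNNReal
  have hw : Measurable w := by fun_prop
  have hFu : Measurable fun u => F (unitV (crossU u)) (unitV (rowU u)) :=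
    hF.comp ((measurable_unitV.comp measurable_crossU).prodMk
      (measurable_unitV.comp measurable_rowU))
  have h := map_eq_of_lintegral (μ := haarK)
    (ν := volume.withDensity fun u => (w u : ENNReal))
    (hF.comp ((measurable_row 0).prodMk (measurable_row 2))) hFu (fun θ hθ => by
      refine (lintegral_haarK (fun c r => θ (F c r)) (hθ.comp hF)
        ⟨fun c r => by simp only [hev.1], fun c r => by simp only [hev.2]⟩).trans ?_
      exact (lintegral_withDensity_eq_lintegral_mul _ hw.coe_nnreal_ennreal (hθ.comp hFu)).symm)
  refine h.2.trans ?_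
  rw [integral_withDensity_eq_integral_smul hw]
  refine integral_congr_ae (Filter.Eventually.of_forall fun u => ?_)
  have hA := lenA_pos u
  have hB := lenB_pos u
  have e : ((w u : ℝ)) = (2 * Real.pi ^ 2 * (lenA u * lenB u) ^ 2)⁻¹ :=
    Real.coe_toNNReal _ (by positivity)
  simp only [NNReal.smul_def, e, Complex.real_smul]

/-! ### Correlations on the unipotent group -/

/-- The group law of the unipotent group in coordinates. -/
def mulU (u x : ℝ × ℝ × ℝ) : ℝ × ℝ × ℝ :=
  (u.1 + x.1, u.2.1 + x.2.1, u.2.2 + x.2.2 + u.2.1 * x.1)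

@[fun_prop]
theorem continuous_mulU : Continuous fun p : (ℝ × ℝ × ℝ) × (ℝ × ℝ × ℝ) => mulU p.1 p.2 := by
  unfold mulU
  fun_prop

theorem psi_mulU (t : ℝ × ℝ) (u x : ℝ × ℝ × ℝ) : psi t (mulU u x) = psi t u * psi t x := by
  simp only [psi, mulU]
  rw [← Complex.exp_add]
  congr 1
  push_cast
  ring

theorem measurePreserving_mulU (u : ℝ × ℝ × ℝ) : MeasurePreserving (mulU u) := by
  have hm : Measurable (mulU u) := (continuous_mulU.comp (continuous_const.prodMk continuous_id)).measurable
  refine ⟨hm, Measure.ext_of_lintegral _ fun f hf => ?_⟩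
  have hm' : Measurable fun x => f (mulU u x) := hf.comp hm
  rw [lintegral_map hf hm, lintegral_triple _ hm', lintegral_triple _ hf]
  symm
  rw [← lintegral_add_left_eq_self _ u.1]
  refine lintegral_congr fun a => ?_
  rw [← lintegral_add_left_eq_self _ u.2.1]
  refine lintegral_congr fun b => ?_
  rw [← lintegral_add_left_eq_self _ (u.2.2 + u.2.1 * a)]
  refine lintegral_congr fun c => ?_
  simp only [mulU]
  congr 3
  ring

/-- The correlation `x ↦ ∫ \bar{f(u)} f(ux) du`. -/
def corr (f : ℝ × ℝ × ℝ → ℂ) (x : ℝ × ℝ × ℝ) : ℂ := ∫ u, conj (f u) * f (mulU u x)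

/-- The Fourier coefficient `∫ f \bar{ψ_t}`. -/
def coeffU (f : ℝ × ℝ × ℝ → ℂ) (t : ℝ × ℝ) : ℂ := ∫ u, f u * conj (psi t u)

theorem psi_mul_conj (t : ℝ × ℝ) (u : ℝ × ℝ × ℝ) : psi t u * conj (psi t u) = 1 := by
  rw [Complex.mul_conj, Complex.normSq_eq_norm_sq, norm_psi]
  simp

theorem integrable_mul_conj_psi {f : ℝ × ℝ × ℝ → ℂ} (hf : Integrable f) (t : ℝ × ℝ) :
    Integrable fun u => f u * conj (psi t u) :=
  hf.mul_bdd (c := 1) (Complex.continuous_conj.comp (continuous_psi_right t)).aestronglyMeasurable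
    (Filter.Eventually.of_forall fun u => by rw [Complex.norm_conj, norm_psi])

/-- The shear (u, x) ↦ (u, ux) preserves measure and reduces the integrand to a product. -/
theorem integrable_corr_prod {f : ℝ × ℝ × ℝ → ℂ} (hf : Integrable f) :
    Integrable (fun p : (ℝ × ℝ × ℝ) × (ℝ × ℝ × ℝ) => conj (f p.1) * f (mulU p.1 p.2))
      (volume.prod volume) := by
  have hs : MeasurePreserving (fun p : (ℝ × ℝ × ℝ) × (ℝ × ℝ × ℝ) => (p.1, mulU p.1 p.2))
      (volume.prod volume) (volume.prod volume) :=
    (MeasurePreserving.id volume).skew_product continuous_mulU.measurable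
      (Filter.Eventually.of_forall fun u => (measurePreserving_mulU u).map_eq)
  have hc : Integrable fun u => conj (f u) := by
    refine hf.norm.mono' (Complex.continuous_conj.comp_aestronglyMeasurable hf.1)
      (Filter.Eventually.of_forall fun u => by rw [Complex.norm_conj])
  exact hs.integrable_comp_of_integrable (hc.mul_prod hf)

theorem integrable_corr {f : ℝ × ℝ × ℝ → ℂ} (hf : Integrable f) : Integrable (corr f) :=
  (integrable_corr_prod hf).integral_prod_right

/-- As ψ_t is a character of U, substituting ux for x splits the double integral into conj(f̂(t))
and f̂(t). Only for integrable f is this legitimate. -/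
theorem integral_corr_mul {f : ℝ × ℝ × ℝ → ℂ} (hf : Integrable f) (t : ℝ × ℝ) :
    ∫ x, corr f x * conj (psi t x) = conj (coeffU f t) * coeffU f t := by
  have h1 : Integrable (fun p : (ℝ × ℝ × ℝ) × (ℝ × ℝ × ℝ) =>
      conj (f p.1) * f (mulU p.1 p.2) * conj (psi t p.2)) (volume.prod volume) :=
    (integrable_corr_prod hf).mul_bdd (c := 1) (Complex.continuous_conj.comp
      ((continuous_psi_right t).comp continuous_snd)).aestronglyMeasurable
      (Filter.Eventually.of_forall fun u => by rw [Complex.norm_conj, norm_psi])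
  have h2 : ∀ u, ∫ x, conj (f u) * f (mulU u x) * conj (psi t x) =
      conj (f u * conj (psi t u)) * coeffU f t := by
    intro u
    have he : MeasurableEmbedding (mulU u) := by
      refine (MeasurableEquiv.mk ⟨mulU u, fun y => (y.1 - u.1, y.2.1 - u.2.1,
        y.2.2 - u.2.2 - u.2.1 * (y.1 - u.1)), fun x => ?_, fun x => ?_⟩
        (measurePreserving_mulU u).measurable ?_).measurableEmbedding
      · ext <;> simp [mulU]
        ring
      · ext <;> simp [mulU]
        ring
      · change Measurable fun y : ℝ × ℝ × ℝ => (y.1 - u.1, y.2.1 - u.2.1,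
          y.2.2 - u.2.2 - u.2.1 * (y.1 - u.1))
        fun_prop
    have e : coeffU f t = ∫ x, f (mulU u x) * conj (psi t (mulU u x)) :=
      ((measurePreserving_mulU u).integral_comp he fun x => f x * conj (psi t x)).symm
    rw [e, ← integral_const_mul]
    refine integral_congr_ae (Filter.Eventually.of_forall fun x => ?_)
    have := psi_mul_conj t u
    simp only [psi_mulU, map_mul, Complex.conj_conj]
    linear_combination (-(conj (f u) * f (mulU u x) * conj (psi t x))) * this
  calc ∫ x, corr f x * conj (psi t x)
      = ∫ x, ∫ u, conj (f u) * f (mulU u x) * conj (psi t x) := by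
        simp only [corr, integral_mul_const]
    _ = ∫ u, ∫ x, conj (f u) * f (mulU u x) * conj (psi t x) :=
        (integral_integral_swap (f := fun u x => conj (f u) * f (mulU u x) * conj (psi t x)) h1).symm
    _ = _ := by
        simp only [h2]
        rw [integral_mul_const, integral_conj]
        rfl

/-! ### The cutoff as an average over frequencies. -/

section Cutoff

variable {α : ℝ → ℝ}

theorem integral_fourier_mul_exp (hαc : Continuous α) (hαi : Integrable α)
    (hF : Integrable (𝓕 fun x : ℝ => (α x : ℂ))) (y : ℝ) :
    ∫ s : ℝ, 𝓕 (fun x : ℝ => (α x : ℂ)) s * Complex.exp (2 * Real.pi * Complex.I * ((s * y : ℝ) : ℂ)) =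
      (α y : ℂ) := by
  have h := congrFun (Continuous.fourierInv_fourier_eq
    (f := fun x : ℝ => (α x : ℂ)) (by fun_prop) hαi.ofReal hF) y
  rw [Real.fourierInv_eq'] at h
  rw [← h]
  refine integral_congr_ae (Filter.Eventually.of_forall fun s => ?_)
  simp only [smul_eq_mul]
  rw [mul_comm]
  congr 2
  simp
  ring

/-- The weight `\hat α(s₁) \hat α(s₂)`. -/
def hatW (α : ℝ → ℝ) (s : ℝ × ℝ) : ℂ :=
  𝓕 (fun x : ℝ => (α x : ℂ)) s.1 * 𝓕 (fun x : ℝ => (α x : ℂ)) s.2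

theorem integral_hatW_mul_exp (hαc : Continuous α) (hαi : Integrable α)
    (hF : Integrable (𝓕 fun x : ℝ => (α x : ℂ))) (y z : ℝ) :
    ∫ s, hatW α s * Complex.exp (2 * Real.pi * Complex.I * ((s.1 * y + s.2 * z : ℝ) : ℂ)) =
      (α y : ℂ) * (α z : ℂ) := by
  rw [← integral_fourier_mul_exp hαc hαi hF y, ← integral_fourier_mul_exp hαc hαi hF z,
    ← integral_prod_mul, ← Measure.volume_eq_prod]
  refine integral_congr_ae (Filter.Eventually.of_forall fun s => ?_)
  simp only [hatW]
  rw [mul_mul_mul_comm, ← Complex.exp_add]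
  congr 2
  push_cast
  ring

/-- Fourier inversion writes the cutoff as a superposition of the characters e((s₁x₁ + s₂x₂)/R), and
each of them moves the frequency from t to t - s/R. -/
theorem integral_cutoff_corr (hαc : Continuous α) (hαi : Integrable α)
    (hF : Integrable (𝓕 fun x : ℝ => (α x : ℂ))) {f : ℝ × ℝ × ℝ → ℂ} (hf : Integrable f)
    (t : ℝ × ℝ) (R : ℝ) :
    ∫ x, (α (x.1 / R) : ℂ) * (α (x.2.1 / R) : ℂ) * corr f x * conj (psi t x) =
      ∫ s, hatW α s * (conj (coeffU f (t - R⁻¹ • s)) * coeffU f (t - R⁻¹ • s)) := by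
  have hW : Integrable (hatW α) := hF.mul_prod hF
  have hc : Continuous fun p : (ℝ × ℝ) × (ℝ × ℝ × ℝ) => conj (psi (t - R⁻¹ • p.1) p.2) :=
    Complex.continuous_conj.comp (continuous_psi.comp
      (f := fun p : (ℝ × ℝ) × (ℝ × ℝ × ℝ) => (t - R⁻¹ • p.1, p.2)) (by fun_prop))
  have hi : Integrable (fun p : (ℝ × ℝ) × (ℝ × ℝ × ℝ) =>
      hatW α p.1 * corr f p.2 * conj (psi (t - R⁻¹ • p.1) p.2)) (volume.prod volume) :=
    (hW.mul_prod (integrable_corr hf)).mul_bdd (c := 1) hc.aestronglyMeasurable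
      (Filter.Eventually.of_forall fun u => by rw [Complex.norm_conj, norm_psi])
  calc _ = ∫ x, ∫ s, hatW α s * corr f x * conj (psi (t - R⁻¹ • s) x) := by
        refine integral_congr_ae (Filter.Eventually.of_forall fun x => ?_)
        simp only
        rw [← integral_hatW_mul_exp hαc hαi hF, ← integral_mul_const, ← integral_mul_const]
        refine integral_congr_ae (Filter.Eventually.of_forall fun s => ?_)
        have e : conj (psi (t - R⁻¹ • s) x) = Complex.exp (2 * Real.pi * Complex.I *
            ((s.1 * (x.1 / R) + s.2 * (x.2.1 / R) : ℝ) : ℂ)) * conj (psi t x) := by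
          rw [conj_psi, conj_psi, ← Complex.exp_add, ← Complex.exp_add, ← Complex.exp_add]
          congr 1
          simp
          ring
        simp only [e]
        ring
    _ = ∫ s, ∫ x, hatW α s * corr f x * conj (psi (t - R⁻¹ • s) x) :=
        (integral_integral_swap hi).symm
    _ = _ := by
        refine integral_congr_ae (Filter.Eventually.of_forall fun s => ?_)
        simp only
        rw [← integral_corr_mul hf, ← integral_const_mul]
        simp only [mul_assoc]

/-! ### Domination at the tempered parameters -/

/-- The choice r = 1, s = 3/4 leaves the exponent 2r - s = 5/4 > 1 for the integral over c, and a
decay 3/4 > 1/2 in a and in b, which is enough for square integrability. -/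
theorem lintegral_last_lenA_lenB (a b : ℝ) :
    ∫⁻ c, ENNReal.ofReal ((lenA (a, b, c) * lenB (a, b, c)) ^ (-1 : ℝ)) ≤
      ENNReal.ofReal (2 ^ (3 / 4 : ℝ)) * (2 * ∫⁻ c, ENNReal.ofReal (jap c ^ (-(5 / 4) : ℝ))) *
        (ENNReal.ofReal (jap a ^ (-(3 / 4) : ℝ)) * ENNReal.ofReal (jap b ^ (-(3 / 4) : ℝ))) := by
  have ha := jap_pos a
  have hb := jap_pos b
  have hmj : Measurable fun c => ENNReal.ofReal (jap c ^ (-(5 / 4) : ℝ)) := by fun_prop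
  calc _ ≤ ∫⁻ c, ENNReal.ofReal (2 ^ (3 / 4 : ℝ)) * (ENNReal.ofReal (jap a ^ (-(3 / 4) : ℝ)) *
        ENNReal.ofReal (jap b ^ (-(3 / 4) : ℝ))) * (ENNReal.ofReal (jap c ^ (-(5 / 4) : ℝ)) +
          ENNReal.ofReal (jap (c - a * b) ^ (-(5 / 4) : ℝ))) := by
        refine lintegral_mono fun c => ?_
        have hc := jap_pos c
        have hc' := jap_pos (c - a * b)
        have := lenA_mul_lenB_rpow_le (a, b, c) (r := 1) (s := 3 / 4) (by norm_num) (by norm_num)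
        rw [← ENNReal.ofReal_mul (by positivity), ← ENNReal.ofReal_mul (by positivity),
          ← ENNReal.ofReal_add (by positivity) (by positivity),
          ← ENNReal.ofReal_mul (by positivity)]
        refine ENNReal.ofReal_le_ofReal (this.trans_eq ?_)
        norm_num
        ring
    _ = _ := by
        rw [lintegral_const_mul' _ _ (by finiteness), lintegral_add_left hmj,
          lintegral_sub_right_eq_self (fun c => ENNReal.ofReal (jap c ^ (-(5 / 4) : ℝ)))]
        ring

theorem lintegral_jap_lt_top {p : ℝ} (hp : 1 < p) :
    ∫⁻ c, ENNReal.ofReal (jap c ^ (-p)) < ⊤ := by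
  have h := (integrable_jap_rpow hp).2
  rwa [hasFiniteIntegral_iff_ofReal (Filter.Eventually.of_forall fun c => by
    have := jap_pos c; positivity)] at h

/-- A product is at most the sum of the squares, which makes the bound uniform in the translation x.
-/
theorem lintegral_jap_translate_le (x : ℝ) :
    ∫⁻ y, ENNReal.ofReal (jap y ^ (-(3 / 4) : ℝ)) * ENNReal.ofReal (jap (y + x) ^ (-(3 / 4) : ℝ)) ≤
      2 * ∫⁻ y, ENNReal.ofReal (jap y ^ (-(3 / 2) : ℝ)) := by
  have hm : Measurable fun c => ENNReal.ofReal (jap c ^ (-(3 / 2) : ℝ)) := by fun_prop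
  have e : ∀ y, jap y ^ (-(3 / 2) : ℝ) = (jap y ^ (-(3 / 4) : ℝ)) ^ 2 := fun y => by
    rw [sq, ← Real.rpow_add (jap_pos y)]
    norm_num
  calc _ ≤ ∫⁻ y, (ENNReal.ofReal (jap y ^ (-(3 / 2) : ℝ)) +
        ENNReal.ofReal (jap (y + x) ^ (-(3 / 2) : ℝ))) := by
        refine lintegral_mono fun y => ?_
        have h1 := jap_pos y
        have h2 := jap_pos (y + x)
        rw [← ENNReal.ofReal_mul (by positivity), ← ENNReal.ofReal_add (by positivity) (by positivity),
          e, e]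
        refine ENNReal.ofReal_le_ofReal ?_
        nlinarith [sq_nonneg (jap y ^ (-(3 / 4) : ℝ) - jap (y + x) ^ (-(3 / 4) : ℝ)),
          sq_nonneg (jap y ^ (-(3 / 4) : ℝ) + jap (y + x) ^ (-(3 / 4) : ℝ))]
    _ = _ := by
        rw [lintegral_add_left hm,
          lintegral_add_right_eq_self (fun c => ENNReal.ofReal (jap c ^ (-(3 / 2) : ℝ))), two_mul]

/-- `A⁻¹ B⁻¹` as an `ENNReal`-valued function. -/
def majU (u : ℝ × ℝ × ℝ) : ENNReal := ENNReal.ofReal ((lenA u * lenB u) ^ (-1 : ℝ))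

@[fun_prop]
theorem measurable_majU : Measurable majU := by
  have : Measurable fun u => (lenA u * lenB u) ^ (-1 : ℝ) :=
    (measurable_lenA.mul measurable_lenB).pow_const _
  exact this.ennreal_ofReal

/-- Integrating over x₃ and then u₃ replaces each factor (AB)⁻¹ by ⟨·⟩^{-3/4}⟨·⟩^{-3/4}. The
integral then factors into two copies of ∫∫ b(x) G(y) G(y + x) dx dy, which is finite because b is
integrable and G square integrable. Absolute convergence of the theorem's cutoff integral at
tempered μ rests on this. -/
theorem lintegral_majU_corr_lt_top {b : ℝ → ENNReal} (hb : Measurable b) (hb' : ∫⁻ x, b x < ⊤) :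
    ∫⁻ u, ∫⁻ x : ℝ × ℝ × ℝ, b x.1 * b x.2.1 * (majU u * majU (mulU u x)) < ⊤ := by
  let G : ℝ → ENNReal := fun x => ENNReal.ofReal (jap x ^ (-(3 / 4) : ℝ))
  have hG : Measurable G := by fun_prop
  let C : ENNReal := ENNReal.ofReal (2 ^ (3 / 4 : ℝ)) * (2 * ∫⁻ c, ENNReal.ofReal (jap c ^ (-(5 / 4) : ℝ)))
  have hC : C < ⊤ := by
    have := lintegral_jap_lt_top (p := 5 / 4) (by norm_num)
    finiteness
  have hF : ∀ a b : ℝ, ∫⁻ c, majU (a, b, c) ≤ C * (G a * G b) := lintegral_last_lenA_lenB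
  let N : ℝ → ENNReal := fun y => ∫⁻ x, b x * G (y + x)
  have hN : Measurable N :=
    Measurable.lintegral_prod_right' (f := fun p : ℝ × ℝ => b p.2 * G (p.1 + p.2)) (by fun_prop)
  have hmm : ∀ u, Measurable (mulU u) := fun u => (measurePreserving_mulU u).measurable
  -- For fixed u, x₁, x₂ the last coordinate of ux is a translate of x₃, so the x₃-integral is
  -- bounded by `hF`.
  have h1 : ∀ u : ℝ × ℝ × ℝ, ∫⁻ x : ℝ × ℝ × ℝ, b x.1 * b x.2.1 * (majU u * majU (mulU u x)) ≤
      C * (N u.1 * N u.2.1) * majU u := by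
    intro u
    rw [lintegral_triple _ (by have := hmm u; fun_prop)]
    calc _ ≤ ∫⁻ x₁, ∫⁻ x₂, (C * majU u * (b x₁ * G (u.1 + x₁))) * (b x₂ * G (u.2.1 + x₂)) := by
          refine lintegral_mono fun x₁ => lintegral_mono fun x₂ => ?_
          have e : ∀ c, majU (mulU u (x₁, x₂, c)) =
              majU (u.1 + x₁, u.2.1 + x₂, (u.2.2 + u.2.1 * x₁) + c) := fun c => by
            simp only [mulU]
            congr 3
            ring
          simp only [e]
          rw [lintegral_const_mul _ (by fun_prop), lintegral_const_mul _ (by fun_prop),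
            lintegral_add_left_eq_self (fun c => majU (u.1 + x₁, u.2.1 + x₂, c))]
          calc _ ≤ b x₁ * b x₂ * (majU u * (C * (G (u.1 + x₁) * G (u.2.1 + x₂)))) := by
                gcongr
                exact hF _ _
            _ = _ := by ring
      _ = _ := by
          have : ∀ x₁, ∫⁻ x₂, (C * majU u * (b x₁ * G (u.1 + x₁))) * (b x₂ * G (u.2.1 + x₂)) =
              C * majU u * (b x₁ * G (u.1 + x₁)) * N u.2.1 := fun x₁ =>
            lintegral_const_mul _ (by fun_prop)
          simp only [this]
          rw [lintegral_mul_const _ (by fun_prop), lintegral_const_mul _ (by fun_prop)]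
          simp only [N]
          ring
  have h2 : ∫⁻ y, G y * N y < ⊤ := by
    have e : ∀ y, G y * N y = ∫⁻ x, G y * (b x * G (y + x)) := fun y =>
      (lintegral_const_mul _ (by fun_prop)).symm
    simp only [e]
    rw [lintegral_lintegral_swap (by fun_prop)]
    have hD := lintegral_jap_lt_top (p := 3 / 2) (by norm_num)
    calc _ ≤ ∫⁻ x, b x * (2 * ∫⁻ y, ENNReal.ofReal (jap y ^ (-(3 / 2) : ℝ))) := by
          refine lintegral_mono fun x => ?_
          have e' : ∀ y, G y * (b x * G (y + x)) = b x * (G y * G (y + x)) := fun y => by ring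
          simp only [e']
          rw [lintegral_const_mul _ (by fun_prop)]
          gcongr
          exact lintegral_jap_translate_le x
      _ < ⊤ := by
          rw [lintegral_mul_const _ hb]
          finiteness
  calc _ ≤ ∫⁻ u : ℝ × ℝ × ℝ, C * (N u.1 * N u.2.1) * majU u := lintegral_mono h1
    _ ≤ ∫⁻ a, ∫⁻ b, (C * C * (G a * N a)) * (G b * N b) := by
        rw [lintegral_triple _ (by fun_prop)]
        refine lintegral_mono fun a => lintegral_mono fun b => ?_
        dsimp only
        rw [lintegral_const_mul _ (by fun_prop)]
        calc _ ≤ C * (N a * N b) * (C * (G a * G b)) := by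
              gcongr
              exact hF _ _
          _ = _ := by ring
    _ = C * C * (∫⁻ y, G y * N y) * ∫⁻ y, G y * N y := by
        have : ∀ a, ∫⁻ b, (C * C * (G a * N a)) * (G b * N b) =
            C * C * (G a * N a) * ∫⁻ y, G y * N y := fun a => lintegral_const_mul _ (by fun_prop)
        simp only [this]
        rw [lintegral_mul_const _ (by fun_prop), lintegral_const_mul _ (by fun_prop)]
    _ < ⊤ := by finiteness

/-- The dominating function for correlations against the cutoff. -/
def domU (α : ℝ → ℝ) (R : ℝ) (p : (ℝ × ℝ × ℝ) × (ℝ × ℝ × ℝ)) : ℝ :=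
  |α (p.2.1 / R)| * |α (p.2.2.1 / R)| *
    ((lenA p.1 * lenB p.1) ^ (-1 : ℝ) * (lenA (mulU p.1 p.2) * lenB (mulU p.1 p.2)) ^ (-1 : ℝ))

theorem integrable_domU (hαc : Continuous α) (hαi : Integrable α) {R : ℝ} (hR : 0 < R) :
    Integrable (domU α R) (volume.prod volume) := by
  have hm : Measurable (domU α R) := by
    have h1 : Measurable fun u => (lenA u * lenB u) ^ (-1 : ℝ) :=
      (measurable_lenA.mul measurable_lenB).pow_const _
    have h2 : Measurable fun p : (ℝ × ℝ × ℝ) × (ℝ × ℝ × ℝ) => mulU p.1 p.2 :=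
      continuous_mulU.measurable
    have h3 := hαc.measurable
    have h4 := h1.comp h2
    have h5 : Measurable fun p : (ℝ × ℝ × ℝ) × (ℝ × ℝ × ℝ) =>
        (lenA p.1 * lenB p.1) ^ (-1 : ℝ) := h1.comp measurable_fst
    exact Measurable.mul (by fun_prop) (h5.mul h4)
  refine ⟨hm.aestronglyMeasurable, ?_⟩
  have h0 : ∀ u : ℝ × ℝ × ℝ, 0 ≤ (lenA u * lenB u) ^ (-1 : ℝ) := fun u =>
    Real.rpow_nonneg (zero_le_one.trans (one_le_lenA_mul_lenB u)) _
  rw [hasFiniteIntegral_iff_ofReal (Filter.Eventually.of_forall fun p => by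
    have := h0 p.1; have := h0 (mulU p.1 p.2); unfold domU; positivity)]
  rw [lintegral_prod _ hm.ennreal_ofReal.aemeasurable]
  have hb := (hαi.comp_div hR.ne').abs.2
  rw [hasFiniteIntegral_iff_ofReal (Filter.Eventually.of_forall fun p => abs_nonneg _)] at hb
  have hαm : Measurable fun x => ENNReal.ofReal |α (x / R)| := by fun_prop
  refine (lintegral_mono fun u => lintegral_mono fun x => ?_).trans_lt
    (lintegral_majU_corr_lt_top hαm hb)
  simp only [domU, majU]
  have := h0 u
  have := h0 (mulU u x)
  rw [ENNReal.ofReal_mul (by positivity), ENNReal.ofReal_mul (by positivity),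
    ENNReal.ofReal_mul (by positivity)]

end Cutoff

/-! ### The cutoff integral of a correlation -/

section Limit

variable {α : ℝ → ℝ} {Q : ℝ × ℝ × ℝ → ℂ} {H : ℂ × ℂ → ℝ × ℝ → ℂ}

/-- The integrand of the cutoff integral, unfolded on `U × U`. -/
def cutG (α : ℝ → ℝ) (Q : ℝ × ℝ × ℝ → ℂ) (t : ℝ × ℝ) (R : ℝ) (z : ℂ × ℂ)
    (p : (ℝ × ℝ × ℝ) × (ℝ × ℝ × ℝ)) : ℂ :=
  (α (p.2.1 / R) : ℂ) * (α (p.2.2.1 / R) : ℂ) *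
    (conj (kern z p.1 * Q p.1) * (kern z (mulU p.1 p.2) * Q (mulU p.1 p.2))) * conj (psi t p.2)

theorem continuous_cutG (hαc : Continuous α) (hQ : Continuous Q) (t : ℝ × ℝ) (R : ℝ) :
    Continuous fun q : (ℂ × ℂ) × ((ℝ × ℝ × ℝ) × (ℝ × ℝ × ℝ)) => cutG α Q t R q.1 q.2 := by
  have h1 : Continuous fun q : (ℂ × ℂ) × ((ℝ × ℝ × ℝ) × (ℝ × ℝ × ℝ)) => kern q.1 q.2.1 :=
    continuous_kern.comp (f := fun q : (ℂ × ℂ) × ((ℝ × ℝ × ℝ) × (ℝ × ℝ × ℝ)) => (q.1, q.2.1))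
      (by fun_prop)
  have hm : Continuous fun q : (ℂ × ℂ) × ((ℝ × ℝ × ℝ) × (ℝ × ℝ × ℝ)) => mulU q.2.1 q.2.2 :=
    continuous_mulU.comp continuous_snd
  have h2 : Continuous fun q : (ℂ × ℂ) × ((ℝ × ℝ × ℝ) × (ℝ × ℝ × ℝ)) =>
      kern q.1 (mulU q.2.1 q.2.2) :=
    continuous_kern.comp (f := fun q : (ℂ × ℂ) × ((ℝ × ℝ × ℝ) × (ℝ × ℝ × ℝ)) =>
      (q.1, mulU q.2.1 q.2.2)) (continuous_fst.prodMk hm)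
  have h3 := hQ.comp hm
  have h4 := continuous_psi_right t
  unfold cutG
  exact (Continuous.mul (by fun_prop) (((Complex.continuous_conj.comp
    (h1.mul (by fun_prop))).mul (h2.mul h3)))).mul (Complex.continuous_conj.comp (by fun_prop))

/-- Because A, B ≥ 1, the bound valid at Re z = 0 persists for all larger real parts, so one
function dominates the whole approach to the imaginary axis. -/
theorem norm_cutG_le {C : ℝ} (hC : ∀ u, ‖Q u‖ ≤ C) (t : ℝ × ℝ) (R : ℝ) {z : ℂ × ℂ}
    (h1 : 0 ≤ z.1.re) (h2 : 0 ≤ z.2.re) (p : (ℝ × ℝ × ℝ) × (ℝ × ℝ × ℝ)) :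
    ‖cutG α Q t R z p‖ ≤ C ^ 2 * domU α R p := by
  have hb : ∀ u, ‖kern z u * Q u‖ ≤ (lenA u * lenB u) ^ (-1 : ℝ) * C := fun u => by
    rw [norm_mul]
    exact mul_le_mul (norm_kern_le (by linarith) (by linarith) u) (hC u) (norm_nonneg _)
      (Real.rpow_nonneg (zero_le_one.trans (one_le_lenA_mul_lenB u)) _)
  unfold cutG domU
  rw [norm_mul, norm_mul, norm_mul, norm_mul (conj _), Complex.norm_conj, Complex.norm_conj,
    norm_psi, mul_one, Complex.norm_real, Complex.norm_real, Real.norm_eq_abs, Real.norm_eq_abs]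
  refine (mul_le_mul_of_nonneg_left (mul_le_mul (hb p.1) (hb (mulU p.1 p.2)) (norm_nonneg _)
    ((norm_nonneg _).trans (hb _))) (by positivity)).trans_eq ?_
  ring

theorem integrable_cutG (hαc : Continuous α) (hαi : Integrable α) (hQ : IsSymbol Q) (t : ℝ × ℝ)
    {R : ℝ} (hR : 0 < R) {z : ℂ × ℂ} (h1 : 0 ≤ z.1.re) (h2 : 0 ≤ z.2.re) :
    Integrable (cutG α Q t R z) (volume.prod volume) := by
  obtain ⟨C, -, hC⟩ := hQ.bounded
  refine ((integrable_domU hαc hαi hR).const_mul (C ^ 2)).mono' ?_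
    (Filter.Eventually.of_forall (norm_cutG_le hC t R h1 h2))
  exact ((continuous_cutG hαc hQ.continuous t R).comp
    (continuous_const.prodMk continuous_id)).aestronglyMeasurable

theorem integral_cutG (t : ℝ × ℝ) (R : ℝ) (z : ℂ × ℂ) (x : ℝ × ℝ × ℝ) :
    ∫ u, cutG α Q t R z (u, x) =
      (α (x.1 / R) : ℂ) * (α (x.2.1 / R) : ℂ) * corr (fun u => kern z u * Q u) x *
        conj (psi t x) := by
  simp only [cutG, integral_mul_const, integral_const_mul, corr]

theorem integrable_cutoff_corr (hαc : Continuous α) (hαi : Integrable α) (hQ : IsSymbol Q)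
    (t : ℝ × ℝ) {R : ℝ} (hR : 0 < R) {z : ℂ × ℂ} (h1 : 0 ≤ z.1.re) (h2 : 0 ≤ z.2.re) :
    Integrable fun x : ℝ × ℝ × ℝ => (α (x.1 / R) : ℂ) * (α (x.2.1 / R) : ℂ) *
      corr (fun u => kern z u * Q u) x * conj (psi t x) := by
  simpa only [integral_cutG] using (integrable_cutG hαc hαi hQ t hR h1 h2).integral_prod_right

/-- The cutoff integral of a correlation. -/
def cutInt (α : ℝ → ℝ) (Q : ℝ × ℝ × ℝ → ℂ) (t : ℝ × ℝ) (R : ℝ) (z : ℂ × ℂ) : ℂ :=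
  ∫ x : ℝ × ℝ × ℝ, (α (x.1 / R) : ℂ) * (α (x.2.1 / R) : ℂ) *
      corr (fun u => kern z u * Q u) x * conj (psi t x)

theorem cutInt_eq (hαc : Continuous α) (hαi : Integrable α) (hQ : IsSymbol Q)
    (t : ℝ × ℝ) {R : ℝ} (hR : 0 < R) {z : ℂ × ℂ} (h1 : 0 ≤ z.1.re) (h2 : 0 ≤ z.2.re) :
    cutInt α Q t R z = ∫ p, cutG α Q t R z p ∂(volume.prod volume) := by
  rw [integral_prod_symm _ (integrable_cutG hαc hαi hQ t hR h1 h2), cutInt]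
  simp only [integral_cutG]

/-- A sequence of points with larger real parts, tending to `z`. -/
def shiftZ (z : ℂ × ℂ) (n : ℕ) : ℂ × ℂ :=
  z + (((1 / ((n : ℝ) + 1) : ℝ) : ℂ), ((1 / ((n : ℝ) + 1) : ℝ) : ℂ))

theorem lt_shiftZ_fst (z : ℂ × ℂ) (n : ℕ) : z.1.re < (shiftZ z n).1.re := by
  rw [shiftZ, Prod.fst_add, Complex.add_re, Complex.ofReal_re]
  exact lt_add_of_pos_right _ Nat.one_div_pos_of_nat

theorem lt_shiftZ_snd (z : ℂ × ℂ) (n : ℕ) : z.2.re < (shiftZ z n).2.re := by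
  rw [shiftZ, Prod.snd_add, Complex.add_re, Complex.ofReal_re]
  exact lt_add_of_pos_right _ Nat.one_div_pos_of_nat

theorem tendsto_shiftZ (z : ℂ × ℂ) : Filter.Tendsto (shiftZ z) Filter.atTop (𝓝 z) := by
  have h0 : Filter.Tendsto (fun n : ℕ => (((1 / ((n : ℝ) + 1) : ℝ) : ℂ))) Filter.atTop (𝓝 0) := by
    have := (Complex.continuous_ofReal.tendsto 0).comp (tendsto_one_div_add_atTop_nhds_zero_nat (𝕜 := ℝ))
    simpa only [Complex.ofReal_zero, Function.comp_def] using this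
  have := (tendsto_const_nhds (x := z)).add (h0.prodMk_nhds h0)
  rwa [Prod.mk_zero_zero, add_zero] at this

theorem tendsto_cutInt (hαc : Continuous α) (hαi : Integrable α) (hQ : IsSymbol Q)
    (t : ℝ × ℝ) {R : ℝ} (hR : 0 < R) {z : ℂ × ℂ} (h1 : 0 ≤ z.1.re) (h2 : 0 ≤ z.2.re) :
    Filter.Tendsto (fun n : ℕ => cutInt α Q t R (shiftZ z n)) Filter.atTop
      (𝓝 (cutInt α Q t R z)) := by
  have g1 : ∀ n : ℕ, 0 ≤ (shiftZ z n).1.re := fun n => h1.trans (lt_shiftZ_fst z n).le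
  have g2 : ∀ n : ℕ, 0 ≤ (shiftZ z n).2.re := fun n => h2.trans (lt_shiftZ_snd z n).le
  rw [cutInt_eq hαc hαi hQ t hR h1 h2]
  refine Filter.Tendsto.congr (fun n => (cutInt_eq hαc hαi hQ t hR (g1 n) (g2 n)).symm) ?_
  obtain ⟨C, -, hC⟩ := hQ.bounded
  have hb := (integrable_domU hαc hαi hR).const_mul (C ^ 2)
  have hn : ∀ n, ∀ᵐ p ∂(volume.prod volume), ‖cutG α Q t R (shiftZ z n) p‖ ≤ C ^ 2 * domU α R p :=
    fun n => Filter.Eventually.of_forall (norm_cutG_le hC t R (g1 n) (g2 n))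
  have hm : ∀ n, AEStronglyMeasurable (cutG α Q t R (shiftZ z n)) (volume.prod volume) :=
    fun n => (integrable_cutG hαc hαi hQ t hR (g1 n) (g2 n)).1
  have hl : ∀ p, Filter.Tendsto (fun n => cutG α Q t R (shiftZ z n) p) Filter.atTop
      (𝓝 (cutG α Q t R z p)) := fun p => by
    have h4 : Continuous fun z => cutG α Q t R z p :=
      Continuous.uncurry_right (f := fun z p => cutG α Q t R z p) p
        (continuous_cutG hαc hQ.continuous t R)
    exact (h4.tendsto z).comp (tendsto_shiftZ z)
  exact tendsto_integral_of_dominated_convergence _ hm hb hn (Filter.Eventually.of_forall hl)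

/-- The continuation of `oscInt`. -/
def contW (H : ℂ × ℂ → ℝ × ℝ → ℂ) (z : ℂ × ℂ) (t : ℝ × ℝ) : ℂ :=
  H z t / ((2 * Real.pi * Complex.I) ^ 2 * (t.1 * t.2))

/-- A continuous function that agrees with `|contW H z τ|²` where `(τ₁τ₂)² ≥ c`. -/
def normW (H : ℂ × ℂ → ℝ × ℝ → ℂ) (c : ℝ) (z : ℂ × ℂ) (τ : ℝ × ℝ) : ℂ :=
  conj (H z τ) * H z τ / (((2 * Real.pi) ^ 4 * max ((τ.1 * τ.2) ^ 2) c : ℝ) : ℂ)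

theorem normW_eq {c : ℝ} {τ : ℝ × ℝ} (h : c ≤ (τ.1 * τ.2) ^ 2) (z : ℂ × ℂ) :
    normW H c z τ = conj (contW H z τ) * contW H z τ := by
  rw [normW, max_eq_left h, contW, map_div₀, div_mul_div_comm]
  congr 1
  simp only [map_mul, map_pow, Complex.conj_ofReal, Complex.conj_I, map_ofNat]
  push_cast
  linear_combination (-(16 * (Real.pi : ℂ) ^ 4 * (τ.1 * τ.2) ^ 2 * (Complex.I ^ 2 - 1))) * Complex.I_sq

/-- The lower bound c in the denominator removes the singularity on the axes τ₁τ₂ = 0, so that the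
average over s makes sense for every ε. -/
theorem continuousOn_normW (hH : IsGood H) {c : ℝ} (hc : 0 < c) :
    ContinuousOn (fun p : (ℂ × ℂ) × (ℝ × ℝ) => normW H c p.1 p.2) (contDom ×ˢ Set.univ) := by
  unfold normW
  refine ((Complex.continuous_conj.comp_continuousOn hH.2).mul hH.2).div
    (Continuous.continuousOn (by fun_prop)) fun p _ => ?_
  have : 0 < max ((p.2.1 * p.2.2) ^ 2) c := lt_max_of_lt_right hc
  exact_mod_cast (by positivity : (2 * Real.pi) ^ 4 * max ((p.2.1 * p.2.2) ^ 2) c ≠ 0)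

/-- The cutoff integral on the Fourier side; `ε` stands for `1/R`. -/
def fourInt (α : ℝ → ℝ) (H : ℂ × ℂ → ℝ × ℝ → ℂ) (c : ℝ) (t : ℝ × ℝ) (ε : ℝ) (z : ℂ × ℂ) : ℂ :=
  ∫ s, hatW α s * normW H c z (t - ε • s)

theorem exists_hatW_support (hαk : HasCompactSupport (𝓕 fun x : ℝ => (α x : ℂ))) :
    ∃ k : Set (ℝ × ℝ), IsCompact k ∧ ∀ s, s ∉ k → hatW α s = 0 := by
  refine ⟨_, hαk.isCompact.prod hαk.isCompact, fun s hs => ?_⟩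
  rw [Set.mem_prod, not_and_or] at hs
  rcases hs with h | h
  · rw [hatW, image_eq_zero_of_notMem_tsupport h, zero_mul]
  · rw [hatW, image_eq_zero_of_notMem_tsupport h, mul_zero]

/-- Compact support of the weight makes the integral continuous in (ε, z) jointly, including ε = 0;
this is where the uniformity of the limit comes from. -/
theorem continuousOn_fourInt (hF : Continuous (𝓕 fun x : ℝ => (α x : ℂ)))
    (hαk : HasCompactSupport (𝓕 fun x : ℝ => (α x : ℂ))) (hH : IsGood H) {c : ℝ} (hc : 0 < c)
    (t : ℝ × ℝ) :
    ContinuousOn (fun p : ℝ × (ℂ × ℂ) => fourInt α H c t p.1 p.2) (Set.univ ×ˢ contDom) := by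
  obtain ⟨k, hk, hs⟩ := exists_hatW_support hαk
  refine continuousOn_integral_of_compact_support hk ?_ fun p s _ hsk => by rw [hs s hsk, zero_mul]
  have h1 : Continuous (hatW α) := by unfold hatW; fun_prop
  refine (h1.comp continuous_snd).continuousOn.mul ((continuousOn_normW hH hc).comp
    (f := fun q : (ℝ × (ℂ × ℂ)) × (ℝ × ℝ) => (q.1.2, t - q.1.1 • q.2))
    (Continuous.continuousOn (by fun_prop)) fun q hq => ⟨hq.1.2, trivial⟩)

theorem tendsto_fourInt (hF : Continuous (𝓕 fun x : ℝ => (α x : ℂ)))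
    (hαk : HasCompactSupport (𝓕 fun x : ℝ => (α x : ℂ))) (hH : IsGood H) {c : ℝ} (hc : 0 < c)
    (t : ℝ × ℝ) (ε : ℝ) {z : ℂ × ℂ} (hz : z ∈ contDom) {y : ℕ → ℂ × ℂ}
    (hy : Filter.Tendsto y Filter.atTop (𝓝 z)) :
    Filter.Tendsto (fun n => fourInt α H c t ε (y n)) Filter.atTop (𝓝 (fourInt α H c t ε z)) := by
  have h4 : ContinuousOn (fourInt α H c t ε) contDom :=
    (continuousOn_fourInt hF hαk hH hc t).uncurry_left ε (Set.mem_univ ε)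
  exact (h4.continuousAt (isOpen_contDom.mem_nhds hz)).tendsto.comp hy

/-- The total mass of the weight is α(0)² = 1, by Fourier inversion at the origin. -/
theorem fourInt_zero (hα0 : α 0 = 1) (hαc : Continuous α) (hαi : Integrable α)
    (hF : Integrable (𝓕 fun x : ℝ => (α x : ℂ))) (c : ℝ) (t : ℝ × ℝ) (z : ℂ × ℂ) :
    fourInt α H c t 0 z = normW H c z t := by
  have h := integral_hatW_mul_exp hαc hαi hF 0 0
  simp only [mul_zero, add_zero, Complex.ofReal_zero, Complex.exp_zero, mul_one, hα0,
    Complex.ofReal_one] at h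
  simp only [fourInt, zero_smul, sub_zero, integral_mul_const, h, one_mul]

/-- For Re z > 0 this is `integral_cutoff_corr`, once R is so large that no frequency t - s/R with s
in the support comes near the axes; the required size of R does not depend on z. The boundary Re z =
0 is reached by continuity of both sides. -/
theorem eventually_cutInt_eq (hαc : Continuous α) (hαi : Integrable α)
    (hFc : Continuous (𝓕 fun x : ℝ => (α x : ℂ)))
    (hαk : HasCompactSupport (𝓕 fun x : ℝ => (α x : ℂ))) (hQ : IsSymbol Q) (hH : IsGood H)
    (hHQ : ∀ z t, 0 < z.1.re → 0 < z.2.re →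
      (2 * Real.pi * Complex.I) ^ 2 * (t.1 * t.2) * oscInt Q z t = H z t)
    {t : ℝ × ℝ} (ht : t.1 * t.2 ≠ 0) :
    ∀ᶠ R : ℝ in Filter.atTop, ∀ z : ℂ × ℂ, 0 ≤ z.1.re → 0 ≤ z.2.re →
      cutInt α Q t R z = fourInt α H ((t.1 * t.2) ^ 2 / 2) t R⁻¹ z := by
  have hF : Integrable (𝓕 fun x : ℝ => (α x : ℂ)) := hFc.integrable_of_hasCompactSupport hαk
  have hc : 0 < (t.1 * t.2) ^ 2 / 2 := by positivity
  obtain ⟨k, hk, hs⟩ := exists_hatW_support hαk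
  -- The value at ε = 0 is (t₁t₂)², twice the threshold, and compactness of k gives one
  -- neighbourhood of 0 for all s.
  have h1 : ∀ᶠ ε : ℝ in 𝓝 0, ∀ s ∈ k,
      (t.1 * t.2) ^ 2 / 2 < ((t - ε • s).1 * (t - ε • s).2) ^ 2 := by
    refine hk.eventually_forall_of_forall_eventually fun s _ => ?_
    have hcc : Continuous fun p : ℝ × (ℝ × ℝ) => ((t - p.1 • p.2).1 * (t - p.1 • p.2).2) ^ 2 := by
      fun_prop
    refine hcc.continuousAt.eventually_const_lt ?_
    simp only [zero_smul, sub_zero]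
    linarith
  filter_upwards [tendsto_inv_atTop_zero.eventually h1, Filter.eventually_gt_atTop 0]
    with R hR hR0
  have key : ∀ z : ℂ × ℂ, 0 < z.1.re → 0 < z.2.re →
      cutInt α Q t R z = fourInt α H ((t.1 * t.2) ^ 2 / 2) t R⁻¹ z := by
    intro z z1 z2
    obtain ⟨C, -, hC⟩ := hQ.bounded
    have hfi : Integrable fun u => kern z u * Q u :=
      (integrable_kern z1 z2).mul_bdd (c := C) hQ.continuous.aestronglyMeasurable
        (Filter.Eventually.of_forall hC)
    rw [cutInt, integral_cutoff_corr hαc hαi hF hfi, fourInt]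
    refine integral_congr_ae (Filter.Eventually.of_forall fun s => ?_)
    by_cases hsk : s ∈ k
    · have h2 := hR s hsk
      dsimp only
      rw [normW_eq h2.le]
      have e : coeffU (fun u => kern z u * Q u) (t - R⁻¹ • s) = contW H z (t - R⁻¹ • s) := by
        have h3 : (t - R⁻¹ • s).1 * (t - R⁻¹ • s).2 ≠ 0 := by
          intro h0
          rw [h0] at h2
          linarith
        have h3' : (((t - R⁻¹ • s).1 : ℂ) * ((t - R⁻¹ • s).2 : ℂ)) ≠ 0 := by exact_mod_cast h3
        rw [contW, ← hHQ z _ z1 z2, mul_div_cancel_left₀]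
        · rfl
        · exact mul_ne_zero (pow_ne_zero _ Complex.two_pi_I_ne_zero) h3'
      rw [e]
    · simp only [hs s hsk, zero_mul]
  intro z z1 z2
  -- Both sides are evaluated at z + 1/(n+1), where the identity is known, and compared in the
  -- limit.
  refine tendsto_nhds_unique (tendsto_cutInt hαc hαi hQ t hR0 z1 z2) ?_
  refine Filter.Tendsto.congr (fun n => (key _ (z1.trans_lt (lt_shiftZ_fst z n))
    (z2.trans_lt (lt_shiftZ_snd z n))).symm) ?_
  have hz : z ∈ contDom := ⟨by linarith, by linarith⟩
  exact tendsto_fourInt hFc hαk hH hc t R⁻¹ hz (tendsto_shiftZ z)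

theorem tendstoUniformlyOn_cutInt (hα0 : α 0 = 1) (hαc : Continuous α) (hαi : Integrable α)
    (hFc : Continuous (𝓕 fun x : ℝ => (α x : ℂ)))
    (hαk : HasCompactSupport (𝓕 fun x : ℝ => (α x : ℂ))) (hQ : IsSymbol Q) (hH : IsGood H)
    (hHQ : ∀ z t, 0 < z.1.re → 0 < z.2.re →
      (2 * Real.pi * Complex.I) ^ 2 * (t.1 * t.2) * oscInt Q z t = H z t)
    {t : ℝ × ℝ} (ht : t.1 * t.2 ≠ 0) {k : Set (ℂ × ℂ)} (hk : IsCompact k)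
    (hk0 : ∀ z ∈ k, 0 ≤ z.1.re ∧ 0 ≤ z.2.re) :
    TendstoUniformlyOn (cutInt α Q t) (fun z => conj (contW H z t) * contW H z t)
      Filter.atTop k := by
  have hF : Integrable (𝓕 fun x : ℝ => (α x : ℂ)) := hFc.integrable_of_hasCompactSupport hαk
  have hc : 0 < (t.1 * t.2) ^ 2 / 2 := by positivity
  intro V hV
  have hsub : k ⊆ contDom := fun z hz => ⟨by linarith [(hk0 z hz).1], by linarith [(hk0 z hz).2]⟩
  -- Joint continuity on a product with a compact factor gives convergence as ε → 0 uniformly in z.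
  obtain ⟨v, hv, hv'⟩ := hk.mem_uniformity_of_prod
    (f := fun ε z => fourInt α H ((t.1 * t.2) ^ 2 / 2) t ε z) (s := Set.univ) (q := 0)
    ((continuousOn_fourInt hFc hαk hH hc t).mono (Set.prod_mono subset_rfl hsub)) trivial
    (symm_le_uniformity hV)
  rw [nhdsWithin_univ] at hv
  filter_upwards [tendsto_inv_atTop_zero.eventually hv,
    eventually_cutInt_eq hαc hαi hFc hαk hQ hH hHQ ht] with R hR hR' z hz
  have h := hv' _ hR z hz
  rw [hR' z (hk0 z hz).1 (hk0 z hz).2]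
  rwa [fourInt_zero hα0 hαc hαi hF, normW_eq (by linarith)] at h

end Limit

/-! ### The power function and the spherical function -/

/-- The coordinates `(μ₂ - μ₃, μ₁ - μ₂)`. -/
def zOf (μ : specA) : ℂ × ℂ :=
  ((μ : Fin 3 → ℂ) 1 - (μ : Fin 3 → ℂ) 2, (μ : Fin 3 → ℂ) 0 - (μ : Fin 3 → ℂ) 1)

/-- `a^{-1-z₁} b^{-1-z₂}`. -/
def powAB (z : ℂ × ℂ) (a b : ℝ) : ℂ :=
  Complex.exp (-(1 + z.1) * (Real.log a : ℂ) - (1 + z.2) * (Real.log b : ℂ))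

/-- With a and b the two lengths, y₁ = b/a² and y₂ = a/b². Collecting exponents and using μ₁ + μ₂ +
μ₃ = 0 leaves the simple-root differences in `zOf`. -/
theorem pPow_of_det_eq_one (μ : specA) {g : Matrix (Fin 3) (Fin 3) ℝ} (hg : g.det = 1) :
    pPow μ g = powAB (zOf μ) (len (g 2)) (len (g 1 ⨯₃ g 2)) := by
  have h2 : g 2 ≠ 0 := fun h => by
    rw [Matrix.det_eq_zero_of_row_eq_zero 2 fun j => congrFun h j] at hg
    exact zero_ne_one hg
  have hc : g 1 ⨯₃ g 2 ≠ 0 := fun h => by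
    have e : g.det = g 0 0 * (g 1 ⨯₃ g 2) 0 + g 0 1 * (g 1 ⨯₃ g 2) 1 +
        g 0 2 * (g 1 ⨯₃ g 2) 2 := by
      rw [Matrix.det_fin_three]
      simp [cross_apply]
      ring
    rw [h, hg] at e
    simp at e
  have p := len_pos h2
  have q := len_pos hc
  have hμ : (μ : Fin 3 → ℂ) 0 + (μ : Fin 3 → ℂ) 1 + (μ : Fin 3 → ℂ) 2 = 0 := μ.2
  have l1 : Real.log (iwaY₁ g) = Real.log (len (g 1 ⨯₃ g 2)) - 2 * Real.log (len (g 2)) := by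
    rw [iwaY₁, Real.log_div q.ne' (by positivity), Real.log_pow]
    push_cast
    rfl
  have l2 : Real.log (iwaY₂ g) = Real.log (len (g 2)) - 2 * Real.log (len (g 1 ⨯₃ g 2)) := by
    rw [iwaY₂, hg, abs_one, one_mul, Real.log_div p.ne' (by positivity), Real.log_pow]
    push_cast
    rfl
  have p1 : 0 < iwaY₁ g := by
    rw [iwaY₁]
    positivity
  have p2 : 0 < iwaY₂ g := by
    rw [iwaY₂, hg]
    positivity
  rw [pPow, powAB, Complex.cpow_def_of_ne_zero (by exact_mod_cast p1.ne'),
    Complex.cpow_def_of_ne_zero (by exact_mod_cast p2.ne'), ← Complex.exp_add,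
    ← Complex.ofReal_log p1.le, ← Complex.ofReal_log p2.le, l1, l2]
  congr 1
  simp only [zOf]
  push_cast
  linear_combination ((Real.log (len (g 2)) : ℂ) - (Real.log (len (g 1 ⨯₃ g 2)) : ℂ)) * hμ

theorem kern_eq_powAB (z : ℂ × ℂ) (u : ℝ × ℝ × ℝ) :
    kern z u = powAB z (len (rowU u)) (len (crossU u)) := by
  rw [len_rowU, len_crossU]
  rfl

/-- For imaginary z the conjugate of a^{-1-z} is a^{-1+z} = a^{-2}·a^{1+z}, so the density
a^{-2}b^{-2} of Haar measure converts division by a and b into a conjugate factor. Temperedness of μ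
is essential here. -/
theorem powAB_div (z : ℂ × ℂ) {a a' b b' : ℝ} (ha : 0 < a) (ha' : 0 < a') (hb : 0 < b)
    (hb' : 0 < b') (h1 : z.1.re = 0) (h2 : z.2.re = 0) :
    (((2 * Real.pi ^ 2 * (a * b) ^ 2)⁻¹ : ℝ) : ℂ) * powAB z (a⁻¹ * a') (b⁻¹ * b') =
      1 / (2 * (Real.pi : ℂ) ^ 2) * (conj (powAB z a b) * powAB z a' b') := by
  have c1 : conj z.1 = -z.1 := by
    apply Complex.ext <;> simp [h1]
  have c2 : conj z.2 = -z.2 := by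
    apply Complex.ext <;> simp [h2]
  have e : (((a * b) ^ 2)⁻¹ : ℂ) =
      Complex.exp (-2 * (Real.log a : ℂ) - 2 * (Real.log b : ℂ)) := by
    rw [← Complex.ofReal_mul, ← Complex.ofReal_pow, ← Complex.ofReal_inv,
      ← Real.exp_log (by positivity : 0 < ((a * b) ^ 2)⁻¹), Real.log_inv, Real.log_pow,
      Real.log_mul ha.ne' hb.ne', Complex.ofReal_exp]
    congr 1
    push_cast
    ring
  have l1 : Real.log (a⁻¹ * a') = Real.log a' - Real.log a := by
    rw [Real.log_mul (by positivity) ha'.ne', Real.log_inv]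
    ring
  have l2 : Real.log (b⁻¹ * b') = Real.log b' - Real.log b := by
    rw [Real.log_mul (by positivity) hb'.ne', Real.log_inv]
    ring
  have e2 : (((2 * Real.pi ^ 2 * (a * b) ^ 2)⁻¹ : ℝ) : ℂ) =
      1 / (2 * (Real.pi : ℂ) ^ 2) * (((a * b) ^ 2)⁻¹ : ℂ) := by
    push_cast
    rw [mul_inv, one_div]
  rw [e2, mul_assoc, e]
  congr 1
  simp only [powAB, l1, l2]
  rw [← Complex.exp_conj, ← Complex.exp_add, ← Complex.exp_add]
  congr 1
  simp only [map_sub, map_mul, map_neg, map_add, map_one, Complex.conj_ofReal, c1, c2]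
  push_cast
  ring

/-- Coordinates of the inverse in the unipotent group. -/
def invU (x : ℝ × ℝ × ℝ) : ℝ × ℝ × ℝ := (-x.1, -x.2.1, x.1 * x.2.1 - x.2.2)

theorem cross_vecMul_unip (p q : Fin 3 → ℝ) (x : ℝ × ℝ × ℝ) :
    (p ᵥ* unip x) ⨯₃ (q ᵥ* unip x) = unip (invU x) *ᵥ (p ⨯₃ q) := by
  ext i
  fin_cases i <;>
    simp [cross_apply, Matrix.vecMul_eq_sum, Matrix.mulVec_eq_sum, Fin.sum_univ_three, unip,
      invU] <;>
    ring

theorem rowU_mulU (u x : ℝ × ℝ × ℝ) : rowU (mulU u x) = rowU u ᵥ* unip x := by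
  ext i
  fin_cases i <;> simp [Matrix.vecMul, dotProduct, Fin.sum_univ_three, unip, mulU, rowU] <;> ring

theorem crossU_mulU (u x : ℝ × ℝ × ℝ) : crossU (mulU u x) = unip (invU x) *ᵥ crossU u := by
  ext i
  fin_cases i <;>
    simp [Matrix.mulVec, dotProduct, Fin.sum_univ_three, unip, mulU, crossU, invU]
  ring

theorem det_unip (x : ℝ × ℝ × ℝ) : (unip x).det = 1 := by
  rw [Matrix.det_fin_three]
  simp [unip]

theorem unitV_pos_smul {c : ℝ} (hc : 0 < c) (v : Fin 3 → ℝ) : unitV (c • v) = unitV v := by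
  rw [unitV, unitV, len_smul, abs_of_pos hc, smul_smul]
  congr 1
  field_simp

theorem unitV_neg (v : Fin 3 → ℝ) : unitV (-v) = -unitV v := by
  rw [unitV, unitV, ← neg_one_smul ℝ v, len_smul]
  simp

/-- On the big cell k has the first and last rows of the frame of u, and right multiplication by x
sends these to the data of ux rescaled by the lengths for u. `powAB_div` absorbs the rescaling, and
a correlation on U appears. -/
theorem integral_haarK_powAB (z : ℂ × ℂ) (h1 : z.1.re = 0) (h2 : z.2.re = 0)
    (τ : (Fin 3 → ℝ) → (Fin 3 → ℝ) → ℂ) (hτ : Measurable (Function.uncurry τ))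
    (hev : ∀ r s, τ (-r) (-s) = τ r s) (x : ℝ × ℝ × ℝ) :
    ∫ k : SO3, powAB z (len ((k : Matrix (Fin 3) (Fin 3) ℝ) 2 ᵥ* unip x))
      (len (unip (invU x) *ᵥ (k : Matrix (Fin 3) (Fin 3) ℝ) 0)) *
        τ ((k : Matrix (Fin 3) (Fin 3) ℝ) 2) (unitV ((k : Matrix (Fin 3) (Fin 3) ℝ) 2 ᵥ* unip x))
        ∂haarK =
      1 / (2 * (Real.pi : ℂ) ^ 2) * ∫ u, conj (kern z u) * kern z (mulU u x) *
        τ (unitV (rowU u)) (unitV (rowU (mulU u x))) := by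
  let F : (Fin 3 → ℝ) → (Fin 3 → ℝ) → ℂ := fun c r =>
    powAB z (len (r ᵥ* unip x)) (len (unip (invU x) *ᵥ c)) * τ r (unitV (r ᵥ* unip x))
  have hv : Measurable fun r : Fin 3 → ℝ => r ᵥ* unip x :=
    (unip x).vecMulLinear.continuous_of_finiteDimensional.measurable
  have hw : Measurable fun c : Fin 3 → ℝ => unip (invU x) *ᵥ c :=
    (unip (invU x)).mulVecLin.continuous_of_finiteDimensional.measurable
  have hl := continuous_len.measurable
  have hF : Measurable (Function.uncurry F) := by
    have m1 : Measurable fun p : (Fin 3 → ℝ) × (Fin 3 → ℝ) => Real.log (len (p.2 ᵥ* unip x)) :=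
      (hl.comp (hv.comp measurable_snd)).log
    have m2 : Measurable fun p : (Fin 3 → ℝ) × (Fin 3 → ℝ) =>
        Real.log (len (unip (invU x) *ᵥ p.1)) := (hl.comp (hw.comp measurable_fst)).log
    have m3 : Measurable fun p : (Fin 3 → ℝ) × (Fin 3 → ℝ) => τ p.2 (unitV (p.2 ᵥ* unip x)) :=
      hτ.comp (measurable_snd.prodMk (measurable_unitV.comp (hv.comp measurable_snd)))
    exact Measurable.mul (by unfold powAB; fun_prop) m3
  have hE : IsEven₂ F := by
    have l : ∀ v : Fin 3 → ℝ, len (-v) = len v := fun v => by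
      rw [← neg_one_smul ℝ v, len_smul]
      simp
    constructor
    · intro c r
      simp only [F, Matrix.mulVec_neg, l]
    · intro c r
      simp only [F, Matrix.neg_vecMul, l, unitV_neg, hev]
  refine (integral_haarK F hF hE).trans ?_
  rw [← integral_const_mul]
  refine integral_congr_ae (Filter.Eventually.of_forall fun u => ?_)
  simp only [F]
  have hA := lenA_pos u
  have hB := lenB_pos u
  have er : unitV (rowU u) ᵥ* unip x = (lenA u)⁻¹ • rowU (mulU u x) := by
    rw [unitV, Matrix.smul_vecMul, ← rowU_mulU, len_rowU]
  have ec : unip (invU x) *ᵥ unitV (crossU u) = (lenB u)⁻¹ • crossU (mulU u x) := by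
    rw [unitV, Matrix.mulVec_smul, ← crossU_mulU, len_crossU]
  rw [er, ec, unitV_pos_smul (by positivity), len_smul, len_smul, len_rowU, len_crossU,
    abs_of_pos (by positivity), abs_of_pos (by positivity), ← mul_assoc,
    powAB_div z hA (lenA_pos _) hB (lenB_pos _) h1 h2, mul_assoc]
  rfl

/-- The rows of `w_l u` that enter its Iwasawa decomposition. -/
theorem wLong_mul_unip (u : ℝ × ℝ × ℝ) :
    (wLong * unip u) 2 = -rowU u ∧ (wLong * unip u) 1 ⨯₃ (wLong * unip u) 2 = crossU u ∧
      (wLong * unip u).det = 1 := by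
  have e : wLong * unip u = !![0, 0, -1; 0, -1, -u.1; -1, -u.2.1, -u.2.2] := by
    ext i j
    fin_cases i <;> fin_cases j <;> simp [wLong, unip, Matrix.mul_apply, Fin.sum_univ_three]
  rw [e]
  refine ⟨?_, ?_, ?_⟩
  · ext j
    fin_cases j <;> simp [rowU]
  · ext j
    fin_cases j <;> simp [crossU, cross_apply]
  · rw [Matrix.det_fin_three]
    simp

theorem pPow_wLong (μ : specA) (u : ℝ × ℝ × ℝ) : pPow μ (wLong * unip u) = kern (zOf μ) u := by
  obtain ⟨h1, h2, h3⟩ := wLong_mul_unip u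
  rw [pPow_of_det_eq_one μ h3, kern_eq_powAB, h2, h1, ← neg_one_smul ℝ (rowU u), len_smul]
  simp

theorem iwaK_wLong_row_two (u : ℝ × ℝ × ℝ) : iwaK (wLong * unip u) 2 = -unitV (rowU u) := by
  obtain ⟨h1, h2, h3⟩ := wLong_mul_unip u
  have e : iwaK (wLong * unip u) 2 =
      ((SignType.sign (wLong * unip u).det : ℝ) * (len ((wLong * unip u) 2))⁻¹) •
        (wLong * unip u) 2 := rfl
  rw [e, h3, h1, ← unitV_neg, unitV]
  simp

/-- The first row is the unit vector along `crossU`, the last is minus the unit vector along `rowU`,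
and the middle one is their cross product. -/
theorem isSymbol_iwaK (a b : Fin 3) :
    IsSymbol fun u => ((iwaK (wLong * unip u) a b : ℝ) : ℂ) := by
  have hr : ∀ j, IsSymbol fun u => ((unitV (rowU u) j : ℝ) : ℂ) := fun j => by
    have := IsSymbol.row j
    simpa only [unitV, len_rowU, Pi.smul_apply, smul_eq_mul, div_eq_inv_mul] using this
  have hc : ∀ j, IsSymbol fun u => ((unitV (crossU u) j : ℝ) : ℂ) := fun j => by
    have := IsSymbol.cross j
    simpa only [unitV, len_crossU, Pi.smul_apply, smul_eq_mul, div_eq_inv_mul] using this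
  have e0 : ∀ u, iwaK (wLong * unip u) 0 = unitV (crossU u) := fun u => by
    have e : iwaK (wLong * unip u) 0 = unitV ((wLong * unip u) 1 ⨯₃ (wLong * unip u) 2) := rfl
    rw [e, (wLong_mul_unip u).2.1]
  have e1 : ∀ u, iwaK (wLong * unip u) 1 = iwaK (wLong * unip u) 2 ⨯₃ iwaK (wLong * unip u) 0 :=
    fun u => rfl
  have hx : ∀ i j k l, IsSymbol fun u =>
      (((-unitV (rowU u)) i * unitV (crossU u) j - (-unitV (rowU u)) k * unitV (crossU u) l : ℝ) : ℂ) := by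
    intro i j k l
    have := (((hr i).mul (hc j)).const_mul (-1)).add ((hr k).mul (hc l))
    convert this using 2 with u
    simp only [Pi.neg_apply]
    push_cast
    ring
  fin_cases a
  · simpa only [Fin.zero_eta, e0] using hc b
  · simp only [Fin.mk_one, e1, e0, iwaK_wLong_row_two, cross_apply]
    fin_cases b
    · exact hx 1 2 2 1
    · exact hx 2 0 0 2
    · exact hx 0 1 1 0
  · have := (hr b).const_mul (-1)
    convert this using 2 with u
    change ((iwaK (wLong * unip u) 2 b : ℝ) : ℂ) = _
    rw [iwaK_wLong_row_two, Pi.neg_apply]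
    push_cast
    ring

/-! ### The Jacquet-Whittaker function -/

/-- `zOf` as a continuous linear map. -/
def zCLM : specA →L[ℂ] ℂ × ℂ :=
  let p : Fin 3 → ((Fin 3 → ℂ) →L[ℂ] ℂ) := fun i =>
    ContinuousLinearMap.proj (R := ℂ) (φ := fun _ : Fin 3 => ℂ) i
  ((p 1 - p 2).prod (p 0 - p 1)).comp specA.subtypeL

theorem continuous_zOf : Continuous zOf := zCLM.continuous

theorem re_zOf {μ : specA} (hμ : μ ∈ specA₀) : (zOf μ).1.re = 0 ∧ (zOf μ).2.re = 0 := by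
  simp only [zOf, Complex.sub_re, hμ _, sub_zero, and_self]

/-- This makes the limiting trace a sum of squared absolute values. -/
theorem negConj_of_mem {μ : specA} (hμ : μ ∈ specA₀) : negConj μ = μ := by
  apply Subtype.ext
  funext i
  change -conj ((μ : Fin 3 → ℂ) i) = (μ : Fin 3 → ℂ) i
  apply Complex.ext <;> simp [hμ i]

theorem convex_contDom : Convex ℝ contDom := by
  intro z hz w hw a b ha hb hab
  have key : ∀ x y : ℝ, -(1 / 8) < x → -(1 / 8) < y → -(1 / 8) < a * x + b * y := fun x y hx hy => by
    rcases ha.eq_or_lt with rfl | ha'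
    · rw [zero_add] at hab
      rw [hab]
      linarith
    · nlinarith
  constructor
  · simpa using key _ _ hz.1 hw.1
  · simpa using key _ _ hz.2 hw.2

theorem contW_eq {Q : ℝ × ℝ × ℝ → ℂ} {H : ℂ × ℂ → ℝ × ℝ → ℂ}
    (hHQ : ∀ z t, 0 < z.1.re → 0 < z.2.re →
      (2 * Real.pi * Complex.I) ^ 2 * (t.1 * t.2) * oscInt Q z t = H z t)
    {t : ℝ × ℝ} (ht : t.1 * t.2 ≠ 0) {z : ℂ × ℂ} (h1 : 0 < z.1.re) (h2 : 0 < z.2.re) :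
    contW H z t = oscInt Q z t := by
  have ht' : ((t.1 : ℂ) * (t.2 : ℂ)) ≠ 0 := by exact_mod_cast ht
  rw [contW, ← hHQ z t h1 h2, mul_div_cancel_left₀]
  exact mul_ne_zero (pow_ne_zero _ Complex.two_pi_I_ne_zero) ht'

/-- Each entry of the Jacquet integral at g = 1 is a fixed linear combination of oscillatory
integrals of symbols, so the continuations of those assemble to one of the matrix. Its domain
contains the tempered parameters, on which `zOf` has real part 0. -/
theorem isJacquetContinuation (d : Fin 2) {ι : Type*} [Fintype ι] {q : ι → ℝ × ℝ × ℝ → ℂ}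
    {H : ι → ℂ × ℂ → ℝ × ℝ → ℂ} (hq : ∀ p, IsSymbol (q p)) (hH : ∀ p, IsGood (H p))
    (hHQ : ∀ p z t, 0 < z.1.re → 0 < z.2.re →
      (2 * Real.pi * Complex.I) ^ 2 * (t.1 * t.2) * oscInt (q p) z t = H p z t)
    {t : ℝ × ℝ} (ht : t.1 * t.2 ≠ 0)
    (c : ι → Fin (2 * (d : ℕ) + 1) → Fin (2 * (d : ℕ) + 1) → ℂ)
    (hc : ∀ u i j, wignerD d (iwaK (wLong * unip u)) i j = ∑ p, c p i j * q p u) :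
    IsJacquetContinuation d 1 t (zOf ⁻¹' contDom)
      (fun μ => Matrix.of fun i j => ∑ p, c p i j * contW (H p) (zOf μ) t) where
  isOpen := isOpen_contDom.preimage continuous_zOf
  convex := convex_contDom.is_linear_preimage
    (f := zOf) (zCLM.restrictScalars ℝ).toLinearMap.isLinear
  chamber_subset := fun μ hμ => by
    constructor
    · change -(1 / 8) < ((μ : Fin 3 → ℂ) 1 - (μ : Fin 3 → ℂ) 2).re
      rw [Complex.sub_re]
      linarith [hμ.2]
    · change -(1 / 8) < ((μ : Fin 3 → ℂ) 0 - (μ : Fin 3 → ℂ) 1).re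
      rw [Complex.sub_re]
      linarith [hμ.1]
  holomorphic := fun i j => by
    simp only [Matrix.of_apply]
    refine DifferentiableOn.fun_sum fun p _ => DifferentiableOn.const_mul ?_ _
    have h : DifferentiableOn ℂ (fun μ => H p (zOf μ) t) (zOf ⁻¹' contDom) :=
      ((hH p).1 t).comp zCLM.differentiable.differentiableOn fun μ hμ => hμ
    simp only [contW, div_eq_mul_inv]
    exact h.mul_const _
  eq_jacquet := fun μ hμ => by
    have h1 : 0 < (zOf μ).1.re := by
      change 0 < ((μ : Fin 3 → ℂ) 1 - (μ : Fin 3 → ℂ) 2).re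
      rw [Complex.sub_re]
      linarith [hμ.2]
    have h2 : 0 < (zOf μ).2.re := by
      change 0 < ((μ : Fin 3 → ℂ) 0 - (μ : Fin 3 → ℂ) 1).re
      rw [Complex.sub_re]
      linarith [hμ.1]
    ext i j
    simp only [Matrix.of_apply, jacquet, Matrix.mul_one, iFun, Matrix.smul_apply, smul_eq_mul,
      pPow_wLong, hc, contW_eq (hHQ _) ht h1 h2]
    have e : ∀ u, kern (zOf μ) u * (∑ p, c p i j * q p u) * conj (psi t u) =
        ∑ p, c p i j * (kern (zOf μ) u * q p u * conj (psi t u)) := fun u => by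
      rw [Finset.mul_sum, Finset.sum_mul]
      exact Finset.sum_congr rfl fun p _ => by ring
    simp only [e]
    rw [integral_finsetSum]
    · exact Finset.sum_congr rfl fun p _ => by rw [integral_const_mul, oscInt]
    · intro p _
      obtain ⟨C, -, hC⟩ := (hq p).bounded
      have hfi : Integrable fun u => kern (zOf μ) u * q p u :=
        (integrable_kern h1 h2).mul_bdd (c := C) (hq p).continuous.aestronglyMeasurable
          (Filter.Eventually.of_forall hC)
      exact (integrable_mul_conj_psi hfi t).const_mul _

/-! ### The spherical function as a correlation -/

/-- The hypothesis `hd` says that the projection Σ^d_d leaves only a dependence on the last rows of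
the two rotations, which is what the big-cell formula can handle. -/
theorem sphFun_unip (d : Fin 2) {μ : specA} (hμ : μ ∈ specA₀)
    (τ : (Fin 3 → ℝ) → (Fin 3 → ℝ) → ℂ) (hτ : Measurable (Function.uncurry τ))
    (hev : ∀ r s, τ (-r) (-s) = τ r s)
    (hd : ∀ k k', ((wignerD d k)ᴴ * sigmaMat d * wignerD d k').trace = τ (k 2) (k' 2))
    (x : ℝ × ℝ × ℝ) :
    sphFun d μ (unip x) = 1 / (2 * (Real.pi : ℂ) ^ 2) *
      ∫ u, conj (kern (zOf μ) u) * kern (zOf μ) (mulU u x) *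
        τ (unitV (rowU u)) (unitV (rowU (mulU u x))) := by
  obtain ⟨h1, h2⟩ := re_zOf hμ
  rw [← integral_haarK_powAB (zOf μ) h1 h2 τ hτ hev x, sphFun]
  refine integral_congr_ae (Filter.Eventually.of_forall fun k => ?_)
  dsimp only
  set m : Matrix (Fin 3) (Fin 3) ℝ := k.1
  have hm : m ∈ SO3 := k.2
  have hdet : (m * unip x).det = 1 := by
    rw [Matrix.det_mul, det_unip, ((mem_SO3_iff m).1 hm).2, mul_one]
  have hrow : ∀ i, (m * unip x) i = m i ᵥ* unip x := fun i => Matrix.mul_apply_eq_vecMul _ _ i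
  have hcross : (m * unip x) 1 ⨯₃ (m * unip x) 2 = unip (invU x) *ᵥ m 0 := by
    rw [hrow, hrow, cross_vecMul_unip, (cross_of_mem_SO3 hm).1]
  have hk : iwaK (m * unip x) 2 = unitV (m 2 ᵥ* unip x) := by
    have e : iwaK (m * unip x) 2 =
        ((SignType.sign (m * unip x).det : ℝ) * (len ((m * unip x) 2))⁻¹) • (m * unip x) 2 := rfl
    rw [e, hdet, hrow, unitV]
    simp
  rw [iFun, Matrix.mul_smul, Matrix.trace_smul, hd, smul_eq_mul, hk,
    pPow_of_det_eq_one μ hdet, hcross, hrow]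

/-- Fubini for the absolutely convergent cutoff integral, applied with a Gaussian cutoff: it never
vanishes, so it can be divided out. -/
theorem ae_integrable_correlation {Q : ℝ × ℝ × ℝ → ℂ} (hQ : IsSymbol Q) {z : ℂ × ℂ}
    (h1 : 0 ≤ z.1.re) (h2 : 0 ≤ z.2.re) :
    ∀ᵐ x : ℝ × ℝ × ℝ, Integrable fun u =>
      conj (kern z u * Q u) * (kern z (mulU u x) * Q (mulU u x)) := by
  have hg : Integrable fun x : ℝ => Real.exp (-1 * x ^ 2) := integrable_exp_neg_mul_sq one_pos
  have h := (integrable_cutG (by fun_prop) hg hQ 0 one_pos h1 h2).prod_left_ae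
  filter_upwards [h] with x hx
  have hψ : conj (psi 0 x) = 1 := by simp [psi]
  have hne : ((Real.exp (-1 * (x.1 / 1) ^ 2) : ℂ) * (Real.exp (-1 * (x.2.1 / 1) ^ 2) : ℂ)) ≠ 0 :=
    mul_ne_zero (by exact_mod_cast (Real.exp_pos _).ne') (by exact_mod_cast (Real.exp_pos _).ne')
  simp only [cutG, hψ, mul_one] at hx
  exact (integrable_const_mul_iff (IsUnit.mk0 _ hne) _).1 hx

/-- The identity `hτQ` splits the kernel into terms conj(Q_j(u)) Q_j(v), and each yields a
correlation. The integral of the sum may be separated only where every correlation converges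
absolutely, hence for almost every x, which suffices under the integral over U. -/
theorem ae_sphFun_eq (d : Fin 2) {μ : specA} (hμ : μ ∈ specA₀) {ι : Type*} [Fintype ι]
    {Q : ι → ℝ × ℝ × ℝ → ℂ} (hQ : ∀ j, IsSymbol (Q j))
    (τ : (Fin 3 → ℝ) → (Fin 3 → ℝ) → ℂ) (hτ : Measurable (Function.uncurry τ))
    (hev : ∀ r s, τ (-r) (-s) = τ r s)
    (hd : ∀ k k', ((wignerD d k)ᴴ * sigmaMat d * wignerD d k').trace = τ (k 2) (k' 2))
    (hτQ : ∀ u v, τ (unitV (rowU u)) (unitV (rowU v)) = ∑ j, conj (Q j u) * Q j v) :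
    ∀ᵐ x, sphFun d μ (unip x) = 1 / (2 * (Real.pi : ℂ) ^ 2) *
      ∑ j, corr (fun u => kern (zOf μ) u * Q j u) x := by
  obtain ⟨h1, h2⟩ := re_zOf hμ
  have h : ∀ᵐ x : ℝ × ℝ × ℝ, ∀ j, Integrable fun u =>
      conj (kern (zOf μ) u * Q j u) * (kern (zOf μ) (mulU u x) * Q j (mulU u x)) :=
    ae_all_iff.2 fun j => ae_integrable_correlation (hQ j) h1.ge h2.ge
  filter_upwards [h] with x hx
  rw [sphFun_unip d hμ τ hτ hev hd]
  congr 1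
  have e : ∀ u, conj (kern (zOf μ) u) * kern (zOf μ) (mulU u x) *
      τ (unitV (rowU u)) (unitV (rowU (mulU u x))) =
      ∑ j, conj (kern (zOf μ) u * Q j u) * (kern (zOf μ) (mulU u x) * Q j (mulU u x)) := fun u => by
    rw [hτQ, Finset.mul_sum]
    exact Finset.sum_congr rfl fun j _ => by
      rw [map_mul]
      ring
  simp only [e]
  rw [integral_finsetSum _ fun j _ => hx j]
  rfl

/-! ### The limit -/

section Main

variable {α : ℝ → ℝ} {ι : Type*} [Fintype ι] {Q : ι → ℝ × ℝ × ℝ → ℂ}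

theorem ae_cutoffIntegrand_eq (α : ℝ → ℝ) {d : Fin 2} {μ : specA}
    (hs : ∀ᵐ x, sphFun d μ (unip x) = 1 / (2 * (Real.pi : ℂ) ^ 2) *
      ∑ j, corr (fun u => kern (zOf μ) u * Q j u) x) (t : ℝ × ℝ) (R : ℝ) :
    cutoffIntegrand α d t R μ =ᵐ[volume] fun x => 1 / (2 * (Real.pi : ℂ) ^ 2) *
      ∑ j, (α (x.1 / R) : ℂ) * (α (x.2.1 / R) : ℂ) *
        corr (fun u => kern (zOf μ) u * Q j u) x * conj (psi t x) := by
  filter_upwards [hs] with x hx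
  rw [cutoffIntegrand, hx, ← Finset.sum_mul, ← Finset.mul_sum]
  ring

theorem integrable_cutoffIntegrand (hαc : Continuous α) (hαi : Integrable α)
    (hQ : ∀ j, IsSymbol (Q j)) {d : Fin 2} {μ : specA} (hμ : μ ∈ specA₀)
    (hs : ∀ᵐ x, sphFun d μ (unip x) = 1 / (2 * (Real.pi : ℂ) ^ 2) *
      ∑ j, corr (fun u => kern (zOf μ) u * Q j u) x) (t : ℝ × ℝ) {R : ℝ} (hR : 0 < R) :
    Integrable (cutoffIntegrand α d t R μ) := by
  obtain ⟨h1, h2⟩ := re_zOf hμ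
  refine Integrable.congr ?_ (ae_cutoffIntegrand_eq α hs t R).symm
  exact (integrable_finsetSum _ fun j _ =>
    integrable_cutoff_corr hαc hαi (hQ j) t hR h1.ge h2.ge).const_mul _

theorem integral_cutoffIntegrand (hαc : Continuous α) (hαi : Integrable α)
    (hQ : ∀ j, IsSymbol (Q j)) {d : Fin 2} {μ : specA} (hμ : μ ∈ specA₀)
    (hs : ∀ᵐ x, sphFun d μ (unip x) = 1 / (2 * (Real.pi : ℂ) ^ 2) *
      ∑ j, corr (fun u => kern (zOf μ) u * Q j u) x) (t : ℝ × ℝ) {R : ℝ} (hR : 0 < R) :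
    ∫ x, cutoffIntegrand α d t R μ x =
      1 / (2 * (Real.pi : ℂ) ^ 2) * ∑ j, cutInt α (Q j) t R (zOf μ) := by
  obtain ⟨h1, h2⟩ := re_zOf hμ
  rw [integral_congr_ae (ae_cutoffIntegrand_eq α hs t R), integral_const_mul,
    integral_finsetSum _ fun j _ => integrable_cutoff_corr hαc hαi (hQ j) t hR h1.ge h2.ge]
  rfl

theorem tendstoUniformlyOn_sum {X : Type*} {F : ι → ℝ → X → ℂ} {f : ι → X → ℂ} {s : Set X}
    (h : ∀ j, TendstoUniformlyOn (F j) (f j) Filter.atTop s) :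
    TendstoUniformlyOn (fun R x => ∑ j, F j R x) (fun x => ∑ j, f j x) Filter.atTop s := by
  classical
  suffices H : ∀ S : Finset ι, TendstoUniformlyOn (fun R x => ∑ j ∈ S, F j R x)
      (fun x => ∑ j ∈ S, f j x) Filter.atTop s from H Finset.univ
  intro S
  induction S using Finset.induction_on with
  | empty =>
    simp only [Finset.sum_empty]
    exact fun V hV => Filter.Eventually.of_forall fun R x _ => refl_mem_uniformity hV
  | insert a S ha ih =>
    simp only [Finset.sum_insert ha]
    exact (h a).add ih

theorem limit_of_decomposition {d : Fin 2} {t : ℝ × ℝ} (ht : t.1 * t.2 ≠ 0)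
    (hα0 : α 0 = 1) (hαc : Continuous α) (hαi : Integrable α)
    (hFc : Continuous (𝓕 fun x : ℝ => (α x : ℂ)))
    (hαk : HasCompactSupport (𝓕 fun x : ℝ => (α x : ℂ)))
    (hQ : ∀ j, IsSymbol (Q j)) {H : ι → ℂ × ℂ → ℝ × ℝ → ℂ} (hH : ∀ j, IsGood (H j))
    (hHQ : ∀ j z t, 0 < z.1.re → 0 < z.2.re →
      (2 * Real.pi * Complex.I) ^ 2 * (t.1 * t.2) * oscInt (Q j) z t = H j z t)
    (hs : ∀ μ ∈ specA₀, ∀ᵐ x, sphFun d μ (unip x) = 1 / (2 * (Real.pi : ℂ) ^ 2) *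
      ∑ j, corr (fun u => kern (zOf μ) u * Q j u) x)
    (hw : ∀ μ ∈ specA₀, ((whittaker d 1 μ t)ᴴ * sigmaMat d * whittaker d 1 μ t).trace =
      ∑ j, conj (contW (H j) (zOf μ) t) * contW (H j) (zOf μ) t) :
    (∀ μ ∈ specA₀,
      (∀ R : ℝ, 0 < R → Integrable (cutoffIntegrand α d t R μ)) ∧
      Filter.Tendsto (fun R : ℝ => ∫ x, cutoffIntegrand α d t R μ x) Filter.atTop
        (𝓝 (1 / (2 * (Real.pi : ℂ) ^ 2) *
          ((whittaker d 1 (negConj μ) t)ᴴ * sigmaMat d * whittaker d 1 μ t).trace))) ∧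
    (∀ C ⊆ specA₀, IsCompact C →
      TendstoUniformlyOn (fun (R : ℝ) (μ : specA) => ∫ x, cutoffIntegrand α d t R μ x)
        (fun μ => 1 / (2 * (Real.pi : ℂ) ^ 2) *
          ((whittaker d 1 (negConj μ) t)ᴴ * sigmaMat d * whittaker d 1 μ t).trace)
        Filter.atTop C) := by
  have key : ∀ C ⊆ specA₀, IsCompact C →
      TendstoUniformlyOn (fun (R : ℝ) (μ : specA) => ∫ x, cutoffIntegrand α d t R μ x)
        (fun μ => 1 / (2 * (Real.pi : ℂ) ^ 2) *
          ((whittaker d 1 (negConj μ) t)ᴴ * sigmaMat d * whittaker d 1 μ t).trace)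
        Filter.atTop C := by
    intro C hC hCc
    have hz : ∀ z ∈ zOf '' C, 0 ≤ z.1.re ∧ 0 ≤ z.2.re := by
      rintro _ ⟨μ, hμ, rfl⟩
      exact ⟨(re_zOf (hC hμ)).1.ge, (re_zOf (hC hμ)).2.ge⟩
    have h1 := tendstoUniformlyOn_sum fun j =>
      ((tendstoUniformlyOn_cutInt hα0 hαc hαi hFc hαk (hQ j) (hH j) (hHQ j) ht
        (hCc.image continuous_zOf) hz).comp zOf).mono (Set.subset_preimage_image zOf C)
    have h2 := (uniformContinuous_const_smul (1 / (2 * (Real.pi : ℂ) ^ 2))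
      (X := ℂ)).comp_tendstoUniformlyOn h1
    refine (h2.congr ?_).congr_right fun μ hμ => ?_
    · filter_upwards [Filter.eventually_gt_atTop 0] with R hR μ hμ
      exact (integral_cutoffIntegrand hαc hαi hQ (hC hμ) (hs μ (hC hμ)) t hR).symm
    · rw [negConj_of_mem (hC hμ), hw μ (hC hμ)]
      rfl
  refine ⟨fun μ hμ => ⟨fun R hR => integrable_cutoffIntegrand hαc hαi hQ hμ (hs μ hμ) t hR, ?_⟩, key⟩
  exact (key {μ} (Set.singleton_subset_iff.2 hμ) isCompact_singleton).tendsto_at rfl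

end Main

/-! ### The two weights -/

theorem sphBasis_mul_conjTranspose : sphBasis * sphBasisᴴ = 1 := by
  have hs : (√2 : ℂ)⁻¹ * (√2 : ℂ)⁻¹ = 1 / 2 := by
    rw [← mul_inv, ← Complex.ofReal_mul, Real.mul_self_sqrt (by norm_num)]
    norm_num
  ext i j
  fin_cases i <;> fin_cases j <;>
    simp [sphBasis, Matrix.mul_apply, Fin.sum_univ_three, Matrix.conjTranspose_apply]
  · linear_combination 2 * hs
  · linear_combination 2 * hs - 2 * ((√2 : ℂ)⁻¹ * (√2 : ℂ)⁻¹) * Complex.I_sq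

/-- The projection keeps only the middle rows, so the trace is their Hermitian inner product, and
the unitary change of basis drops out of it. -/
theorem trace_sigmaMat_one {A B : Matrix (Fin 3) (Fin 3) ℂ} {a b : Fin 3 → ℂ}
    (hA : A 1 = a ᵥ* sphBasis) (hB : B 1 = b ᵥ* sphBasis) :
    (Aᴴ * (!![0, 0, 0; 0, 1, 0; 0, 0, 0] : Matrix (Fin 3) (Fin 3) ℂ) * B).trace =
      ∑ j, conj (a j) * b j := by
  have e : (Aᴴ * (!![0, 0, 0; 0, 1, 0; 0, 0, 0] : Matrix (Fin 3) (Fin 3) ℂ) * B).trace =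
      B 1 ⬝ᵥ star (A 1) := by
    simp [Matrix.trace, Matrix.mul_apply, Fin.sum_univ_three, Matrix.conjTranspose_apply,
      dotProduct, mul_comm]
  rw [e, hA, hB, Matrix.star_vecMul, ← Matrix.dotProduct_mulVec, Matrix.mulVec_mulVec,
    sphBasis_mul_conjTranspose, Matrix.one_mulVec]
  simp only [dotProduct, Pi.star_apply, mul_comm]
  rfl

theorem wignerD_one_apply (k : Matrix (Fin 3) (Fin 3) ℝ) (i j : Fin 3) :
    (wignerD 1 k : Matrix (Fin 3) (Fin 3) ℂ) i j =
      ∑ p : Fin 3 × Fin 3, (conj (sphBasis p.1 i) * sphBasis p.2 j) * (k p.1 p.2 : ℂ) := by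
  change (sphBasisᴴ * k.map (fun a : ℝ => (a : ℂ)) * sphBasis) i j = _
  rw [Fintype.sum_prod_type, Finset.sum_comm]
  simp only [Matrix.mul_apply, Finset.sum_mul, Matrix.conjTranspose_apply, Matrix.map_apply]
  refine Finset.sum_congr rfl fun b _ => Finset.sum_congr rfl fun a _ => ?_
  rw [RCLike.star_def]
  ring

/-- The middle basis vector is (0, 0, 1), so conjugation by it selects the last row. -/
theorem sum_sphBasis_row_one (w : Fin 3 × Fin 3 → ℂ) :
    (fun j => ∑ p : Fin 3 × Fin 3, (conj (sphBasis p.1 1) * sphBasis p.2 j) * w p) =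
      (fun b => w (2, b)) ᵥ* sphBasis := by
  funext j
  rw [Fintype.sum_prod_type]
  simp [sphBasis, Fin.sum_univ_three, Matrix.vecMul, dotProduct, mul_comm]

theorem wignerD_one_row_one (k : Matrix (Fin 3) (Fin 3) ℝ) :
    (wignerD 1 k : Matrix (Fin 3) (Fin 3) ℂ) 1 = (fun b => (k 2 b : ℂ)) ᵥ* sphBasis := by
  rw [← sum_sphBasis_row_one fun p => (k p.1 p.2 : ℂ)]
  exact funext fun j => wignerD_one_apply k 1 j

theorem trace_weight_zero (k k' : Matrix (Fin 3) (Fin 3) ℝ) :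
    ((wignerD 0 k)ᴴ * sigmaMat 0 * wignerD 0 k').trace = 1 := by
  rw [sigmaMat_zero]
  change ((1 : Matrix (Fin 1) (Fin 1) ℂ)ᴴ * 1 * 1).trace = 1
  simp

theorem trace_weight_one (k k' : Matrix (Fin 3) (Fin 3) ℝ) :
    ((wignerD 1 k)ᴴ * sigmaMat 1 * wignerD 1 k').trace = ∑ b, (k 2 b : ℂ) * (k' 2 b : ℂ) := by
  rw [sigmaMat_one]
  refine (trace_sigmaMat_one (wignerD_one_row_one k) (wignerD_one_row_one k')).trans ?_
  simp only [Complex.conj_ofReal]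

theorem trace_whittaker_zero {H : ℂ × ℂ → ℝ × ℝ → ℂ} (hH : IsGood H)
    (hHQ : ∀ z t, 0 < z.1.re → 0 < z.2.re →
      (2 * Real.pi * Complex.I) ^ 2 * (t.1 * t.2) * oscInt (fun _ => 1) z t = H z t)
    {t : ℝ × ℝ} (ht : t.1 * t.2 ≠ 0) {μ : specA} (hμ : zOf μ ∈ contDom) :
    ((whittaker 0 1 μ t)ᴴ * sigmaMat 0 * whittaker 0 1 μ t).trace =
      conj (contW H (zOf μ) t) * contW H (zOf μ) t := by
  have hJ := isJacquetContinuation 0 (ι := Unit) (q := fun _ _ => 1) (H := fun _ => H)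
    (fun _ => .const 1) (fun _ => hH) (fun _ => hHQ) ht (fun _ _ _ => 1) (fun u i j => by
      change (1 : Matrix (Fin 1) (Fin 1) ℂ) i j = _
      have : i = j := Subsingleton.elim (α := Fin 1) i j
      rw [this, Matrix.one_apply_eq]
      simp)
  rw [whittaker_eq hJ hμ, sigmaMat_zero]
  change ((Matrix.of fun _ _ => ∑ _ : Unit, 1 * contW H (zOf μ) t : Matrix (Fin 1) (Fin 1) ℂ)ᴴ *
    (1 : Matrix (Fin 1) (Fin 1) ℂ) * (Matrix.of fun _ _ => ∑ _ : Unit, 1 * contW H (zOf μ) t :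
      Matrix (Fin 1) (Fin 1) ℂ)).trace = _
  simp [Matrix.trace, Matrix.mul_apply]

theorem trace_whittaker_one {H : Fin 3 × Fin 3 → ℂ × ℂ → ℝ × ℝ → ℂ} (hH : ∀ p, IsGood (H p))
    (hHQ : ∀ p z t, 0 < z.1.re → 0 < z.2.re →
      (2 * Real.pi * Complex.I) ^ 2 * (t.1 * t.2) *
        oscInt (fun u => ((iwaK (wLong * unip u) p.1 p.2 : ℝ) : ℂ)) z t = H p z t)
    {t : ℝ × ℝ} (ht : t.1 * t.2 ≠ 0) {μ : specA} (hμ : zOf μ ∈ contDom) :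
    ((whittaker 1 1 μ t)ᴴ * sigmaMat 1 * whittaker 1 1 μ t).trace =
      ∑ b, conj (contW (H (2, b)) (zOf μ) t) * contW (H (2, b)) (zOf μ) t := by
  have hJ := isJacquetContinuation 1 (fun p : Fin 3 × Fin 3 => isSymbol_iwaK p.1 p.2) hH hHQ ht
    (fun p i j => conj (sphBasis p.1 i) * sphBasis p.2 j) fun u i j => wignerD_one_apply _ i j
  rw [whittaker_eq hJ hμ, sigmaMat_one]
  have hrow := sum_sphBasis_row_one fun p => contW (H p) (zOf μ) t
  exact trace_sigmaMat_one hrow hrow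

end GL3
end

theorem mainTheorem8 (d : Fin 2) (t : ℝ × ℝ) (ht : t.1 * t.2 ≠ 0)
    (α : ℝ → ℝ) (hα0 : α 0 = 1) (hαc : Continuous α) (hαi : Integrable α)
    (hαs : ContDiff ℝ ∞ (𝓕 (fun x : ℝ => (α x : ℂ))))
    (hαk : HasCompactSupport (𝓕 (fun x : ℝ => (α x : ℂ)))) :
    (∀ μ ∈ specA₀,
      (∀ R : ℝ, 0 < R → Integrable (cutoffIntegrand α d t R μ)) ∧
      Filter.Tendsto (fun R : ℝ => ∫ x, cutoffIntegrand α d t R μ x) Filter.atTop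
        (𝓝 (1 / (2 * (Real.pi : ℂ) ^ 2) *
          ((whittaker d 1 (negConj μ) t)ᴴ * sigmaMat d * whittaker d 1 μ t).trace))) ∧
    (∀ C ⊆ specA₀, IsCompact C →
      TendstoUniformlyOn (fun (R : ℝ) (μ : specA) => ∫ x, cutoffIntegrand α d t R μ x)
        (fun μ => 1 / (2 * (Real.pi : ℂ) ^ 2) *
          ((whittaker d 1 (negConj μ) t)ᴴ * sigmaMat d * whittaker d 1 μ t).trace)
        Filter.atTop C) := by
  have hdom : ∀ μ ∈ specA₀, zOf μ ∈ contDom := fun μ hμ => by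
    obtain ⟨h1, h2⟩ := re_zOf hμ
    exact ⟨by rw [h1]; norm_num, by rw [h2]; norm_num⟩
  obtain rfl | rfl : d = 0 ∨ d = 1 := by omega
  · obtain ⟨H, hH, hHQ⟩ := exists_continuation (IsSymbol.const 1)
    -- In weight 0 the representation is trivial, and a single correlation with Q = 1 represents the
    -- spherical function.
    refine limit_of_decomposition (ι := Unit) (Q := fun _ _ => 1) (H := fun _ => H) ht hα0 hαc hαi
      hαs.continuous hαk (fun _ => .const 1) (fun _ => hH) (fun _ => hHQ) (fun μ hμ => ?_)
      fun μ hμ => ?_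
    · exact ae_sphFun_eq 0 hμ (fun _ => .const 1) (fun _ _ => 1) measurable_const
        (fun _ _ => rfl) trace_weight_zero fun u v => by simp
    · rw [trace_whittaker_zero hH hHQ ht (hdom μ hμ)]
      simp
  · choose H hH hHQ using fun p : Fin 3 × Fin 3 => exists_continuation (isSymbol_iwaK p.1 p.2)
    -- The continuation of the full Whittaker matrix needs all nine entries of the K-part, but Σ^1_1
    -- retains only the three of its last row. The minus sign in that row cancels, since it enters
    -- each product twice.
    refine limit_of_decomposition (Q := fun b u => ((iwaK (wLong * unip u) 2 b : ℝ) : ℂ))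
      (H := fun b => H (2, b)) ht hα0 hαc hαi hαs.continuous hαk (fun b => isSymbol_iwaK 2 b)
      (fun b => hH (2, b)) (fun b => hHQ (2, b)) (fun μ hμ => ?_) fun μ hμ => ?_
    · refine ae_sphFun_eq 1 hμ (fun b => isSymbol_iwaK 2 b)
        (fun r s => ∑ b, (r b : ℂ) * (s b : ℂ)) (by unfold Function.uncurry; fun_prop)
        (fun r s => by simp) trace_weight_one fun u v => ?_
      simp [iwaK_wLong_row_two]
    · exact trace_whittaker_one hH hHQ ht (hdom μ hμ)
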